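/- **Conventions.** Let $P$ be a left cancellative monoid with identity $e$ and group of invertible elements $P^*$. Write $p\le q$ if $q\in pP$. A right LCM $\vee U$ of $U\subset P$ is a common right multiple of the elements of $U$ that left-divides every other one (it is determined up to right multiplication by $P^*$); $\vee U=\infty$ if there is none. $P$ is a *right LCM monoid* if any two elements with a common right multiple have a right LCM. $P$ is *Noetherian* if there is no infinite descending sequence for the proper factor relation ($f$ is a proper factor of $g$ if $g=xfy$ with $x$ or $y$ not invertible). $P_a$ is the set of atoms. *Trees.* A list is a map $\lambda:\{1,\dots,n\}\to P\cup\{\infty\}$. It is a *leaf* if all its values lie in $P_a\cup\{\infty\}$ or if some value is invertible. If $\lambda$ is not a leaf, let $i$ be the first index for which $\lambda(i)=pq$ with $p,q\in P\setminus P^*$, choose such a factorisation, let $\lambda_1$ be $\lambda$ with $\lambda(i)$ replaced by $p$, and let $\lambda_2(j)=p^{-1}(p\vee\lambda(j))$ (for some choice of right LCM), with $\lambda_2(j)=\infty$ if $p\vee\lambda(j)=\infty$. Iterating $\lambda\mapsto\lambda_1,\lambda_2$ and stopping at leaves gives a binary tree rooted at $\lambda$. *Positivity.* Let $X=\{X_p\}_{p\in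 P}$ be a product system of $C^*$-correspondences over a $C^*$-algebra $A$ with $X_e=A$, let $N:P\to(0,\infty)$ be a homomorphism with $N|_{P^*}=1$, let $\beta\in\mathbb R$ and let $\tau$ be a tracial state of $A$. For $a\in A_+$ put $\operatorname{Tr}^p_\tau(a)=\sup_H\sum_{\xi\in H}\tau(\langle\xi,a\xi\rangle)\in[0,\infty]$, the supremum being over the finite $H\subset X_p$ with $\sum_{\xi\in H}\theta_{\xi,\xi}\le1$. For $R\subset P$ say that $\tau$ is *positive on $R$* if $$\tau(a)+\sum_{\emptyset\ne K\subset J}(-1)^{|K|}N(\vee K)^{-\beta}\operatorname{Tr}_\tau^{\vee K}(a)\ \ge\ 0\qquad\text{for all finite }J\subset R\text{ and all }a\in A_+,$$ where the terms with $\vee K=\infty$ are zero. When $P^*\neq\{e\}$ we assume that $\operatorname{Tr}_\tau^{pu}(a)=\operatorname{Tr}_\tau^{p}(a)$ for all $p\in P$, $u\in P^*$, $a\in A_+$, so that these sums do not depend on the choice of the right LCMs $\vee K$; this is void when $P^*=\{e\}$. **Theorem.** (1) Let $P$ be a Noetherian right LCM monoid in which any two elements have a common right multiple. Then every list $\lambda$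 in $P\cup\{\infty\}$ has a tree as above, and every such tree (for all choices of factorisations and right LCMs) is finite. Moreover positivity reduces to atoms: for all $A,X,N,\beta,\tau$ as above, $\tau$ is positive on $P\setminus\{e\}$ if and only if it is positive on $P_a$. (2) Let $A_M^+$ be an Artin monoid of finite type, i.e. the Coxeter group of the Coxeter matrix $M$ is finite, with canonical generating set $S$. Then reduction of positivity to generators holds: for all $A$, $X$, $N:A_M^+\to(0,\infty)$, $\beta$, $\tau$ as above, $\tau$ is positive on $A_M^+\setminus\{e\}$ if and only if it is positive on $S$. -/

import Mathlib

open scoped ENNReal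

/-! ### Monoids: right least common multiples, Noetherianity

In a monoid, Mathlib's `p ∣ q` means `∃ x, q = p * x`, i.e. `p` is a left divisor of `q`
(`q ∈ pP`). Atoms are Mathlib's `Irreducible` elements: non-invertible elements `s` such that
`s = x * y` forces `x` or `y` to be invertible. -/

/-- `r` is a right LCM of `U`: a right multiple of every element of `U` that left-divides every
other common right multiple. -/
def IsRightLCM {P : Type*} [Monoid P] (U : Set P) (r : P) : Prop :=
  (∀ p ∈ U, p ∣ r) ∧ ∀ r' : P, (∀ p ∈ U, p ∣ r') → r ∣ r'

/-- Any two elements with a common right multiple have a right LCM. (Together with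
left cancellation this is the definition of a right LCM monoid.) -/
def HasConditionalRightLCMs (P : Type*) [Monoid P] : Prop :=
  ∀ p q : P, (∃ r, p ∣ r ∧ q ∣ r) → ∃ r, IsRightLCM {p, q} r

/-- `f` is a proper factor of `g`. -/
def IsProperFactor {P : Type*} [Monoid P] (f g : P) : Prop :=
  ∃ x y : P, g = x * f * y ∧ (¬ IsUnit x ∨ ¬ IsUnit y)

/-- There is no infinite descending sequence for the proper factor relation. -/
def IsFactorNoetherian (P : Type*) [Monoid P] : Prop :=
  WellFounded (IsProperFactor (P := P))

/-- Any two elements have a common right multiple. -/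
def IsRightDirected (P : Type*) [Monoid P] : Prop :=
  ∀ x y : P, ∃ z, x ∣ z ∧ y ∣ z

/-! ### Lists in `P ∪ {∞}` and their trees -/

/-- An `n`-list in `P ∪ {∞}`. -/
abbrev ExtList (P : Type*) (n : ℕ) := Fin n → WithTop P

/-- A list is a leaf if all its entries are atoms or `∞`, or if some entry is invertible. -/
def IsLeaf {P : Type*} [Monoid P] {n : ℕ} (l : ExtList P n) : Prop :=
  (∀ j, l j = ⊤ ∨ ∃ s : P, Irreducible s ∧ l j = (s : WithTop P)) ∨
    ∃ (j : Fin n) (u : P), IsUnit u ∧ l j = (u : WithTop P)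

/-- `x = pq` for some non-invertible `p`, `q` in `P`. -/
def HasNontrivialFactorisation {P : Type*} [Monoid P] (x : WithTop P) : Prop :=
  ∃ p q : P, ¬ IsUnit p ∧ ¬ IsUnit q ∧ x = ((p * q : P) : WithTop P)

/-- `y` is a possible value of `p⁻¹ (p ∨ x)`, where `p ∨ x` is any choice of right LCM of `p` and
`x`; it is `∞` if there is none, and if `x = ∞`. -/
def IsResidual {P : Type*} [Monoid P] (p : P) (x y : WithTop P) : Prop :=
  (∃ x' y' : P, x = (x' : WithTop P) ∧ y = (y' : WithTop P) ∧ IsRightLCM {p, x'} (p * y')) ∨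
    (y = ⊤ ∧ ∀ x' : P, x = (x' : WithTop P) → ¬ ∃ m, IsRightLCM {p, x'} m)

/-- One iteration step: at the first index `i` where the entry has a nontrivial factorisation,
choose one, `l i = p * q`; the list `l₁` has `p` in place of `p * q`, and `l₂` is obtained by
applying `x ↦ p⁻¹ (p ∨ x)` to every entry. -/
def IsSplitting {P : Type*} [Monoid P] {n : ℕ} (l l₁ l₂ : ExtList P n) : Prop :=
  ∃ (i : Fin n) (p q : P), ¬ IsUnit p ∧ ¬ IsUnit q ∧ l i = ((p * q : P) : WithTop P) ∧
    (∀ j < i, ¬ HasNontrivialFactorisation (l j)) ∧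
    l₁ = Function.update l i (p : WithTop P) ∧
    ∀ j, IsResidual p (l j) (l₂ j)

/-- The nodes of a tree labelled by lists, as words in two symbols (`0`, `1` stand for the symbols
`1`, `2`): a word is a node when no proper initial subword of it carries a leaf. -/
def treeNodes {P : Type*} [Monoid P] {n : ℕ} (Λ : List (Fin 2) → ExtList P n) :
    Set (List (Fin 2)) :=
  {ω | ∀ ω', ω' <+: ω → ω' ≠ ω → ¬ IsLeaf (Λ ω')}

/-- `Λ` is a tree of the list `l` (for some choices of factorisations and of right LCMs):
the root carries `l`, and every node `ω` that is not a leaf is split into the two nodes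
`ω1`, `ω2`. The values of `Λ` at words that are not nodes are irrelevant. -/
def IsListTree {P : Type*} [Monoid P] {n : ℕ} (l : ExtList P n)
    (Λ : List (Fin 2) → ExtList P n) : Prop :=
  Λ [] = l ∧ ∀ ω ∈ treeNodes Λ, ¬ IsLeaf (Λ ω) →
    IsSplitting (Λ ω) (Λ (ω ++ [0])) (Λ (ω ++ [1]))

/-! ### C*-correspondences and product systems -/

/-- A C*-correspondence structure over `A` on a complex Banach space `E`: a right Hilbert
`A`-module (inner product `⟪x, y⟫` linear in `y`, whose norm is that of `E`) with a left action
of `A` by adjointable operators. (Mathlib's `CStarModule` is about left modules.) -/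
structure CStarCorrespondence (A : Type*) [NonUnitalCStarAlgebra A] [PartialOrder A]
    [StarOrderedRing A] (E : Type*) [NormedAddCommGroup E] [NormedSpace ℂ E]
    [CompleteSpace E] where
  /-- the `A`-valued inner product -/
  ip : E → E → A
  /-- the right action -/
  rsmul : E → A → E
  /-- the left action -/
  lsmul : A → E → E
  add_rsmul : ∀ x y a, rsmul (x + y) a = rsmul x a + rsmul y a
  rsmul_add : ∀ x a b, rsmul x (a + b) = rsmul x a + rsmul x b
  rsmul_mul : ∀ x a b, rsmul x (a * b) = rsmul (rsmul x a) b
  smul_rsmul : ∀ (c : ℂ) x a, rsmul (c • x) a = c • rsmul x a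
  rsmul_smul : ∀ (c : ℂ) x a, rsmul x (c • a) = c • rsmul x a
  ip_add : ∀ x y z, ip x (y + z) = ip x y + ip x z
  ip_smul : ∀ (c : ℂ) x y, ip x (c • y) = c • ip x y
  ip_rsmul : ∀ x y a, ip x (rsmul y a) = ip x y * a
  star_ip : ∀ x y, star (ip x y) = ip y x
  ip_self_nonneg : ∀ x, 0 ≤ ip x x
  norm_sq : ∀ x, ‖x‖ ^ 2 = ‖ip x x‖
  add_lsmul : ∀ a b x, lsmul (a + b) x = lsmul a x + lsmul b x
  smul_lsmul : ∀ (c : ℂ) a x, lsmul (c • a) x = c • lsmul a x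
  mul_lsmul : ∀ a b x, lsmul (a * b) x = lsmul a (lsmul b x)
  ip_lsmul : ∀ a x y, ip (lsmul a x) y = ip x (lsmul (star a) y)

/-- The induced trace `Tr_τ(T)` of a positive operator `T` on `E`: the supremum of
`∑_{ξ ∈ H} τ(⟪ξ, T ξ⟫)` over the finite subsets `H` of `E` with `∑_{ξ ∈ H} θ_{ξ,ξ} ≤ 1`, where
`θ_{ξ,ξ} η = ξ ⟪ξ, η⟫`; the operator inequality is `⟪η, (∑ θ_{ξ,ξ}) η⟫ ≤ ⟪η, η⟫` for all `η`. -/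
noncomputable def CStarCorrespondence.inducedTrace {A : Type*} [NonUnitalCStarAlgebra A]
    [PartialOrder A] [StarOrderedRing A] {E : Type*} [NormedAddCommGroup E] [NormedSpace ℂ E]
    [CompleteSpace E] (c : CStarCorrespondence A E) (τ : A →L[ℂ] ℂ) (T : E → E) : ℝ≥0∞ :=
  ⨆ (H : Finset E) (_ : ∀ η, ∑ ξ ∈ H, c.ip η (c.rsmul ξ (c.ip ξ η)) ≤ c.ip η η),
    ∑ ξ ∈ H, ENNReal.ofReal (τ (c.ip ξ (T ξ))).re

/-- A product system over `P` of C*-correspondences over `A`. The product of `ξ ∈ X_p` and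
`ζ ∈ X_q` is written `mul h ξ ζ ∈ X_r` for any proof `h` of `p * q = r`. -/
structure ProductSystem (P : Type*) [Monoid P] (A : Type*) [NonUnitalCStarAlgebra A]
    [PartialOrder A] [StarOrderedRing A] where
  /-- the fibres -/
  X : P → Type*
  [normedAddCommGroup : ∀ p, NormedAddCommGroup (X p)]
  [normedSpace : ∀ p, NormedSpace ℂ (X p)]
  [completeSpace : ∀ p, CompleteSpace (X p)]
  /-- each fibre is a C*-correspondence over `A` -/
  corr : ∀ p, CStarCorrespondence A (X p)
  /-- the multiplication `X_p × X_q → X_{pq}` -/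
  mul : ∀ {p q r : P}, p * q = r → X p → X q → X r
  mul_assoc' : ∀ {p q s pq qs r : P} (h₁ : p * q = pq) (h₂ : pq * s = r) (h₃ : q * s = qs)
    (h₄ : p * qs = r) (ξ : X p) (ζ : X q) (η : X s),
    mul h₂ (mul h₁ ξ ζ) η = mul h₄ ξ (mul h₃ ζ η)
  /-- the multiplication preserves the inner product of `X_p ⊗_A X_q` … -/
  ip_mul : ∀ {p q r : P} (h : p * q = r) (ξ ξ' : X p) (ζ ζ' : X q),
    (corr r).ip (mul h ξ ζ) (mul h ξ' ζ') = (corr q).ip ζ ((corr q).lsmul ((corr p).ip ξ ξ') ζ')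
  /-- … and, for `p ≠ e`, has dense linear span, so that it extends to an isometric isomorphism
  of `X_p ⊗_A X_q` onto `X_{pq}` -/
  dense_mul : ∀ {p q r : P} (h : p * q = r), p ≠ 1 →
    Dense (Submodule.span ℂ {x : X r | ∃ ξ ζ, x = mul h ξ ζ} : Set (X r))
  /-- the identification of `A` with `X_e` -/
  unitEquiv : A ≃ₗᵢ[ℂ] X 1
  ip_unit : ∀ a b, (corr 1).ip (unitEquiv a) (unitEquiv b) = star a * b
  lsmul_unit : ∀ a b, (corr 1).lsmul a (unitEquiv b) = unitEquiv (a * b)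
  rsmul_unit : ∀ a b, (corr 1).rsmul (unitEquiv a) b = unitEquiv (a * b)
  unit_mul : ∀ (p : P) (a : A) (ξ : X p), mul (one_mul p) (unitEquiv a) ξ = (corr p).lsmul a ξ
  mul_unit : ∀ (p : P) (ξ : X p) (a : A), mul (mul_one p) ξ (unitEquiv a) = (corr p).rsmul ξ a

attribute [instance] ProductSystem.normedAddCommGroup ProductSystem.normedSpace
  ProductSystem.completeSpace

/-- A tracial state: a positive linear functional of norm one with `τ(ab) = τ(ba)`. -/
structure IsTracialState {A : Type*} [NonUnitalCStarAlgebra A] [PartialOrder A]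
    (τ : A →L[ℂ] ℂ) : Prop where
  nonneg : ∀ a, 0 ≤ a → 0 ≤ (τ a).re ∧ (τ a).im = 0
  norm_eq_one : ‖τ‖ = 1
  map_mul_comm : ∀ a b, τ (a * b) = τ (b * a)

namespace ProductSystem

variable {P : Type*} [Monoid P] {A : Type*} [NonUnitalCStarAlgebra A] [PartialOrder A]
  [StarOrderedRing A]

/-- `Tr_τ^p(a)`, for `a ∈ A_+` acting on `X_p` from the left. -/
noncomputable def tr (X : ProductSystem P A) (τ : A →L[ℂ] ℂ) (p : P) (a : A) : ℝ≥0∞ :=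
  (X.corr p).inducedTrace τ ((X.corr p).lsmul a)

/-- `Tr_τ^p` on `A_+` depends only on the class `pP*`. This is what makes `Tr_τ^{∨K}` independent
of the choice of the right LCM `∨K`; it is void if `P* = {e}`. -/
def TraceUnitInvariant (X : ProductSystem P A) (τ : A →L[ℂ] ℂ) : Prop :=
  ∀ (p u : P), IsUnit u → ∀ a, 0 ≤ a → X.tr τ (p * u) a = X.tr τ p a

open Classical in
/-- The summand `(-1)^{|K|} N(∨K)^{-β} Tr_τ^{∨K}(a)`, which is `0` if `∨K = ∞`. -/
noncomputable def summand (X : ProductSystem P A) (N : P →* ℝ) (β : ℝ) (τ : A →L[ℂ] ℂ)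
    (K : Finset P) (a : A) : EReal :=
  if h : ∃ r, IsRightLCM (K : Set P) r then
    (((-1) ^ K.card * N h.choose ^ (-β) : ℝ) : EReal) * (X.tr τ h.choose a : EReal)
  else 0

/-- The positivity condition for all finite subsets `J` of `R`:
`τ(a) + ∑_{∅ ≠ K ⊆ J} (-1)^{|K|} N(∨K)^{-β} Tr_τ^{∨K}(a) ≥ 0` for all `a ∈ A_+`. The sum is taken
in the extended reals; for `J = {p}` the condition says that `Tr_τ^p(a) ≤ N(p)^β τ(a)`. -/
def PositivityOn (X : ProductSystem P A) (N : P →* ℝ) (β : ℝ) (τ : A →L[ℂ] ℂ)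
    (R : Set P) : Prop :=
  ∀ J : Finset P, (J : Set P) ⊆ R → ∀ a : A, 0 ≤ a →
    0 ≤ ((τ a).re : EReal) + ∑ K ∈ J.powerset with K.Nonempty, X.summand N β τ K a

end ProductSystem

/-! ### Artin monoids -/

/-- The alternating word `s t s ⋯` of length `m`. -/
def alternatingFrom {B : Type*} (s t : B) : ℕ → List B
  | 0 => []
  | m + 1 => s :: alternatingFrom t s m

/-- The defining relations `⟨st⟩^{m_{st}} = ⟨ts⟩^{m_{ts}}` for `m_{st} ≠ ∞` (in Mathlib's Coxeter
matrices the entry `∞` is written `0`). -/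
def CoxeterMatrix.artinRel {B : Type*} (M : CoxeterMatrix B) (v w : FreeMonoid B) : Prop :=
  ∃ s t : B, M s t ≠ 0 ∧ v = FreeMonoid.ofList (alternatingFrom s t (M s t)) ∧
    w = FreeMonoid.ofList (alternatingFrom t s (M t s))

/-- The Artin monoid of a Coxeter matrix. -/
abbrev CoxeterMatrix.ArtinMonoid {B : Type*} (M : CoxeterMatrix B) : Type _ :=
  PresentedMonoid M.artinRel

/-- The canonical generators of the Artin monoid. -/
def CoxeterMatrix.artinGenerators {B : Type*} (M : CoxeterMatrix B) : Set M.ArtinMonoid :=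
  Set.range (PresentedMonoid.of M.artinRel)

/-!
Think of `Φ(p) = N(p)^(-β) Tr^p(a)` as the measure of the right ideal `pP`. The sum that defines
positivity is then the measure of the complement of the union of the ideals `xᵢP` for the entries
`xᵢ` of a list. If `xᵢ = p q`, this complement splits into the complement for the list `λ₁`, where
`xᵢ` is replaced by `p`, and the part inside `pP`, which is `p` times the complement for `λ₂`. As
`Tr^{pr}(a)` is the limit of the sums of `Tr^r(⟨ξ, aξ⟩)` over approximate frames of `X_p`,
positivity for `λ₂` gives positivity of the second part. Hence positivity propagates from the leaves
of the tree, which involve only atoms, to the root.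

For an Artin monoid of finite type, the weak order on the finite Coxeter group is a lattice. The
right complement `u⁻¹ (u ∨ v)` of this lattice extends along words to an action of the Artin monoid,
which lets one cancel generators, produces common right multiples, and shows that the lift of
`s ∨ t` is the right least common multiple of the generators `s` and `t`.
-/

open Filter Topology

/-! ### Finiteness of trees -/

section Trees

universe u

variable {P : Type u} [Monoid P] {n : ℕ}

theorem IsProperFactor.mul_left {p : P} (q : P) (hp : ¬ IsUnit p) : IsProperFactor q (p * q) :=
  ⟨p, 1, by simp, Or.inl hp⟩

theorem IsProperFactor.mul_right (p : P) {q : P} (hq : ¬ IsUnit q) : IsProperFactor p (p * q) :=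
  ⟨1, q, by simp, Or.inr hq⟩

theorem mul_dvd_mul_iff_left_of_isLeftCancelMul [IsLeftCancelMul P] (p x y : P) :
    p * x ∣ p * y ↔ x ∣ y := by
  refine ⟨fun ⟨c, hc⟩ => ⟨c, mul_left_cancel (a := p) ?_⟩, mul_dvd_mul_left p⟩
  rw [hc, mul_assoc]

theorem exists_isUnit_of_dvd_dvd [IsLeftCancelMul P] {p q : P} (hpq : p ∣ q) (hqp : q ∣ p) :
    ∃ u, IsUnit u ∧ q = p * u := by
  obtain ⟨u, rfl⟩ := hpq
  obtain ⟨v, hv⟩ := hqp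
  have huv : u * v = 1 := by rwa [mul_assoc, eq_comm, mul_eq_left] at hv
  have hvu : v * u = 1 := mul_left_cancel (a := u) (by rw [← mul_assoc, huv, one_mul, mul_one])
  exact ⟨u, ⟨⟨u, v, huv, hvu⟩, rfl⟩, rfl⟩

theorem IsRightLCM.dvd_iff {U : Set P} {r z : P} (h : IsRightLCM U r) :
    r ∣ z ↔ ∀ u ∈ U, u ∣ z :=
  ⟨fun hz u hu => (h.1 u hu).trans hz, h.2 z⟩

theorem IsResidual.dvd [IsLeftCancelMul P] {p y m : P} {x : WithTop P}
    (h : IsResidual p x (y : WithTop P)) (hx : ∀ x' : P, x = (x' : WithTop P) → x' ∣ p * m) :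
    y ∣ m := by
  rcases h with ⟨x', y', hx', hy, hlcm⟩ | ⟨hy, -⟩
  · obtain rfl := WithTop.coe_injective hy
    exact (mul_dvd_mul_iff_left_of_isLeftCancelMul p y m).mp
      (hlcm.dvd_iff.mpr (by simp [hx x' hx']))
  · exact absurd hy WithTop.coe_ne_top

theorem exists_isResidual (p : P) (x : WithTop P) : ∃ y, IsResidual p x y := by
  by_cases h : ∃ x' m : P, x = (x' : WithTop P) ∧ IsRightLCM {p, x'} m
  · obtain ⟨x', m, rfl, hm⟩ := h
    obtain ⟨y', rfl⟩ := hm.1 p (by simp)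
    exact ⟨y', Or.inl ⟨x', y', rfl, rfl, hm⟩⟩
  · exact ⟨⊤, Or.inr ⟨rfl, fun x' hx' ⟨m, hm⟩ => h ⟨x', m, hx', hm⟩⟩⟩

theorem exists_hasNontrivialFactorisation_of_not_isLeaf {l : ExtList P n} (h : ¬ IsLeaf l) :
    ∃ i, HasNontrivialFactorisation (l i) := by
  obtain ⟨hatom, hunit⟩ := not_or.mp h
  push Not at hatom hunit
  obtain ⟨i, htop, hirr⟩ := hatom
  obtain ⟨x, hx⟩ := WithTop.ne_top_iff_exists.mp htop
  have hxu : ¬ IsUnit x := fun hu => hunit i x hu hx.symm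
  by_contra hf
  refine hirr x ⟨hxu, fun {p q} hpq => ?_⟩ hx.symm
  by_contra! hpq'
  exact hf ⟨i, p, q, hpq'.1, hpq'.2, by rw [← hx, hpq]⟩

theorem exists_isSplitting {l : ExtList P n} (h : ¬ IsLeaf l) :
    ∃ l₁ l₂, IsSplitting l l₁ l₂ := by
  obtain ⟨i, ⟨p, q, hp, hq, hpq⟩, hmin⟩ := WellFounded.has_min (wellFounded_lt (α := Fin n))
    {i | HasNontrivialFactorisation (l i)} (exists_hasNontrivialFactorisation_of_not_isLeaf h)
  choose l₂ hl₂ using fun j => exists_isResidual p (l j)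
  exact ⟨_, l₂, i, p, q, hp, hq, hpq, fun j hj hf => hmin j hf hj, rfl, hl₂⟩

theorem exists_isListTree (l : ExtList P n) : ∃ Λ, IsListTree l Λ := by
  classical
  choose f g hfg using fun (l : {l : ExtList P n // ¬ IsLeaf l}) => exists_isSplitting l.2
  let child : ExtList P n → Fin 2 → ExtList P n := fun l b =>
    if h : IsLeaf l then l else if b = 0 then f ⟨l, h⟩ else g ⟨l, h⟩
  refine ⟨fun ω => ω.foldl child l, rfl, fun ω _ hω => ?_⟩
  simpa only [List.foldl_append, List.foldl_cons, List.foldl_nil, child, hω, dite_false,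
    ↓reduceIte, one_ne_zero] using hfg ⟨_, hω⟩

/-- `l'` is one of the two lists obtained by splitting `l`; trees terminate because this relation
is well-founded below every list with a common right multiple. -/
def IsSplittingChild (l' l : ExtList P n) : Prop :=
  ∃ l₁ l₂, IsSplitting l l₁ l₂ ∧ (l' = l₁ ∨ l' = l₂)

/-- The height of an entry for the proper factor relation. The value `0` at `∞` is a junk value:
infinite entries are never split. -/
noncomputable def entryRank (hN : IsFactorNoetherian P) (x : WithTop P) : Ordinal.{u} :=
  have : IsWellFounded P IsProperFactor := ⟨hN⟩
  x.recTopCoe 0 (IsWellFounded.rank IsProperFactor)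

theorem update_entryRank_lt (hN : IsFactorNoetherian P) {l : ExtList P n} {i : Fin n} {p q : P}
    (hq : ¬ IsUnit q) (hpq : l i = ((p * q : P) : WithTop P)) :
    entryRank hN ∘ Function.update l i (p : WithTop P) < entryRank hN ∘ l := by
  rw [Function.comp_update, update_lt_self_iff, Function.comp_apply, hpq]
  have : IsWellFounded P IsProperFactor := ⟨hN⟩
  exact IsWellFounded.rank_lt_of_rel (.mul_right p hq)

/-- A first child keeps the common right multiple `m` and lowers the rank of an entry, while a
second child has the proper factor `p⁻¹ m` of `m` as a common right multiple. -/
theorem acc_isSplittingChild [IsLeftCancelMul P] (hN : IsFactorNoetherian P) (m : P)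
    (l : ExtList P n) (hl : ∀ j (x : P), l j = (x : WithTop P) → x ∣ m) :
    Acc IsSplittingChild l := by
  induction m using hN.induction generalizing l with
  | _ m ihm =>
    induction l using (InvImage.wf (entryRank hN ∘ ·)
      (wellFounded_lt (α := Fin n → Ordinal.{u}))).induction with
    | _ l ihl =>
      refine ⟨_, ?_⟩
      rintro l' ⟨l₁, l₂, ⟨i, p, q, hp, hq, hpq, -, rfl, hres⟩, rfl | rfl⟩
      · refine ihl _ (update_entryRank_lt hN hq hpq) fun j x hx => ?_
        rcases eq_or_ne j i with rfl | hj
        · rw [Function.update_self] at hx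
          exact WithTop.coe_injective hx ▸ (Dvd.intro q rfl).trans (hl j _ hpq)
        · exact hl j x (by rwa [Function.update_of_ne hj] at hx)
      · obtain ⟨m', rfl⟩ : p ∣ m := (Dvd.intro q rfl).trans (hl i _ hpq)
        exact ihm m' (.mul_left m' hp) _ fun j y hy => (hy ▸ hres j).dvd (hl j)

theorem IsListTree.subtree {l : ExtList P n} {Λ : List (Fin 2) → ExtList P n}
    (hΛ : IsListTree l Λ) (hl : ¬ IsLeaf l) (b : Fin 2) :
    IsListTree (Λ [b]) fun ω => Λ (b :: ω) := by
  refine ⟨rfl, fun ω hω => hΛ.2 (b :: ω) fun ω' hpre hne => ?_⟩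
  rcases ω' with _ | ⟨c, ω'⟩
  · rwa [hΛ.1]
  · obtain ⟨rfl, hpre'⟩ := List.cons_prefix_cons.mp hpre
    exact hω ω' hpre' fun h => hne (by rw [h])

theorem treeNodes_subset (Λ : List (Fin 2) → ExtList P n) :
    treeNodes Λ ⊆ {[]} ∪ ⋃ b, List.cons b '' treeNodes fun ω => Λ (b :: ω) := by
  rintro (_ | ⟨b, ω⟩) hω
  · exact Or.inl rfl
  · refine Or.inr (Set.mem_iUnion.mpr ⟨b, ω, fun ω' hpre hne => ?_, rfl⟩)
    exact hω (b :: ω') (List.cons_prefix_cons.mpr ⟨rfl, hpre⟩) (by simpa using hne)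

theorem treeNodes_finite_of_acc {l : ExtList P n} (hl : Acc IsSplittingChild l)
    {Λ : List (Fin 2) → ExtList P n} (hΛ : IsListTree l Λ) : (treeNodes Λ).Finite := by
  induction hl generalizing Λ with
  | intro l _ ih =>
    by_cases hleaf : IsLeaf l
    · refine (Set.finite_singleton []).subset fun ω hω => ?_
      by_contra hne
      exact hω [] List.nil_prefix (Ne.symm hne) (by rwa [hΛ.1])
    · have hsplit : IsSplitting l (Λ [0]) (Λ [1]) := hΛ.1 ▸ hΛ.2 [] (fun ω' hpre hne =>
        absurd (List.prefix_nil.mp hpre) hne) (by rwa [hΛ.1])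
      have hchild : ∀ b : Fin 2, IsSplittingChild (Λ [b]) l :=
        Fin.forall_fin_two.mpr ⟨⟨_, _, hsplit, Or.inl rfl⟩, ⟨_, _, hsplit, Or.inr rfl⟩⟩
      exact ((Set.finite_singleton _).union (Set.finite_iUnion fun b =>
        (ih _ (hchild b) (hΛ.subtree hleaf b)).image _)).subset (treeNodes_subset Λ)

theorem IsRightDirected.exists_forall_dvd (hD : IsRightDirected P) {U : Set P} (hU : U.Finite) :
    ∃ m, ∀ u ∈ U, u ∣ m := by
  have hdir : Directed (· ∣ ·) (id : P → P) := hD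
  simpa using hdir.finset_le hU.toFinset

theorem treeNodes_finite [IsLeftCancelMul P] (hN : IsFactorNoetherian P) (hD : IsRightDirected P)
    {l : ExtList P n} {Λ : List (Fin 2) → ExtList P n} (hΛ : IsListTree l Λ) :
    (treeNodes Λ).Finite := by
  obtain ⟨m, hm⟩ := hD.exists_forall_dvd
    ((Set.finite_range l).preimage (WithTop.coe_injective (α := P)).injOn)
  exact treeNodes_finite_of_acc (acc_isSplittingChild hN m l fun j x hx => hm x ⟨j, hx⟩) hΛ

end Trees

/-! ### Alternating sums over right least common multiples -/

section AltSum

variable {P : Type*} [Monoid P]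

theorem isRightLCM_pair_iff {p q r : P} :
    IsRightLCM {p, q} r ↔ p ∣ r ∧ q ∣ r ∧ ∀ z, p ∣ z → q ∣ z → r ∣ z := by
  simp only [IsRightLCM, Set.forall_mem_insert, Set.mem_singleton_iff, forall_eq, and_assoc,
    and_imp]

theorem isRightLCM_pair_of_dvd {x r : P} (h : x ∣ r) : IsRightLCM {x, r} r :=
  isRightLCM_pair_iff.mpr ⟨h, dvd_rfl, fun _ _ => id⟩

theorem IsRightLCM.mul_left [IsLeftCancelMul P] {p q r : P}
    (h : IsRightLCM {p, q} r) (x : P) : IsRightLCM {x * p, x * q} (x * r) := by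
  rw [isRightLCM_pair_iff] at h ⊢
  refine ⟨mul_dvd_mul_left x h.1, mul_dvd_mul_left x h.2.1, ?_⟩
  rintro _ ⟨c, rfl⟩ hq
  rw [mul_assoc, mul_dvd_mul_iff_left_of_isLeftCancelMul] at hq ⊢
  exact h.2.2 _ (dvd_mul_right p c) hq

/-- Every finite set of elements has a right LCM. -/
def HasFiniteRightLCMs (P : Type*) [Monoid P] : Prop :=
  ∀ U : Set P, U.Finite → ∃ r, IsRightLCM U r

theorem HasConditionalRightLCMs.hasFiniteRightLCMs (hL : HasConditionalRightLCMs P)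
    (hD : IsRightDirected P) : HasFiniteRightLCMs P := by
  intro U hU
  induction U, hU using Set.Finite.induction_on with
  | empty => exact ⟨1, by simp, fun _ _ => one_dvd _⟩
  | @insert u U _ _ ih =>
    obtain ⟨r, hr⟩ := ih
    obtain ⟨t, ht⟩ := hL u r (hD u r)
    have hdvd : ∀ z, t ∣ z ↔ ∀ v ∈ insert u U, v ∣ z := fun z => by
      simp [ht.dvd_iff, hr.dvd_iff]
    exact ⟨t, (hdvd t).mp dvd_rfl, fun z => (hdvd z).mpr⟩

open Classical in
/-- A right LCM of `U`, with the junk value `1` if there is none. -/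
noncomputable def rightLCM (U : Set P) : P :=
  if h : ∃ r, IsRightLCM U r then h.choose else 1

theorem HasFiniteRightLCMs.isRightLCM (hP : HasFiniteRightLCMs P) {U : Set P} (hU : U.Finite) :
    IsRightLCM U (rightLCM U) := by
  rw [rightLCM, dif_pos (hP U hU)]
  exact (hP U hU).choose_spec

/-- `Φ p` depends only on the right ideal `pP`. -/
def DependsOnRightIdeal (Φ : P → ℝ) : Prop :=
  ∀ ⦃x y : P⦄, x ∣ y → y ∣ x → Φ x = Φ y

theorem DependsOnRightIdeal.congr {Φ : P → ℝ} (hΦ : DependsOnRightIdeal Φ) {x y : P}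
    (h : ∀ z, x ∣ z ↔ y ∣ z) : Φ x = Φ y :=
  hΦ ((h y).mpr dvd_rfl) ((h x).mp dvd_rfl)

theorem DependsOnRightIdeal.comp_mul_left {Φ : P → ℝ} (hΦ : DependsOnRightIdeal Φ) (p : P) :
    DependsOnRightIdeal fun r => Φ (p * r) :=
  fun _ _ h h' => hΦ (mul_dvd_mul_left p h) (mul_dvd_mul_left p h')

/-- The alternating sum `∑_{K ⊆ s} (-1)^|K| Φ(r ∨ ⋁_{i ∈ K} x i)`. If `Φ q` is thought of as the
measure of `qP`, this is the measure of `rP` minus the union of the `(x i)P`, `i ∈ s`. -/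
noncomputable def altSum {ι : Type*} (Φ : P → ℝ) (x : ι → P) (s : Finset ι) (r : P) : ℝ :=
  ∑ K ∈ s.powerset, (-1) ^ K.card * Φ (rightLCM (insert r (x '' K)))

variable {ι : Type*} {Φ : P → ℝ} {x : ι → P} {s : Finset ι} {r : P}

theorem altSum_congr {x' : ι → P} (h : ∀ i ∈ s, x i = x' i) : altSum Φ x s r = altSum Φ x' s r := by
  refine Finset.sum_congr rfl fun K hK => ?_
  rw [Set.image_congr fun i hi => h i (Finset.mem_powerset.mp hK hi)]

theorem altSum_empty (hP : HasFiniteRightLCMs P) (hΦ : DependsOnRightIdeal Φ) :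
    altSum Φ x ∅ r = Φ r := by
  have hr : Φ (rightLCM {r}) = Φ r :=
    hΦ.congr fun z => by simp [(hP.isRightLCM (Set.finite_singleton r)).dvd_iff]
  simp [altSum, hr]

theorem altSum_insert [DecidableEq ι] (hP : HasFiniteRightLCMs P) (hΦ : DependsOnRightIdeal Φ)
    {i : ι} (hi : i ∉ s) {t : P} (ht : IsRightLCM {x i, r} t) :
    altSum Φ x (insert i s) r = altSum Φ x s r - altSum Φ x s t := by
  rw [altSum, Finset.sum_powerset_insert hi, sub_eq_add_neg, altSum, altSum,
    ← Finset.sum_neg_distrib]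
  refine congrArg _ (Finset.sum_congr rfl fun K hK => ?_)
  have hlcm : Φ (rightLCM (insert r (x '' ↑(insert i K)))) = Φ (rightLCM (insert t (x '' K))) :=
    hΦ.congr fun z => by
      rw [(hP.isRightLCM (Set.toFinite _)).dvd_iff, (hP.isRightLCM (Set.toFinite _)).dvd_iff]
      simp only [Finset.coe_insert, Set.image_insert_eq, Set.forall_mem_insert, ht.dvd_iff,
        Set.mem_singleton_iff, forall_eq]
      tauto
  rw [hlcm, Finset.card_insert_of_notMem fun h => hi (Finset.mem_powerset.mp hK h), pow_succ]
  ring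

theorem altSum_insert_one [DecidableEq ι] (hP : HasFiniteRightLCMs P)
    (hΦ : DependsOnRightIdeal Φ) {i : ι} (hi : i ∉ s) :
    altSum Φ x (insert i s) 1 = altSum Φ x s 1 - altSum Φ x s (x i) :=
  altSum_insert hP hΦ hi (Set.pair_comm _ _ ▸ isRightLCM_pair_of_dvd (one_dvd _))

theorem altSum_eq_zero_of_dvd (hP : HasFiniteRightLCMs P) (hΦ : DependsOnRightIdeal Φ) {i : ι}
    (hi : i ∈ s) (hir : x i ∣ r) : altSum Φ x s r = 0 := by
  classical
  rw [← Finset.insert_erase hi, altSum_insert hP hΦ (s.notMem_erase i) (isRightLCM_pair_of_dvd hir),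
    sub_self]

theorem altSum_image [DecidableEq P] (hP : HasFiniteRightLCMs P) (hΦ : DependsOnRightIdeal Φ)
    (x : ι → P) (s : Finset ι) (r : P) : altSum Φ id (s.image x) r = altSum Φ x s r := by
  classical
  induction s using Finset.induction_on generalizing r with
  | empty => rw [Finset.image_empty, altSum_empty hP hΦ, altSum_empty hP hΦ]
  | insert i s hi ih =>
    obtain ⟨t, ht⟩ := hP {x i, r} (Set.toFinite _)
    rw [Finset.image_insert, altSum_insert hP hΦ hi ht]
    by_cases hx : x i ∈ s.image x
    · rw [Finset.insert_eq_of_mem hx, ih, ← ih t,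
        altSum_eq_zero_of_dvd hP hΦ hx (ht.1 (x i) (by simp)), sub_zero]
    · rw [altSum_insert hP hΦ hx ht, ih, ih]

theorem altSum_base_congr (hP : HasFiniteRightLCMs P) (hΦ : DependsOnRightIdeal Φ) {r' : P}
    (h : ∀ z, r ∣ z ↔ r' ∣ z) : altSum Φ x s r = altSum Φ x s r' := by
  refine Finset.sum_congr rfl fun K _ => congrArg _ (hΦ.congr fun z => ?_)
  rw [(hP.isRightLCM (Set.toFinite _)).dvd_iff, (hP.isRightLCM (Set.toFinite _)).dvd_iff]
  simp [h]

theorem altSum_mul_left [IsLeftCancelMul P] (hP : HasFiniteRightLCMs P)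
    (hΦ : DependsOnRightIdeal Φ) {p : P} {y : ι → P}
    (hy : ∀ i, IsRightLCM {p, x i} (p * y i)) :
    altSum Φ x s (p * r) = altSum (fun t => Φ (p * t)) y s r := by
  refine Finset.sum_congr rfl fun K _ => congrArg _ (hΦ.congr fun z => ?_)
  by_cases hpz : p ∣ z
  · obtain ⟨w, rfl⟩ := hpz
    have hxy : ∀ i, x i ∣ p * w ↔ y i ∣ w := fun i => by
      rw [← mul_dvd_mul_iff_left_of_isLeftCancelMul p (y i), (hy i).dvd_iff]
      simp
    rw [(hP.isRightLCM (Set.toFinite _)).dvd_iff, mul_dvd_mul_iff_left_of_isLeftCancelMul,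
      (hP.isRightLCM (Set.toFinite _)).dvd_iff]
    simp [mul_dvd_mul_iff_left_of_isLeftCancelMul, hxy]
  · refine iff_of_false (fun h => hpz ?_) fun h => hpz ((Dvd.intro _ rfl).trans h)
    exact (Dvd.intro r rfl).trans
      (((hP.isRightLCM (Set.toFinite _)).1 (p * r) (Set.mem_insert _ _)).trans h)

/-- In terms of measures, this cuts the complement of the union of the `(x j)P` along `pP`. -/
theorem altSum_splitting [Fintype ι] [DecidableEq ι] [IsLeftCancelMul P]
    (hP : HasFiniteRightLCMs P) (hΦ : DependsOnRightIdeal Φ) {i : ι} {p q : P}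
    (hi : x i = p * q) {y : ι → P} (hy : ∀ j, IsRightLCM {p, x j} (p * y j)) :
    altSum Φ x Finset.univ 1 = altSum Φ (Function.update x i p) Finset.univ 1 +
      altSum (fun r => Φ (p * r)) y Finset.univ 1 := by
  have hqy : ∀ z, q ∣ z ↔ y i ∣ z := fun z => by
    rw [← mul_dvd_mul_iff_left_of_isLeftCancelMul p q,
      ← mul_dvd_mul_iff_left_of_isLeftCancelMul p (y i), (hy i).dvd_iff]
    simp [hi]
  have hupd : ∀ r, altSum Φ (Function.update x i p) (Finset.univ.erase i) r =
      altSum Φ x (Finset.univ.erase i) r := fun r =>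
    altSum_congr fun j hj => Function.update_of_ne (Finset.ne_of_mem_erase hj) p x
  have hΦp := hΦ.comp_mul_left p
  have hi' := Finset.notMem_erase i Finset.univ
  rw [← Finset.insert_erase (Finset.mem_univ i), altSum_insert_one hP hΦ hi',
    altSum_insert_one hP hΦ hi', altSum_insert_one hP hΦp hi', ← altSum_mul_left hP hΦ hy,
    ← altSum_base_congr hP hΦp hqy, ← altSum_mul_left hP hΦ hy, hupd, hupd, Function.update_self,
    hi, mul_one]
  ring

theorem IsResidual.exists_coe (hP : HasFiniteRightLCMs P) {p x : P} {y : WithTop P}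
    (h : IsResidual p (x : WithTop P) y) :
    ∃ y' : P, y = (y' : WithTop P) ∧ IsRightLCM {p, x} (p * y') := by
  rcases h with ⟨x', y', hx, hy, hlcm⟩ | ⟨-, hnone⟩
  · obtain rfl := WithTop.coe_injective hx
    exact ⟨y', hy, hlcm⟩
  · exact absurd (hP _ (Set.toFinite _)) (hnone x rfl)

variable [IsLeftCancelMul P] {𝒜 : Type*} {Ψ : 𝒜 → P → ℝ}

theorem altSum_nonneg_of_acc (hP : HasFiniteRightLCMs P) (hΨ : ∀ a, DependsOnRightIdeal (Ψ a))
    (hshift : ∀ p, ¬ IsUnit p → ∀ (n : ℕ) (y : Fin n → P),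
      (∀ a, 0 ≤ altSum (Ψ a) y Finset.univ 1) →
      ∀ a, 0 ≤ altSum (fun r => Ψ a (p * r)) y Finset.univ 1)
    (hatoms : ∀ J : Finset P, (∀ s ∈ J, Irreducible s) → ∀ a, 0 ≤ altSum (Ψ a) id J 1)
    {n : ℕ} {x : Fin n → P} (hx : Acc IsSplittingChild fun j => (x j : WithTop P)) (a : 𝒜) :
    0 ≤ altSum (Ψ a) x Finset.univ 1 := by
  classical
  generalize hl : (fun j => (x j : WithTop P)) = l at hx
  induction hx generalizing x a with
  | intro l _ ih =>
    by_cases hleaf : IsLeaf l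
    · subst hl
      rcases hleaf with hirr | ⟨j, u, hu, hxu⟩
      · rw [← altSum_image hP (hΨ a)]
        refine hatoms _ (fun s hs => ?_) a
        obtain ⟨j, -, rfl⟩ := Finset.mem_image.mp hs
        obtain ⟨s, hs, hjs⟩ := (hirr j).resolve_left WithTop.coe_ne_top
        exact WithTop.coe_injective hjs ▸ hs
      · rw [altSum_eq_zero_of_dvd hP (hΨ a) (Finset.mem_univ j)]
        exact WithTop.coe_injective hxu ▸ hu.exists_right_inv.imp fun _ h => h.symm
    · obtain ⟨l₁, l₂, hsplit⟩ := exists_isSplitting hleaf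
      obtain ⟨i, p, q, hp, -, hpq, -, hl₁, hres⟩ := id hsplit
      subst hl
      choose y hy hlcm using fun j => (hres j).exists_coe hP
      rw [altSum_splitting hP (hΨ a) (WithTop.coe_injective hpq) hlcm]
      refine add_nonneg (ih l₁ ⟨l₁, l₂, hsplit, Or.inl rfl⟩ a ?_)
        (hshift p hp n y (fun b => ih l₂ ⟨l₁, l₂, hsplit, Or.inr rfl⟩ b (funext hy).symm) a)
      rw [hl₁]
      exact Function.comp_update _ x i p

theorem altSum_nonneg_of_irreducible (hN : IsFactorNoetherian P) (hD : IsRightDirected P)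
    (hP : HasFiniteRightLCMs P) (hΨ : ∀ a, DependsOnRightIdeal (Ψ a))
    (hshift : ∀ p, ¬ IsUnit p → ∀ (n : ℕ) (y : Fin n → P),
      (∀ a, 0 ≤ altSum (Ψ a) y Finset.univ 1) →
      ∀ a, 0 ≤ altSum (fun r => Ψ a (p * r)) y Finset.univ 1)
    (hatoms : ∀ J : Finset P, (∀ s ∈ J, Irreducible s) → ∀ a, 0 ≤ altSum (Ψ a) id J 1)
    (J : Finset P) (a : 𝒜) : 0 ≤ altSum (Ψ a) id J 1 := by
  classical
  let x : Fin J.card → P := fun j => J.equivFin.symm j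
  have hJ : Finset.univ.image x = J := by
    ext s
    simp only [x, Finset.mem_image, Finset.mem_univ, true_and]
    exact ⟨fun ⟨j, hj⟩ => hj ▸ (J.equivFin.symm j).2, fun hs => ⟨J.equivFin ⟨s, hs⟩, by simp⟩⟩
  obtain ⟨m, hm⟩ := hD.exists_forall_dvd (Set.finite_range x)
  rw [← hJ, altSum_image hP (hΨ a)]
  refine altSum_nonneg_of_acc hP hΨ hshift hatoms (acc_isSplittingChild hN m _ fun j s hs => ?_) a
  exact hm s ⟨j, WithTop.coe_injective hs⟩

end AltSum

/-! ### Hilbert modules and induced traces -/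

section FunctionalCalculus

variable {D : Type*} [NonUnitalCStarAlgebra D]

theorem exists_isSelfAdjoint_add_self_sub_mul_self_eq {h : D} (h₀ : IsSelfAdjoint h)
    (h₁ : ‖h‖ ≤ 1) : ∃ k : D, IsSelfAdjoint k ∧ k + k - k * k = h := by
  let f : ℝ → ℝ := fun t => 1 - √(1 - t)
  have hf : Continuous f := by fun_prop
  have hf0 : f 0 = 0 := by simp [f]
  refine ⟨cfcₙ f h, cfcₙ_predicate f h, ?_⟩
  rw [← cfcₙ_add f f h hf.continuousOn hf0 hf.continuousOn hf0,
    ← cfcₙ_mul f f h hf.continuousOn hf0 hf.continuousOn hf0,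
    ← cfcₙ_sub _ _ h (by fun_prop) (by simp [hf0]) (by fun_prop) (by simp [hf0])]
  conv_rhs => rw [← cfcₙ_id' ℝ h]
  refine cfcₙ_congr fun t ht => ?_
  have ht_norm : ‖t‖ ≤ ‖h‖ :=
    (NonUnitalIsometricContinuousFunctionalCalculus.isGreatest_norm_quasispectrum h h₀).2
      ⟨t, ht, rfl⟩
  have ht_le : t ≤ 1 := (le_abs_self t).trans (ht_norm.trans h₁)
  have := Real.mul_self_sqrt (sub_nonneg.mpr ht_le)
  simp only [f]
  linarith

/-- The function `√t / max t ε`, a bounded continuous approximation of `1 / √t` for `t > 0`. It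
vanishes for `t ≤ 0`, where `Real.sqrt` is `0`. -/
noncomputable def invSqrtApprox (ε t : ℝ) : ℝ := √t / max t ε

theorem invSqrtApprox_zero (ε : ℝ) : invSqrtApprox ε 0 = 0 := by simp [invSqrtApprox]

theorem invSqrtApprox_of_nonpos (ε : ℝ) {t : ℝ} (ht : t ≤ 0) : invSqrtApprox ε t = 0 := by
  simp [invSqrtApprox, Real.sqrt_eq_zero_of_nonpos ht]

theorem continuous_invSqrtApprox {ε : ℝ} (hε : 0 < ε) : Continuous (invSqrtApprox ε) :=
  Real.continuous_sqrt.div (by fun_prop) fun t => (lt_max_of_lt_right hε).ne'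

theorem mul_invSqrtApprox_mul_invSqrtApprox {ε t : ℝ} (ht : 0 ≤ t) :
    t * invSqrtApprox ε t * invSqrtApprox ε t = (t / max t ε) ^ 2 := by
  rw [invSqrtApprox, mul_assoc, div_mul_div_comm, Real.mul_self_sqrt ht]
  ring

theorem norm_mul_invSqrtApprox_mul_invSqrtApprox_le {ε : ℝ} (hε : 0 < ε) (t : ℝ) :
    ‖t * invSqrtApprox ε t * invSqrtApprox ε t‖ ≤ 1 := by
  rcases le_total t 0 with ht | ht
  · simp [invSqrtApprox_of_nonpos ε ht]
  · have hmax : 0 < max t ε := lt_max_of_lt_right hε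
    rw [mul_invSqrtApprox_mul_invSqrtApprox ht, Real.norm_of_nonneg (sq_nonneg _)]
    exact pow_le_one₀ (by positivity) ((div_le_one hmax).mpr (le_max_left t ε))

theorem mul_one_sub_invSqrtApprox_sq_le {ε : ℝ} (hε : 0 < ε) (t : ℝ) :
    t * (1 - t * invSqrtApprox ε t * invSqrtApprox ε t) ^ 2 ≤ ε := by
  rcases le_total t 0 with ht | ht
  · simp only [invSqrtApprox_of_nonpos ε ht, mul_zero, sub_zero, one_pow, mul_one]
    exact ht.trans hε.le
  rw [mul_invSqrtApprox_mul_invSqrtApprox ht]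
  rcases le_total ε t with htε | htε
  · simpa [max_eq_left htε, div_self (hε.trans_le htε).ne'] using hε.le
  · have hratio : (t / max t ε) ^ 2 ≤ 1 :=
      pow_le_one₀ (by positivity) ((div_le_one (lt_max_of_lt_right hε)).mpr (le_max_left t ε))
    have hle : (1 - (t / max t ε) ^ 2) ^ 2 ≤ 1 :=
      pow_le_one₀ (by linarith) (by linarith [sq_nonneg (t / max t ε)])
    nlinarith

theorem cfcₙ_id_mul {G : D} (hG : IsSelfAdjoint G) {f : ℝ → ℝ} (hf : Continuous f)
    (hf0 : f 0 = 0) : G * cfcₙ f G = cfcₙ (fun t => t * f t) G := by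
  rw [cfcₙ_mul (fun t => t) f G continuousOn_id rfl hf.continuousOn hf0, cfcₙ_id' ℝ G]

theorem cfcₙ_mul_id {G : D} (hG : IsSelfAdjoint G) {f : ℝ → ℝ} (hf : Continuous f)
    (hf0 : f 0 = 0) : cfcₙ f G * G = cfcₙ (fun t => t * f t) G := by
  simp only [mul_comm _ (f _)]
  rw [cfcₙ_mul f (fun t => t) G hf.continuousOn hf0 continuousOn_id rfl, cfcₙ_id' ℝ G]

theorem exists_isSelfAdjoint_approximate_inverse_sqrt [PartialOrder D] [StarOrderedRing D] {G : D}
    (hG : IsSelfAdjoint G) {ε : ℝ} (hε : 0 < ε) :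
    ∃ F : D, IsSelfAdjoint F ∧ F * G = G * F ∧ ‖F * G * F‖ ≤ 1 ∧ ∃ p : D, ‖p‖ ≤ ε ∧
      G - G * (F * G * F) - (F * G * F * G - F * G * F * G * (F * G * F)) ≤ p := by
  let f : ℝ → ℝ := invSqrtApprox ε
  have hf : Continuous f := continuous_invSqrtApprox hε
  have hf0 : f 0 = 0 := invSqrtApprox_zero ε
  let e : ℝ → ℝ := fun t => t * f t * f t
  let g : ℝ → ℝ := fun t => t * (1 - e t) ^ 2
  have he : Continuous e := by fun_prop
  have he0 : e 0 = 0 := by simp [e]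
  have hE : cfcₙ f G * G * cfcₙ f G = cfcₙ e G := by
    rw [cfcₙ_mul_id hG hf hf0,
      ← cfcₙ_mul _ f G (by fun_prop) (by simp) hf.continuousOn hf0]
  refine ⟨cfcₙ f G, cfcₙ_predicate f G, ?_, ?_, cfcₙ (fun t => max (g t) 0) G, ?_, ?_⟩
  · rw [cfcₙ_mul_id hG hf hf0, cfcₙ_id_mul hG hf hf0]
  · rw [hE]
    exact norm_cfcₙ_le fun t _ => norm_mul_invSqrtApprox_mul_invSqrtApprox_le hε t
  · refine norm_cfcₙ_le fun t _ => ?_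
    rw [Real.norm_of_nonneg (le_max_right _ _)]
    exact max_le (mul_one_sub_invSqrtApprox_sq_le hε t) hε.le
  · have hG_sub : G - G * cfcₙ e G - (cfcₙ e G * G - cfcₙ e G * G * cfcₙ e G) = cfcₙ g G := by
      rw [cfcₙ_mul_id hG he he0, cfcₙ_id_mul hG he he0,
        ← cfcₙ_mul _ e G (by fun_prop) (by simp) he.continuousOn he0]
      nth_rewrite 1 [← cfcₙ_id' ℝ G]
      rw [← cfcₙ_sub _ _ G (by fun_prop) rfl (by fun_prop) (by simp),
        ← cfcₙ_sub _ _ G (by fun_prop) (by simp) (by fun_prop) (by simp),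
        ← cfcₙ_sub _ _ G (by fun_prop) (by simp) (by fun_prop) (by simp)]
      exact cfcₙ_congr fun t _ => by simp only [g]; ring
    rw [hE, hG_sub]
    exact cfcₙ_mono (fun t _ => le_max_left _ _) (by fun_prop) (by fun_prop) (by simp [g])
      (by simp [g])

end FunctionalCalculus

theorem cstarMatrix_diag_nonneg {A ι : Type*} [NonUnitalCStarAlgebra A] [PartialOrder A]
    [StarOrderedRing A] [Fintype ι] {M : CStarMatrix ι ι A} (hM : 0 ≤ M) (k : ι) :
    0 ≤ M k k := by
  rw [StarOrderedRing.nonneg_iff] at hM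
  induction hM using AddSubmonoid.closure_induction with
  | mem M hM =>
    obtain ⟨Z, rfl⟩ := hM
    change 0 ≤ (star Z * Z) k k
    rw [CStarMatrix.mul_apply]
    exact Finset.sum_nonneg fun j _ => star_mul_self_nonneg (Z j k)
  | zero => exact le_rfl
  | add M N _ _ hM hN => exact add_nonneg hM hN

namespace CStarCorrespondence

variable {A : Type*} [NonUnitalCStarAlgebra A] [PartialOrder A] [StarOrderedRing A]
  {E : Type*} [NormedAddCommGroup E] [NormedSpace ℂ E] [CompleteSpace E]

section Basic

variable (c : CStarCorrespondence A E)

/-- The inner product as an additive map in the second variable. -/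
def ipHom (x : E) : E →+ A := AddMonoidHom.mk' (c.ip x) (c.ip_add x)

theorem ip_zero_right (x : E) : c.ip x 0 = 0 := (c.ipHom x).map_zero

theorem ip_sub_right (x y z : E) : c.ip x (y - z) = c.ip x y - c.ip x z := (c.ipHom x).map_sub y z

theorem ip_sum_right {ι : Type*} (s : Finset ι) (x : E) (f : ι → E) :
    c.ip x (∑ i ∈ s, f i) = ∑ i ∈ s, c.ip x (f i) := map_sum (c.ipHom x) f s

theorem ip_sub_left (x y z : E) : c.ip (x - y) z = c.ip x z - c.ip y z := by
  rw [← c.star_ip, c.ip_sub_right, star_sub, c.star_ip, c.star_ip]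

theorem ip_zero_left (x : E) : c.ip 0 x = 0 := by
  rw [← c.star_ip, c.ip_zero_right, star_zero]

theorem ip_sum_left {ι : Type*} (s : Finset ι) (x : E) (f : ι → E) :
    c.ip (∑ i ∈ s, f i) x = ∑ i ∈ s, c.ip (f i) x := by
  rw [← c.star_ip, c.ip_sum_right, star_sum]
  simp only [c.star_ip]

theorem ip_smul_left (z : ℂ) (x y : E) : c.ip (z • x) y = star z • c.ip x y := by
  rw [← c.star_ip, c.ip_smul, star_smul, c.star_ip]

theorem ip_rsmul_left (x y : E) (a : A) : c.ip (c.rsmul x a) y = star a * c.ip x y := by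
  rw [← c.star_ip, c.ip_rsmul, star_mul, c.star_ip]

theorem ip_lsmul_right (x y : E) (a : A) : c.ip x (c.lsmul a y) = c.ip (c.lsmul (star a) x) y := by
  rw [c.ip_lsmul, star_star]

theorem ip_lsmul_self_nonneg {a : A} (ha : 0 ≤ a) (x : E) : 0 ≤ c.ip x (c.lsmul a x) := by
  obtain ⟨b, rfl⟩ := CStarAlgebra.nonneg_iff_eq_star_mul_self.mp ha
  rw [c.mul_lsmul, c.ip_lsmul_right, star_star]
  exact c.ip_self_nonneg _

theorem eq_zero_of_ip_self {x : E} (h : c.ip x x = 0) : x = 0 := by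
  have := c.norm_sq x
  rw [h, norm_zero] at this
  exact norm_eq_zero.mp (pow_eq_zero_iff two_ne_zero |>.mp this)

theorem ext_ip {x y : E} (h : ∀ z, c.ip z x = c.ip z y) : x = y := by
  rw [← sub_eq_zero]
  exact c.eq_zero_of_ip_self (by rw [c.ip_sub_right, h, sub_self])

theorem norm_le_of_ip_self_le {F : Type*} [NormedAddCommGroup F] [NormedSpace ℂ F]
    [CompleteSpace F] (d : CStarCorrespondence A F) {x : E} {y : F} (h : c.ip x x ≤ d.ip y y) :
    ‖x‖ ≤ ‖y‖ := by
  have := CStarAlgebra.norm_le_norm_of_nonneg_of_le (c.ip_self_nonneg x) h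
  rw [← c.norm_sq, ← d.norm_sq] at this
  exact (pow_le_pow_iff_left₀ (norm_nonneg _) (norm_nonneg _) two_ne_zero).mp this

theorem lsmul_smul (a : A) (z : ℂ) (x : E) : c.lsmul a (z • x) = z • c.lsmul a x :=
  c.ext_ip fun y => by simp only [c.ip_smul, c.ip_lsmul_right]

theorem sub_lsmul (a b : A) (x : E) : c.lsmul (a - b) x = c.lsmul a x - c.lsmul b x :=
  (AddMonoidHom.mk' (fun a => c.lsmul a x) (fun a b => c.add_lsmul a b x)).map_sub a b

theorem sum_lsmul {ι : Type*} (s : Finset ι) (f : ι → A) (x : E) :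
    c.lsmul (∑ i ∈ s, f i) x = ∑ i ∈ s, c.lsmul (f i) x :=
  map_sum (AddMonoidHom.mk' (fun a => c.lsmul a x) (fun a b => c.add_lsmul a b x)) f s

theorem lsmul_sum {ι : Type*} (s : Finset ι) (a : A) (f : ι → E) :
    c.lsmul a (∑ i ∈ s, f i) = ∑ i ∈ s, c.lsmul a (f i) :=
  c.ext_ip fun z => by simp only [c.ip_sum_right, c.ip_lsmul_right]

theorem rsmul_sum {ι : Type*} (s : Finset ι) (x : E) (f : ι → A) :
    c.rsmul x (∑ i ∈ s, f i) = ∑ i ∈ s, c.rsmul x (f i) :=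
  map_sum (AddMonoidHom.mk' (c.rsmul x) (c.rsmul_add x)) f s

theorem sum_rsmul {ι : Type*} (s : Finset ι) (f : ι → E) (a : A) :
    c.rsmul (∑ i ∈ s, f i) a = ∑ i ∈ s, c.rsmul (f i) a :=
  map_sum (AddMonoidHom.mk' (fun x => c.rsmul x a) (fun x y => c.add_rsmul x y a)) f s

theorem star_ip_mul_ip_le {x y : E} (hy : ‖y‖ ≤ 1) :
    star (c.ip y x) * c.ip y x ≤ c.ip x x := by
  set a := c.ip y x with ha
  have h_nonneg : 0 ≤ c.ip (x - c.rsmul y a) (x - c.rsmul y a) := c.ip_self_nonneg _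
  have h_expand : c.ip (x - c.rsmul y a) (x - c.rsmul y a)
      = c.ip x x - star a * a - star a * a + star a * c.ip y y * a := by
    simp only [c.ip_sub_left, c.ip_sub_right, c.ip_rsmul, c.ip_rsmul_left, ← ha]
    rw [← c.star_ip y x, ← ha]
    noncomm_ring
  have h_conj : star a * c.ip y y * a ≤ star a * a := by
    refine (CStarAlgebra.star_left_conjugate_le_norm_smul (c.star_ip y y)).trans ?_
    have : ‖c.ip y y‖ ≤ 1 := by rw [← c.norm_sq]; exact pow_le_one₀ (norm_nonneg _) hy
    simpa using smul_le_smul_of_nonneg_right this (star_mul_self_nonneg a)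
  rw [← sub_nonneg]
  calc 0 ≤ c.ip x x - star a * a - star a * a + star a * c.ip y y * a := h_expand ▸ h_nonneg
    _ ≤ c.ip x x - star a * a - star a * a + star a * a := by gcongr
    _ = c.ip x x - star a * a := by abel

theorem norm_ip_le_of_norm_le_one {x y : E} (hy : ‖y‖ ≤ 1) : ‖c.ip y x‖ ≤ ‖x‖ := by
  have h := CStarAlgebra.norm_le_norm_of_nonneg_of_le (star_mul_self_nonneg _)
    (c.star_ip_mul_ip_le (x := x) hy)
  rw [CStarRing.norm_star_mul_self, ← c.norm_sq, ← sq] at h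
  exact (pow_le_pow_iff_left₀ (norm_nonneg _) (norm_nonneg _) two_ne_zero).mp h

theorem norm_ip_le (y x : E) : ‖c.ip y x‖ ≤ ‖y‖ * ‖x‖ := by
  rcases eq_or_ne y 0 with rfl | hy
  · simp [c.ip_zero_left]
  have h := c.norm_ip_le_of_norm_le_one (x := x) (y := ((‖y‖⁻¹ : ℝ) : ℂ) • y)
    (by simp [norm_smul, hy])
  rw [c.ip_smul_left, norm_smul] at h
  simp only [norm_star, Complex.norm_real, norm_inv, norm_norm] at h
  rwa [inv_mul_le_iff₀ (norm_pos_iff.mpr hy)] at h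

theorem continuous_ip_right (x : E) : Continuous (c.ip x) :=
  AddMonoidHomClass.continuous_of_bound (c.ipHom x) ‖x‖ (c.norm_ip_le x)

theorem ip_lsmul_self_le {h : A} (h₀ : IsSelfAdjoint h) (h₁ : ‖h‖ ≤ 1) (x : E) :
    c.ip x (c.lsmul h x) ≤ c.ip x x := by
  obtain ⟨k, hk, rfl⟩ := exists_isSelfAdjoint_add_self_sub_mul_self_eq h₀ h₁
  rw [← sub_nonneg]
  refine (c.ip_self_nonneg (x - c.lsmul k x)).trans_eq ?_
  simp only [c.ip_sub_left, c.ip_sub_right, c.sub_lsmul, c.add_lsmul, c.ip_add, c.mul_lsmul]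
  rw [c.ip_lsmul, c.ip_lsmul, hk.star_eq]
  abel

theorem norm_lsmul_le_of_norm_le_one {a : A} (ha : ‖a‖ ≤ 1) (x : E) : ‖c.lsmul a x‖ ≤ ‖x‖ := by
  refine c.norm_le_of_ip_self_le c ?_
  rw [c.ip_lsmul a, ← c.mul_lsmul]
  refine c.ip_lsmul_self_le (IsSelfAdjoint.star_mul_self a) ?_ x
  rw [CStarRing.norm_star_mul_self]
  exact mul_le_one₀ ha (norm_nonneg a) ha

theorem norm_lsmul_le (a : A) (x : E) : ‖c.lsmul a x‖ ≤ ‖a‖ * ‖x‖ := by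
  rcases eq_or_ne a 0 with rfl | ha
  · have : c.lsmul 0 x = 0 := by simpa using c.sub_lsmul 0 0 x
    simp [this]
  have h := c.norm_lsmul_le_of_norm_le_one (a := ((‖a‖⁻¹ : ℝ) : ℂ) • a)
    (by simp [norm_smul, ha]) x
  rw [c.smul_lsmul, norm_smul] at h
  simp only [Complex.norm_real, norm_inv, norm_norm] at h
  rwa [inv_mul_le_iff₀ (norm_pos_iff.mpr ha)] at h

/-- The C*-algebra `A` as a correspondence over itself. -/
def self (A : Type*) [NonUnitalCStarAlgebra A] [PartialOrder A] [StarOrderedRing A] :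
    CStarCorrespondence A A where
  ip x y := star x * y
  rsmul x a := x * a
  lsmul a x := a * x
  add_rsmul := add_mul
  rsmul_add := mul_add
  rsmul_mul x a b := (mul_assoc x a b).symm
  smul_rsmul := smul_mul_assoc
  rsmul_smul c x a := mul_smul_comm c x a
  ip_add x := mul_add (star x)
  ip_smul c x y := mul_smul_comm c (star x) y
  ip_rsmul x y a := (mul_assoc (star x) y a).symm
  star_ip x y := by simp
  ip_self_nonneg := star_mul_self_nonneg
  norm_sq x := by rw [CStarRing.norm_star_mul_self, sq]
  add_lsmul := add_mul
  smul_lsmul := smul_mul_assoc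
  mul_lsmul := mul_assoc
  ip_lsmul a x y := by simp [mul_assoc]

end Basic

section MatrixAction

variable (c : CStarCorrespondence A E) {ι : Type*}

/-- The Gram matrix of a tuple of vectors. -/
def gram (x : ι → E) : CStarMatrix ι ι A := CStarMatrix.ofMatrix fun i j => c.ip (x i) (x j)

theorem gram_apply (x : ι → E) (i j : ι) : c.gram x i j = c.ip (x i) (x j) := rfl

theorem isSelfAdjoint_gram (x : ι → E) : IsSelfAdjoint (c.gram x) :=
  CStarMatrix.ext fun i j => by rw [CStarMatrix.star_apply, gram_apply, gram_apply, c.star_ip]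

variable [Fintype ι]

/-- The left action of a matrix over `A` on a tuple of vectors, `(M v)_i = ∑_j M_{ij} v_j`. -/
def matrixLsmul (M : CStarMatrix ι ι A) (v : ι → E) (i : ι) : E := ∑ j, c.lsmul (M i j) (v j)

theorem add_matrixLsmul (M N : CStarMatrix ι ι A) (v : ι → E) (i : ι) :
    c.matrixLsmul (M + N) v i = c.matrixLsmul M v i + c.matrixLsmul N v i := by
  simp only [matrixLsmul, CStarMatrix.add_apply, c.add_lsmul, Finset.sum_add_distrib]

theorem sub_matrixLsmul (M N : CStarMatrix ι ι A) (v : ι → E) (i : ι) :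
    c.matrixLsmul (M - N) v i = c.matrixLsmul M v i - c.matrixLsmul N v i := by
  simp only [matrixLsmul, CStarMatrix.sub_apply, c.sub_lsmul, Finset.sum_sub_distrib]

theorem mul_matrixLsmul (M N : CStarMatrix ι ι A) (v : ι → E) (i : ι) :
    c.matrixLsmul (M * N) v i = c.matrixLsmul M (c.matrixLsmul N v) i := by
  simp only [matrixLsmul, CStarMatrix.mul_apply, c.sum_lsmul, c.mul_lsmul, c.lsmul_sum]
  exact Finset.sum_comm

theorem sum_ip_matrixLsmul_left {M : CStarMatrix ι ι A} (hM : IsSelfAdjoint M) (v w : ι → E) :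
    ∑ i, c.ip (c.matrixLsmul M v i) (w i) = ∑ i, c.ip (v i) (c.matrixLsmul M w i) := by
  simp only [matrixLsmul, c.ip_sum_left, c.ip_sum_right, c.ip_lsmul,
    CStarMatrix.star_apply_of_isSelfAdjoint hM]
  exact Finset.sum_comm

theorem sum_ip_matrixLsmul_self_le {M : CStarMatrix ι ι A} (h₀ : IsSelfAdjoint M) (h₁ : ‖M‖ ≤ 1)
    (v : ι → E) : ∑ i, c.ip (v i) (c.matrixLsmul M v i) ≤ ∑ i, c.ip (v i) (v i) := by
  obtain ⟨K, hK, rfl⟩ := exists_isSelfAdjoint_add_self_sub_mul_self_eq h₀ h₁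
  have h_nonneg : 0 ≤ ∑ i, c.ip (v i - c.matrixLsmul K v i) (v i - c.matrixLsmul K v i) :=
    Finset.sum_nonneg fun i _ => c.ip_self_nonneg _
  rw [← sub_nonneg]
  refine h_nonneg.trans_eq ?_
  simp only [sub_matrixLsmul, add_matrixLsmul, mul_matrixLsmul, c.ip_sub_left, c.ip_sub_right,
    c.ip_add, Finset.sum_sub_distrib, Finset.sum_add_distrib, c.sum_ip_matrixLsmul_left hK]
  abel

/-- The right action of a matrix over `A` on a tuple of vectors, `(x M)_j = ∑_i x_i M_{ij}`. -/
def matrixRsmul (x : ι → E) (M : CStarMatrix ι ι A) (j : ι) : E := ∑ i, c.rsmul (x i) (M i j)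

theorem ip_matrixRsmul_left (x : ι → E) (M : CStarMatrix ι ι A) (i j : ι) :
    c.ip (c.matrixRsmul x M i) (x j) = (star M * c.gram x) i j := by
  simp only [matrixRsmul, CStarMatrix.mul_apply, c.ip_sum_left, c.ip_rsmul_left,
    CStarMatrix.star_apply, gram_apply]

theorem gram_matrixRsmul (x : ι → E) (M : CStarMatrix ι ι A) :
    c.gram (c.matrixRsmul x M) = star M * c.gram x * M := by
  refine CStarMatrix.ext fun i j => ?_
  rw [gram_apply, CStarMatrix.mul_apply]
  conv_lhs => enter [3]; rw [matrixRsmul]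
  simp only [c.ip_sum_right, c.ip_rsmul, c.ip_matrixRsmul_left]

theorem matrixRsmul_mul (x : ι → E) (M N : CStarMatrix ι ι A) (k : ι) :
    c.matrixRsmul (c.matrixRsmul x M) N k = c.matrixRsmul x (M * N) k := by
  simp only [matrixRsmul, CStarMatrix.mul_apply, c.sum_rsmul, c.rsmul_sum, c.rsmul_mul]
  exact Finset.sum_comm

theorem ip_sub_matrixRsmul_self (x : ι → E) {M : CStarMatrix ι ι A} (hM : IsSelfAdjoint M)
    (k : ι) :
    c.ip (x k - c.matrixRsmul x M k) (x k - c.matrixRsmul x M k)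
      = (c.gram x - c.gram x * M - (M * c.gram x - M * c.gram x * M)) k k := by
  have h_left : c.ip (c.matrixRsmul x M k) (x k) = (M * c.gram x) k k := by
    rw [c.ip_matrixRsmul_left, hM.star_eq]
  have h_right : c.ip (x k) (c.matrixRsmul x M k) = (c.gram x * M) k k := by
    rw [← c.star_ip, h_left, ← CStarMatrix.star_apply, star_mul, hM.star_eq,
      (c.isSelfAdjoint_gram x).star_eq]
  have h_both : c.ip (c.matrixRsmul x M k) (c.matrixRsmul x M k) = (M * c.gram x * M) k k := by
    rw [← c.gram_apply, c.gram_matrixRsmul, hM.star_eq]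
  rw [c.ip_sub_left, c.ip_sub_right, c.ip_sub_right, h_left, h_right, h_both]
  rfl

end MatrixAction

/-- A finite family of vectors with `∑ θ_{ξ,ξ} ≤ 1`, in the form: its Gram matrix is a
contraction. -/
structure ContractiveFamily (c : CStarCorrespondence A E) where
  card : ℕ
  vec : Fin card → E
  norm_gram_le : ‖c.gram vec‖ ≤ 1

namespace ContractiveFamily

variable {c : CStarCorrespondence A E}

/-- The operator `∑ θ_{ξ,ξ}`. -/
def frame (ξ : c.ContractiveFamily) (x : E) : E := ∑ i, c.rsmul (ξ.vec i) (c.ip (ξ.vec i) x)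

variable (c) in
theorem exists_forall_norm_sub_frame_le {n : ℕ} (x : Fin n → E) {ε : ℝ} (hε : 0 < ε) :
    ∃ ξ : c.ContractiveFamily, ∀ k, ‖x k - ξ.frame (x k)‖ ≤ ε := by
  obtain ⟨F, hF, hFG, hE_norm, p, hp, hle⟩ :=
    exists_isSelfAdjoint_approximate_inverse_sqrt (c.isSelfAdjoint_gram x) (pow_pos hε 2)
  set E' := F * c.gram x * F with hE'
  have hE_sa : IsSelfAdjoint E' := by
    simpa only [hE', hF.star_eq] using (c.isSelfAdjoint_gram x).conjugate_self hF
  refine ⟨⟨n, c.matrixRsmul x F, ?_⟩, fun k => ?_⟩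
  · rwa [c.gram_matrixRsmul, hF.star_eq]
  have h_frame : frame ⟨n, c.matrixRsmul x F, by rwa [c.gram_matrixRsmul, hF.star_eq]⟩ (x k)
      = c.matrixRsmul x E' k := by
    have h_mul : E' = F * (F * c.gram x) := by rw [hE', mul_assoc, ← hFG]
    rw [h_mul, ← c.matrixRsmul_mul]
    simp only [frame, c.ip_matrixRsmul_left, hF.star_eq]
    rfl
  rw [h_frame]
  have h_ip : c.ip (x k - c.matrixRsmul x E' k) (x k - c.matrixRsmul x E' k) ≤ p k k := by
    rw [c.ip_sub_matrixRsmul_self x hE_sa, ← sub_nonneg, ← CStarMatrix.sub_apply]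
    exact cstarMatrix_diag_nonneg (sub_nonneg.mpr hle) k
  have h_norm := (CStarAlgebra.norm_le_norm_of_nonneg_of_le (c.ip_self_nonneg _) h_ip).trans
    (CStarMatrix.norm_entry_le_norm.trans hp)
  rw [← c.norm_sq] at h_norm
  exact (pow_le_pow_iff_left₀ (norm_nonneg _) hε.le two_ne_zero).mp h_norm

variable (c) in
/-- The filter of contractive families along which `∑ θ_{ξ,ξ}` tends strongly to the identity. -/
def approxId : Filter c.ContractiveFamily := (𝓝 id).comap frame

theorem tendsto_frame (x : E) : Tendsto (fun ξ => ξ.frame x) (approxId c) (𝓝 x) :=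
  tendsto_pi_nhds.mp tendsto_comap x

instance : (approxId c).NeBot := by
  refine comap_neBot fun s hs => ?_
  rw [nhds_pi, mem_pi] at hs
  obtain ⟨I, hI, t, ht, hts⟩ := hs
  have h_ball : ∀ᶠ ε in 𝓝[>] (0 : ℝ), ∀ x ∈ I, Metric.closedBall x ε ⊆ t x :=
    (hI.eventually_all).mpr fun x _ => by
      obtain ⟨δ, hδ, hδt⟩ := Metric.nhds_basis_closedBall.mem_iff.mp (ht x)
      filter_upwards [Ioo_mem_nhdsGT hδ] with ε hε
      exact (Metric.closedBall_subset_closedBall hε.2.le).trans hδt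
  obtain ⟨ε, hball, hε⟩ := (h_ball.and self_mem_nhdsWithin).exists
  obtain ⟨ξ, hξ⟩ := exists_forall_norm_sub_frame_le c
    (fun k => ((hI.toFinset.equivFin.symm k : hI.toFinset) : E)) hε
  refine ⟨ξ, hts fun x hx => hball x hx ?_⟩
  rw [mem_closedBall_iff_norm']
  simpa using hξ (hI.toFinset.equivFin ⟨x, by simpa using hx⟩)

end ContractiveFamily

section Bessel

variable {c : CStarCorrespondence A E} {F : Type*} [NormedAddCommGroup F] [NormedSpace ℂ F]
  [CompleteSpace F] {d : CStarCorrespondence A F} {ι : Type*} [Fintype ι] {T : ι → F → E}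
  {S : ι → E → F} {G : CStarMatrix ι ι A}

theorem ip_sum_adjoint_left (hTS : ∀ i y z, c.ip (T i y) z = d.ip y (S i z)) (z w : E) :
    c.ip (∑ i, T i (S i z)) w = ∑ i, d.ip (S i z) (S i w) := by
  simp only [c.ip_sum_left, hTS]

theorem ip_sum_adjoint_self_le (hTS : ∀ i y z, c.ip (T i y) z = d.ip y (S i z))
    (hST : ∀ i j y, S i (T j y) = d.lsmul (G i j) y) (hG : IsSelfAdjoint G) (hG₁ : ‖G‖ ≤ 1)
    (z : E) :
    c.ip (∑ i, T i (S i z)) (∑ i, T i (S i z)) ≤ ∑ i, d.ip (S i z) (S i z) := by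
  refine le_of_eq_of_le ?_ (d.sum_ip_matrixLsmul_self_le hG hG₁ fun i => S i z)
  simp only [c.ip_sum_left, c.ip_sum_right, d.ip_sum_right, hTS, hST, matrixLsmul]

theorem sum_ip_adjoint_self_le (hTS : ∀ i y z, c.ip (T i y) z = d.ip y (S i z))
    (hST : ∀ i j y, S i (T j y) = d.lsmul (G i j) y) (hG : IsSelfAdjoint G) (hG₁ : ‖G‖ ≤ 1)
    (z : E) : ∑ i, d.ip (S i z) (S i z) ≤ c.ip z z := by
  have h_nonneg := c.ip_self_nonneg (z - ∑ i, T i (S i z))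
  have h_right : c.ip z (∑ i, T i (S i z)) = ∑ i, d.ip (S i z) (S i z) := by
    rw [← c.star_ip, ip_sum_adjoint_left hTS, star_sum]
    simp only [d.star_ip]
  rw [c.ip_sub_left, c.ip_sub_right, c.ip_sub_right, ip_sum_adjoint_left hTS, h_right] at h_nonneg
  exact sub_nonneg.mp ((sub_nonneg.mpr (ip_sum_adjoint_self_le hTS hST hG hG₁ z)).trans
    (sub_nonneg.mp h_nonneg))

theorem norm_sum_adjoint_le (hTS : ∀ i y z, c.ip (T i y) z = d.ip y (S i z))
    (hST : ∀ i j y, S i (T j y) = d.lsmul (G i j) y) (hG : IsSelfAdjoint G) (hG₁ : ‖G‖ ≤ 1)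
    (z : E) : ‖∑ i, T i (S i z)‖ ≤ ‖z‖ :=
  c.norm_le_of_ip_self_le c ((ip_sum_adjoint_self_le hTS hST hG hG₁ z).trans
    (sum_ip_adjoint_self_le hTS hST hG hG₁ z))

theorem ContractiveFamily.sum_ip_rsmul_le (ξ : c.ContractiveFamily) (η : E) :
    ∑ i, c.ip η (c.rsmul (ξ.vec i) (c.ip (ξ.vec i) η)) ≤ c.ip η η := by
  refine le_of_eq_of_le (Finset.sum_congr rfl fun i _ => ?_)
    (sum_ip_adjoint_self_le (d := .self A) (T := fun i => c.rsmul (ξ.vec i))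
      (S := fun i => c.ip (ξ.vec i)) (fun i a z => c.ip_rsmul_left _ _ _)
      (fun i j a => c.ip_rsmul _ _ _) (c.isSelfAdjoint_gram ξ.vec) ξ.norm_gram_le η)
  rw [c.ip_rsmul, ← c.star_ip]
  rfl

end Bessel

end CStarCorrespondence

namespace IsTracialState

variable {A : Type*} [NonUnitalCStarAlgebra A] [PartialOrder A] [StarOrderedRing A]
  {τ : A →L[ℂ] ℂ}

theorem re_mono (hτ : IsTracialState τ) {a b : A} (h : a ≤ b) : (τ a).re ≤ (τ b).re := by
  have := (hτ.nonneg _ (sub_nonneg.mpr h)).1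
  rwa [map_sub, Complex.sub_re, sub_nonneg] at this

end IsTracialState

namespace CStarCorrespondence

variable {A : Type*} [NonUnitalCStarAlgebra A] [PartialOrder A] [StarOrderedRing A]
  {E : Type*} [NormedAddCommGroup E] [NormedSpace ℂ E] [CompleteSpace E]
  {c : CStarCorrespondence A E} {τ : A →L[ℂ] ℂ}

theorem multiset_sum_le_inducedTrace (a : A) (s : Multiset E)
    (hs : ∀ η, (s.map fun ξ => c.ip η (c.rsmul ξ (c.ip ξ η))).sum ≤ c.ip η η) :
    (s.map fun ξ => ENNReal.ofReal (τ (c.ip ξ (c.lsmul a ξ))).re).sum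
      ≤ c.inducedTrace τ (c.lsmul a) := by
  induction hn : s.card using Nat.strong_induction_on generalizing s with
  | _ n ih =>
    by_cases hnd : s.Nodup
    · exact le_iSup₂_of_le (⟨s, hnd⟩ : Finset E) hs le_rfl
    obtain ⟨x, t, rfl⟩ : ∃ x t, s = x ::ₘ x ::ₘ t := by
      by_contra! hc
      exact hnd (Multiset.nodup_iff_ne_cons_cons.mpr hc)
    -- Two copies of `x` contribute as much as the single vector `√2 x`.
    have h_sq : ((√2 : ℝ) : ℂ) * ((√2 : ℝ) : ℂ) = 2 := by
      rw [← Complex.ofReal_mul, Real.mul_self_sqrt zero_le_two, Complex.ofReal_ofNat]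
    have h_star : star ((√2 : ℝ) : ℂ) = ((√2 : ℝ) : ℂ) := Complex.conj_ofReal _
    have h_merged := ih (t.card + 1) (by simp [← hn]) ((((√2 : ℝ) : ℂ) • x) ::ₘ t)
      (fun η => ?_) (by simp)
    · refine le_of_eq_of_le ?_ h_merged
      simp only [Multiset.map_cons, Multiset.sum_cons]
      rw [c.lsmul_smul, c.ip_smul, c.ip_smul_left, smul_smul, h_star, h_sq, two_smul, map_add,
        Complex.add_re, ← two_mul, ENNReal.ofReal_mul zero_le_two, ENNReal.ofReal_ofNat, two_mul,
        add_assoc]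
    · refine le_of_eq_of_le ?_ (hs η)
      simp only [Multiset.map_cons, Multiset.sum_cons]
      rw [c.smul_rsmul, c.ip_smul_left, c.rsmul_smul, c.ip_smul, c.ip_smul, smul_smul, h_star,
        h_sq, two_smul, add_assoc]

theorem sum_le_inducedTrace (a : A) {ι : Type*} [Fintype ι] (ξ : ι → E)
    (hξ : ∀ η, ∑ i, c.ip η (c.rsmul (ξ i) (c.ip (ξ i) η)) ≤ c.ip η η) :
    ∑ i, ENNReal.ofReal (τ (c.ip (ξ i) (c.lsmul a (ξ i)))).re ≤ c.inducedTrace τ (c.lsmul a) := by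
  have := multiset_sum_le_inducedTrace (τ := τ) a ((Finset.univ : Finset ι).val.map ξ)
    (fun η => by simpa [Multiset.map_map, Function.comp_def] using hξ η)
  simpa [Multiset.map_map, Function.comp_def] using this

theorem re_ip_frame (hτ : IsTracialState τ) (ξ : c.ContractiveFamily) (x : E) :
    (τ (c.ip x (ξ.frame x))).re
      = ∑ i, (τ (c.ip (ξ.vec i) x * c.ip x (ξ.vec i))).re := by
  simp only [ContractiveFamily.frame, c.ip_sum_right, c.ip_rsmul, map_sum, Complex.re_sum,
    hτ.map_mul_comm (c.ip x _)]

/-- For `T : F → E` adjointable with adjoint `S`, this is `Tr_τ(T T*) ≤ Tr_τ(T* T)`. -/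
theorem sum_re_ip_adjoint_le_inducedTrace (hτ : IsTracialState τ) {F : Type*}
    [NormedAddCommGroup F] [NormedSpace ℂ F] [CompleteSpace F] {d : CStarCorrespondence A F}
    {T : F → E} {S : E → F} {g : A}
    (hTS : ∀ y z, c.ip (T y) z = d.ip y (S z)) (hST : ∀ y, S (T y) = d.lsmul g y)
    (H : Finset E) (hH : ∀ η, ∑ ξ ∈ H, c.ip η (c.rsmul ξ (c.ip ξ η)) ≤ c.ip η η) :
    ENNReal.ofReal (∑ η ∈ H, (τ (d.ip (S η) (S η))).re) ≤ d.inducedTrace τ (d.lsmul g) := by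
  have h_tendsto : Tendsto
      (fun ζ => ENNReal.ofReal (∑ η ∈ H, (τ (d.ip (S η) (ζ.frame (S η)))).re))
      (ContractiveFamily.approxId d) (𝓝 (ENNReal.ofReal (∑ η ∈ H, (τ (d.ip (S η) (S η))).re))) := by
    refine ENNReal.tendsto_ofReal (tendsto_finsetSum H fun η _ => ?_)
    have h_cont : Continuous fun y => (τ (d.ip (S η) y)).re :=
      Complex.continuous_re.comp (τ.continuous.comp (d.continuous_ip_right (S η)))
    exact (h_cont.tendsto (S η)).comp (ContractiveFamily.tendsto_frame (S η))
  refine le_of_tendsto' h_tendsto fun ζ => ?_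
  calc ENNReal.ofReal (∑ η ∈ H, (τ (d.ip (S η) (ζ.frame (S η)))).re)
      = ENNReal.ofReal (∑ i, ∑ η ∈ H, (τ (d.ip (ζ.vec i) (S η) * d.ip (S η) (ζ.vec i))).re) := by
        simp only [re_ip_frame hτ]
        rw [Finset.sum_comm]
    _ ≤ ENNReal.ofReal (∑ i, (τ (d.ip (ζ.vec i) (d.lsmul g (ζ.vec i)))).re) := by
        gcongr with i
        rw [← hST, ← hTS]
        refine le_of_eq_of_le ?_ (hτ.re_mono (hH (T (ζ.vec i))))
        rw [map_sum, Complex.re_sum]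
        refine Finset.sum_congr rfl fun η _ => ?_
        rw [c.ip_rsmul, hTS, ← c.star_ip, hTS, d.star_ip]
    _ = ∑ i, ENNReal.ofReal (τ (d.ip (ζ.vec i) (d.lsmul g (ζ.vec i)))).re := by
        refine ENNReal.ofReal_sum_of_nonneg fun i _ => ?_
        rw [← hST, ← hTS]
        exact (hτ.nonneg _ (c.ip_self_nonneg _)).1
    _ ≤ d.inducedTrace τ (d.lsmul g) := sum_le_inducedTrace g ζ.vec ζ.sum_ip_rsmul_le

end CStarCorrespondence

theorem ennreal_sum_iSup_le {ι : Type*} {κ : ι → Type*} [∀ i, Nonempty (κ i)] (s : Finset ι)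
    (f : ∀ i, κ i → ℝ≥0∞) {b : ℝ≥0∞} (h : ∀ k : ∀ i, κ i, ∑ i ∈ s, f i (k i) ≤ b) :
    ∑ i ∈ s, ⨆ k, f i k ≤ b := by
  have h_proj : ∀ i, ⨆ k, f i k = ⨆ k : ∀ i, κ i, f i (k i) := fun i =>
    ((Function.surjective_eval i).iSup_comp (f i)).symm
  simp only [h_proj]
  rw [ENNReal.finsetSum_iSup]
  · exact iSup_le h
  · intro k l
    choose m hm using fun i => (le_total (f i (k i)) (f i (l i))).elim
      (fun hle => ⟨l i, hle, le_rfl⟩) (fun hle => (⟨k i, le_rfl, hle⟩ :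
        ∃ m, f i (k i) ≤ f i m ∧ f i (l i) ≤ f i m))
    exact ⟨m, hm⟩

theorem ereal_coe_sum {ι : Type*} (s : Finset ι) (f : ι → ℝ) :
    ((∑ i ∈ s, f i : ℝ) : EReal) = ∑ i ∈ s, (f i : EReal) :=
  map_sum (⟨⟨Real.toEReal, EReal.coe_zero⟩, EReal.coe_add⟩ : ℝ →+ EReal) f s

namespace ProductSystem

variable {P : Type*} [Monoid P] {A : Type*} [NonUnitalCStarAlgebra A] [PartialOrder A]
  [StarOrderedRing A] (X : ProductSystem P A)

section Adjoint

variable {p q r : P} (h : p * q = r)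

theorem mul_sub_left (ξ ξ' : X.X p) (ζ : X.X q) :
    X.mul h (ξ - ξ') ζ = X.mul h ξ ζ - X.mul h ξ' ζ := by
  rw [← sub_eq_zero]
  have h_orth : ∀ (η : X.X p) (ω : X.X q), (X.corr r).ip
      (X.mul h (ξ - ξ') ζ - (X.mul h ξ ζ - X.mul h ξ' ζ)) (X.mul h η ω) = 0 := fun η ω => by
    simp only [(X.corr r).ip_sub_left, X.ip_mul, (X.corr p).ip_sub_left, (X.corr q).sub_lsmul,
      (X.corr q).ip_sub_right, sub_self]
  refine (X.corr r).eq_zero_of_ip_self ?_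
  conv_lhs => rw [(X.corr r).ip_sub_right, (X.corr r).ip_sub_right]
  rw [h_orth, h_orth, h_orth, sub_self, sub_self]

/-- Multiplication on the right by `ζ`, as an additive map. -/
def mulRightHom (ζ : X.X q) : X.X p →+ X.X r :=
  AddMonoidHom.ofMapSub (fun ξ => X.mul h ξ ζ) fun ξ ξ' => X.mul_sub_left h ξ ξ' ζ

theorem mul_sum_left {ι : Type*} (s : Finset ι) (f : ι → X.X p) (ζ : X.X q) :
    X.mul h (∑ i ∈ s, f i) ζ = ∑ i ∈ s, X.mul h (f i) ζ := map_sum (X.mulRightHom h ζ) f s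

theorem lsmul_mul (a : A) (ξ : X.X p) (ζ : X.X q) :
    (X.corr r).lsmul a (X.mul h ξ ζ) = X.mul h ((X.corr p).lsmul a ξ) ζ := by
  rw [← X.unit_mul, ← X.unit_mul]
  exact (X.mul_assoc' (one_mul p) h h (one_mul r) _ ξ ζ).symm

theorem rsmul_mul (a : A) (ξ : X.X p) (ζ : X.X q) :
    X.mul h ((X.corr p).rsmul ξ a) ζ = X.mul h ξ ((X.corr q).lsmul a ζ) := by
  rw [← X.unit_mul, ← X.mul_unit]
  exact X.mul_assoc' (mul_one p) h (one_mul q) h ξ _ ζ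

theorem norm_mul_le (ξ : X.X p) (ζ : X.X q) : ‖X.mul h ξ ζ‖ ≤ ‖ξ‖ * ‖ζ‖ := by
  refine (pow_le_pow_iff_left₀ (norm_nonneg _) (by positivity) two_ne_zero).mp ?_
  calc ‖X.mul h ξ ζ‖ ^ 2
      = ‖(X.corr q).ip ζ ((X.corr q).lsmul ((X.corr p).ip ξ ξ) ζ)‖ := by
        rw [(X.corr r).norm_sq, X.ip_mul]
    _ ≤ ‖ζ‖ * (‖(X.corr p).ip ξ ξ‖ * ‖ζ‖) := by
        refine ((X.corr q).norm_ip_le _ _).trans ?_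
        gcongr
        exact (X.corr q).norm_lsmul_le _ _
    _ = (‖ξ‖ * ‖ζ‖) ^ 2 := by rw [← (X.corr p).norm_sq]; ring

/-- The graph of the adjoint of left multiplication by `ξ`. -/
def adjGraph (ξ : X.X p) : Submodule ℂ (X.X r × X.X q) where
  carrier := {x | ∀ ζ, (X.corr r).ip (X.mul h ξ ζ) x.1 = (X.corr q).ip ζ x.2}
  add_mem' hx hy ζ := by
    rw [Prod.fst_add, Prod.snd_add, (X.corr r).ip_add, (X.corr q).ip_add, hx, hy]
  zero_mem' ζ := ((X.corr r).ip_zero_right _).trans ((X.corr q).ip_zero_right _).symm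
  smul_mem' z x hx ζ := by
    rw [Prod.smul_fst, Prod.smul_snd, (X.corr r).ip_smul, (X.corr q).ip_smul, hx]

theorem isClosed_adjGraph (ξ : X.X p) : IsClosed (X.adjGraph h ξ : Set (X.X r × X.X q)) := by
  refine isClosed_iff_forall_filter.mpr fun x F _ hF hFx ζ => ?_
  have h_fst := (((X.corr r).continuous_ip_right (X.mul h ξ ζ)).comp continuous_fst).tendsto x
  have h_snd := (((X.corr q).continuous_ip_right ζ).comp continuous_snd).tendsto x
  refine tendsto_nhds_unique (h_fst.mono_left hFx) ((h_snd.mono_left hFx).congr' ?_)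
  filter_upwards [le_principal_iff.mp hF] with y hy using (hy ζ).symm

variable {X h} in
theorem norm_snd_le_of_mem_adjGraph {ξ : X.X p} {x : X.X r × X.X q} (hx : x ∈ X.adjGraph h ξ) :
    ‖x.2‖ ≤ ‖ξ‖ * ‖x.1‖ := by
  have h_sq : ‖x.2‖ * ‖x.2‖ ≤ ‖ξ‖ * ‖x.1‖ * ‖x.2‖ :=
    calc ‖x.2‖ * ‖x.2‖ = ‖(X.corr r).ip (X.mul h ξ x.2) x.1‖ := by
          rw [← sq, (X.corr q).norm_sq, hx]
      _ ≤ ‖ξ‖ * ‖x.2‖ * ‖x.1‖ := by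
          refine ((X.corr r).norm_ip_le _ _).trans ?_
          gcongr
          exact X.norm_mul_le h _ _
      _ = ‖ξ‖ * ‖x.1‖ * ‖x.2‖ := by ring
  rcases (norm_nonneg x.2).eq_or_lt with h₀ | h₀
  · rw [← h₀]; positivity
  · exact le_of_mul_le_mul_right h_sq h₀

theorem isClosed_range_fst_adjGraph (ξ : X.X p) :
    IsClosed (Set.range ((LinearMap.fst ℂ (X.X r) (X.X q)).domRestrict (X.adjGraph h ξ))) := by
  have : CompleteSpace (X.adjGraph h ξ) := (X.isClosed_adjGraph h ξ).completeSpace_coe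
  refine AntilipschitzWith.isClosed_range (K := max ‖ξ‖₊ 1)
    (AddMonoidHomClass.antilipschitz_of_bound _ fun x => ?_)
    (uniformContinuous_fst.comp uniformContinuous_subtype_val)
  rw [Submodule.coe_norm, Prod.norm_def]
  refine max_le ?_ ((norm_snd_le_of_mem_adjGraph x.2).trans ?_)
  · exact le_mul_of_one_le_left (norm_nonneg _) (le_max_right _ _)
  · exact mul_le_mul_of_nonneg_right (le_max_left _ _) (norm_nonneg _)

variable {h} (hp : p ≠ 1)

include hp in
theorem exists_mem_adjGraph (ξ : X.X p) (x : X.X r) : ∃ z, (x, z) ∈ X.adjGraph h ξ := by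
  have h_prod : {x : X.X r | ∃ ξ ζ, x = X.mul h ξ ζ} ⊆
      (LinearMap.range ((LinearMap.fst ℂ (X.X r) (X.X q)).domRestrict (X.adjGraph h ξ))) := by
    rintro _ ⟨ξ', ζ', rfl⟩
    exact ⟨⟨(_, _), fun ζ => X.ip_mul h ξ ξ' ζ ζ'⟩, rfl⟩
  obtain ⟨⟨⟨_, z⟩, hz⟩, rfl⟩ := closure_minimal (Submodule.span_le.mpr h_prod)
    (X.isClosed_range_fst_adjGraph h ξ) (X.dense_mul h hp x)
  exact ⟨z, hz⟩

/-- The adjoint of left multiplication by `ξ`. -/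
noncomputable def adj (h : p * q = r) (ξ : X.X p) (x : X.X r) : X.X q :=
  (X.exists_mem_adjGraph (h := h) hp ξ x).choose

theorem ip_adj (ξ : X.X p) (ζ : X.X q) (x : X.X r) :
    (X.corr q).ip ζ (X.adj hp h ξ x) = (X.corr r).ip (X.mul h ξ ζ) x :=
  ((X.exists_mem_adjGraph hp ξ x).choose_spec ζ).symm

theorem adj_mul (ξ ξ' : X.X p) (ζ : X.X q) :
    X.adj hp h ξ (X.mul h ξ' ζ) = (X.corr q).lsmul ((X.corr p).ip ξ ξ') ζ :=
  (X.corr q).ext_ip fun ω => by rw [ip_adj, X.ip_mul]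

/-- `(∑ θ_{ξ,ξ}) ⊗ 1` on `X_p ⊗_A X_q = X_{pq}`, for a contractive family `ξ` in `X_p`. -/
noncomputable def leftFrame (h : p * q = r) (ξ : (X.corr p).ContractiveFamily) (x : X.X r) :
    X.X r :=
  ∑ i, X.mul h (ξ.vec i) (X.adj hp h (ξ.vec i) x)

variable (ξ : (X.corr p).ContractiveFamily)

theorem sum_ip_adj_self_le (x : X.X r) :
    ∑ i, (X.corr q).ip (X.adj hp h (ξ.vec i) x) (X.adj hp h (ξ.vec i) x) ≤ (X.corr r).ip x x :=
  CStarCorrespondence.sum_ip_adjoint_self_le (fun i y z => (X.ip_adj hp (ξ.vec i) y z).symm)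
    (fun i j y => X.adj_mul hp (ξ.vec i) (ξ.vec j) y) ((X.corr p).isSelfAdjoint_gram ξ.vec)
    ξ.norm_gram_le x

theorem norm_leftFrame_le (x : X.X r) : ‖X.leftFrame hp h ξ x‖ ≤ ‖x‖ :=
  CStarCorrespondence.norm_sum_adjoint_le (fun i y z => (X.ip_adj hp (ξ.vec i) y z).symm)
    (fun i j y => X.adj_mul hp (ξ.vec i) (ξ.vec j) y) ((X.corr p).isSelfAdjoint_gram ξ.vec)
    ξ.norm_gram_le x

theorem ip_leftFrame (x y : X.X r) :
    (X.corr r).ip y (X.leftFrame hp h ξ x)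
      = ∑ i, (X.corr r).ip (X.mul h (ξ.vec i) (X.adj hp h (ξ.vec i) y)) x := by
  simp only [leftFrame, (X.corr r).ip_sum_right, ← X.ip_adj hp]
  refine Finset.sum_congr rfl fun i _ => ?_
  rw [← (X.corr r).star_ip, ← X.ip_adj hp, (X.corr q).star_ip]

theorem leftFrame_add (x y : X.X r) :
    X.leftFrame hp h ξ (x + y) = X.leftFrame hp h ξ x + X.leftFrame hp h ξ y :=
  (X.corr r).ext_ip fun z => by
    simp only [(X.corr r).ip_add, ip_leftFrame, Finset.sum_add_distrib]

theorem leftFrame_smul (a : ℂ) (x : X.X r) :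
    X.leftFrame hp h ξ (a • x) = a • X.leftFrame hp h ξ x :=
  (X.corr r).ext_ip fun z => by simp only [(X.corr r).ip_smul, ip_leftFrame, Finset.smul_sum]

theorem leftFrame_sub (x y : X.X r) :
    X.leftFrame hp h ξ (x - y) = X.leftFrame hp h ξ x - X.leftFrame hp h ξ y :=
  (X.corr r).ext_ip fun z => by
    simp only [(X.corr r).ip_sub_right, ip_leftFrame, Finset.sum_sub_distrib]

theorem leftFrame_mul (ξ' : X.X p) (ζ : X.X q) :
    X.leftFrame hp h ξ (X.mul h ξ' ζ) = X.mul h (ξ.frame ξ') ζ := by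
  simp only [leftFrame, adj_mul, CStarCorrespondence.ContractiveFamily.frame, X.mul_sum_left,
    X.rsmul_mul]

open CStarCorrespondence in
theorem tendsto_leftFrame (x : X.X r) :
    Tendsto (fun ξ => X.leftFrame hp h ξ x) (ContractiveFamily.approxId (X.corr p)) (𝓝 x) := by
  have h_equi : Equicontinuous fun ξ => X.leftFrame hp h ξ :=
    (LipschitzWith.uniformEquicontinuous _ 1 fun ξ => LipschitzWith.of_dist_le_mul fun x y => by
      rw [dist_eq_norm, dist_eq_norm, ← X.leftFrame_sub, NNReal.coe_one, one_mul]
      exact X.norm_leftFrame_le hp ξ _).equicontinuous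
  refine closure_minimal ?_ (h_equi.isClosed_setOfPred_tendsto continuous_id') (X.dense_mul h hp x)
  intro y hy
  induction hy using Submodule.span_induction with
  | mem y hy =>
    obtain ⟨ξ', ζ, rfl⟩ := hy
    have h_cont : Continuous fun ξ => X.mul h ξ ζ :=
      AddMonoidHomClass.continuous_of_bound (X.mulRightHom h ζ) ‖ζ‖ fun ξ =>
        (X.norm_mul_le h ξ ζ).trans_eq (mul_comm _ _)
    simp only [Set.mem_ofPred_eq, leftFrame_mul]
    exact (h_cont.tendsto ξ').comp (ContractiveFamily.tendsto_frame ξ')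
  | zero =>
    have h_zero : ∀ ξ, X.leftFrame hp h ξ 0 = 0 := fun ξ => by
      simpa using X.leftFrame_smul hp ξ 0 0
    simp only [Set.mem_ofPred_eq, h_zero]
    exact tendsto_const_nhds
  | add y y' _ _ hy hy' => simpa only [Set.mem_ofPred_eq, leftFrame_add] using hy.add hy'
  | smul a y _ hy => simpa only [Set.mem_ofPred_eq, leftFrame_smul] using hy.const_smul a

end Adjoint

section Trace

open CStarCorrespondence

variable {p : P} (hp : p ≠ 1) {τ : A →L[ℂ] ℂ}

include hp in
theorem sum_tr_ip_le_tr (τ : A →L[ℂ] ℂ) (q : P) (a : A) (ξ : (X.corr p).ContractiveFamily) :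
    ∑ i, X.tr τ q ((X.corr p).ip (ξ.vec i) ((X.corr p).lsmul a (ξ.vec i)))
      ≤ X.tr τ (p * q) a := by
  simp only [tr, inducedTrace, iSup_subtype' (ι := Finset (X.X q))]
  have : Nonempty {H : Finset (X.X q) // ∀ η, ∑ ζ ∈ H, (X.corr q).ip η
      ((X.corr q).rsmul ζ ((X.corr q).ip ζ η)) ≤ (X.corr q).ip η η} :=
    ⟨⟨∅, fun η => by simpa using (X.corr q).ip_self_nonneg η⟩⟩
  refine ennreal_sum_iSup_le _ _ fun H => ?_
  have h_frame : ∀ x, ∑ k : (Σ i, {ζ // ζ ∈ (H i).1}), (X.corr (p * q)).ip x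
      ((X.corr (p * q)).rsmul (X.mul rfl (ξ.vec k.1) k.2.1)
        ((X.corr (p * q)).ip (X.mul rfl (ξ.vec k.1) k.2.1) x)) ≤ (X.corr (p * q)).ip x x := by
    refine fun x => le_trans ?_ (X.sum_ip_adj_self_le hp (h := rfl) ξ x)
    rw [Fintype.sum_sigma]
    refine Finset.sum_le_sum fun i _ =>
      le_of_eq_of_le ?_ ((H i).2 (X.adj hp rfl (ξ.vec i) x))
    rw [← Finset.sum_coe_sort (H i).1]
    refine Finset.sum_congr rfl fun ζ _ => ?_
    rw [(X.corr (p * q)).ip_rsmul, (X.corr q).ip_rsmul, ip_adj, ← (X.corr q).star_ip, ip_adj,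
      (X.corr (p * q)).star_ip]
  refine le_of_eq_of_le ?_ (sum_le_inducedTrace (τ := τ) a _ h_frame)
  rw [Fintype.sum_sigma]
  refine Finset.sum_congr rfl fun i _ => ?_
  rw [← Finset.sum_coe_sort (H i).1]
  simp only [X.lsmul_mul, X.ip_mul]

theorem ofReal_sum_re_ip_leftFrame_le (hτ : IsTracialState τ) {b : A} (hb : IsSelfAdjoint b)
    (q : P) {H : Finset (X.X (p * q))}
    (hH : ∀ η, ∑ ξ ∈ H, (X.corr _).ip η ((X.corr _).rsmul ξ ((X.corr _).ip ξ η))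
      ≤ (X.corr _).ip η η) (ξ : (X.corr p).ContractiveFamily) :
    ENNReal.ofReal (∑ η ∈ H, (τ ((X.corr _).ip ((X.corr _).lsmul b η)
        (X.leftFrame hp rfl ξ ((X.corr _).lsmul b η)))).re)
      ≤ ∑ i, X.tr τ q ((X.corr p).ip (ξ.vec i) ((X.corr p).lsmul (b * b) (ξ.vec i))) := by
  have h_ip : ∀ i x, (X.corr (p * q)).ip x (X.mul rfl (ξ.vec i) (X.adj hp rfl (ξ.vec i) x))
      = (X.corr q).ip (X.adj hp rfl (ξ.vec i) x) (X.adj hp rfl (ξ.vec i) x) := fun i x => by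
    rw [← (X.corr _).star_ip, ← X.ip_adj hp, (X.corr q).star_ip]
  simp only [leftFrame, (X.corr (p * q)).ip_sum_right, h_ip, map_sum, Complex.re_sum]
  rw [Finset.sum_comm, ENNReal.ofReal_sum_of_nonneg fun i _ => Finset.sum_nonneg fun η _ =>
    (hτ.nonneg _ ((X.corr q).ip_self_nonneg _)).1]
  refine Finset.sum_le_sum fun i _ => sum_re_ip_adjoint_le_inducedTrace hτ
    (S := fun z => X.adj hp rfl (ξ.vec i) ((X.corr _).lsmul b z))
    (T := fun y => X.mul rfl ((X.corr p).lsmul b (ξ.vec i)) y) (fun y z => ?_) (fun y => ?_) H hH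
  · rw [ip_adj, ← X.lsmul_mul, (X.corr _).ip_lsmul, hb.star_eq]
  · rw [X.lsmul_mul, adj_mul, (X.corr p).mul_lsmul]

include hp in
/-- This is induction in stages for `X_{pq} = X_p ⊗_A X_q`. -/
theorem tendsto_sum_tr_ip (hτ : IsTracialState τ) {a : A} (ha : 0 ≤ a) (q : P) :
    Tendsto (fun ξ : (X.corr p).ContractiveFamily =>
        ∑ i, X.tr τ q ((X.corr p).ip (ξ.vec i) ((X.corr p).lsmul a (ξ.vec i))))
      (ContractiveFamily.approxId (X.corr p)) (𝓝 (X.tr τ (p * q) a)) := by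
  refine tendsto_order.mpr ⟨fun m hm => ?_, fun m hm =>
    .of_forall fun ξ => (X.sum_tr_ip_le_tr hp τ q a ξ).trans_lt hm⟩
  obtain ⟨b, hb, rfl⟩ : ∃ b : A, IsSelfAdjoint b ∧ b * b = a :=
    ⟨CFC.sqrt a, (CFC.sqrt_nonneg a).isSelfAdjoint, CFC.sqrt_mul_sqrt_self a⟩
  simp only [tr, inducedTrace, lt_iSup_iff] at hm
  obtain ⟨H, hH, hm⟩ := hm
  have h_ip : ∀ η, (X.corr (p * q)).ip η ((X.corr _).lsmul (b * b) η)
      = (X.corr _).ip ((X.corr _).lsmul b η) ((X.corr _).lsmul b η) := fun η => by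
    rw [(X.corr _).mul_lsmul, (X.corr _).ip_lsmul, hb.star_eq]
  simp only [h_ip] at hm
  rw [← ENNReal.ofReal_sum_of_nonneg fun η _ => (hτ.nonneg _ ((X.corr _).ip_self_nonneg _)).1] at hm
  have h_lim : Tendsto (fun ξ => ENNReal.ofReal (∑ η ∈ H, (τ ((X.corr _).ip
      ((X.corr _).lsmul b η) (X.leftFrame hp rfl ξ ((X.corr _).lsmul b η)))).re))
      (ContractiveFamily.approxId (X.corr p)) (𝓝 (ENNReal.ofReal (∑ η ∈ H,
        (τ ((X.corr _).ip ((X.corr _).lsmul b η) ((X.corr _).lsmul b η))).re))) := by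
    refine ENNReal.tendsto_ofReal (tendsto_finsetSum H fun η _ => ?_)
    have h_cont : Continuous fun y => (τ ((X.corr (p * q)).ip ((X.corr _).lsmul b η) y)).re :=
      Complex.continuous_re.comp (τ.continuous.comp ((X.corr _).continuous_ip_right _))
    exact (h_cont.tendsto _).comp (X.tendsto_leftFrame hp _)
  filter_upwards [h_lim.eventually_const_lt hm] with ξ hξ
  exact hξ.trans_le (X.ofReal_sum_re_ip_leftFrame_le hp hτ hb q hH ξ)

theorem ip_mul_ip_unitEquiv (b : A) (ξ : X.X 1) :
    (X.corr 1).ip ξ (X.unitEquiv b) * (X.corr 1).ip (X.unitEquiv b) ξ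
      = (X.corr 1).ip ξ ((X.corr 1).lsmul (b * star b) ξ) := by
  obtain ⟨e, rfl⟩ := X.unitEquiv.surjective ξ
  simp only [X.lsmul_unit, X.ip_unit, mul_assoc]

theorem tr_one (hτ : IsTracialState τ) {a : A} (ha : 0 ≤ a) :
    X.tr τ 1 a = ENNReal.ofReal (τ a).re := by
  obtain ⟨b, rfl⟩ := CStarAlgebra.nonneg_iff_eq_mul_star_self.mp ha
  have h_ip : τ ((X.corr 1).ip (X.unitEquiv b) (X.unitEquiv b)) = τ (b * star b) := by
    rw [X.ip_unit, hτ.map_mul_comm]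
  have h_nonneg : ∀ ξ, 0 ≤ (τ ((X.corr 1).ip ξ ((X.corr 1).lsmul (b * star b) ξ))).re :=
    fun ξ => by
      rw [← ip_mul_ip_unitEquiv, ← (X.corr 1).star_ip ξ]
      exact (hτ.nonneg _ (mul_star_self_nonneg _)).1
  refine le_antisymm (iSup₂_le fun H hH => ?_) ?_
  · rw [← ENNReal.ofReal_sum_of_nonneg fun ξ _ => h_nonneg ξ]
    refine ENNReal.ofReal_le_ofReal ?_
    have h_le := hτ.re_mono (hH (X.unitEquiv b))
    simpa only [map_sum, Complex.re_sum, (X.corr 1).ip_rsmul, hτ.map_mul_comm ((X.corr 1).ip _ _),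
      X.ip_mul_ip_unitEquiv, h_ip] using h_le
  · have h_cont : Continuous fun y => ENNReal.ofReal
        (τ ((X.corr 1).ip (X.unitEquiv b) y)).re :=
      ENNReal.continuous_ofReal.comp (Complex.continuous_re.comp
        (τ.continuous.comp ((X.corr 1).continuous_ip_right _)))
    rw [← h_ip]
    refine le_of_tendsto' ((h_cont.tendsto _).comp
      (ContractiveFamily.tendsto_frame (c := X.corr 1) _)) fun ζ => ?_
    rw [Function.comp_apply, re_ip_frame hτ]
    simp only [X.ip_mul_ip_unitEquiv]
    rw [ENNReal.ofReal_sum_of_nonneg fun i _ => h_nonneg _]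
    exact sum_le_inducedTrace _ ζ.vec ζ.sum_ip_rsmul_le

end Trace

section Bounded

variable {X} {τ : A →L[ℂ] ℂ}

/-- `Tr_τ^p` is dominated by a multiple of `τ`. -/
def TraceBounded (X : ProductSystem P A) (τ : A →L[ℂ] ℂ) (p : P) : Prop :=
  ∃ C : NNReal, ∀ a : A, 0 ≤ a → X.tr τ p a ≤ C * ENNReal.ofReal (τ a).re

theorem TraceBounded.ne_top {p : P} (h : X.TraceBounded τ p) {a : A} (ha : 0 ≤ a) :
    X.tr τ p a ≠ ⊤ := by
  obtain ⟨C, hC⟩ := h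
  exact ((hC a ha).trans_lt (ENNReal.mul_lt_top ENNReal.coe_lt_top ENNReal.ofReal_lt_top)).ne

theorem TraceBounded.mul (hτ : IsTracialState τ) {p q : P} (hp : p ≠ 1)
    (h : X.TraceBounded τ p) (h' : X.TraceBounded τ q) : X.TraceBounded τ (p * q) := by
  obtain ⟨C, hC⟩ := h
  obtain ⟨C', hC'⟩ := h'
  refine ⟨C' * C, fun a ha => le_of_tendsto' (X.tendsto_sum_tr_ip hp hτ ha q) fun ξ => ?_⟩
  have h_compr : ∀ x, 0 ≤ (X.corr p).ip x ((X.corr p).lsmul a x) :=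
    fun x => (X.corr p).ip_lsmul_self_nonneg ha x
  calc ∑ i, X.tr τ q ((X.corr p).ip (ξ.vec i) ((X.corr p).lsmul a (ξ.vec i)))
      ≤ ∑ i, C' * ENNReal.ofReal
          (τ ((X.corr p).ip (ξ.vec i) ((X.corr p).lsmul a (ξ.vec i)))).re :=
        Finset.sum_le_sum fun i _ => hC' _ (h_compr _)
    _ ≤ C' * X.tr τ p a := by
        rw [← Finset.mul_sum]
        gcongr
        exact CStarCorrespondence.sum_le_inducedTrace a ξ.vec ξ.sum_ip_rsmul_le
    _ ≤ C' * (C * ENNReal.ofReal (τ a).re) := by gcongr; exact hC a ha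
    _ = (C' * C : NNReal) * ENNReal.ofReal (τ a).re := by rw [ENNReal.coe_mul, mul_assoc]

theorem TraceUnitInvariant.traceBounded_of_isUnit (hinv : X.TraceUnitInvariant τ)
    (hτ : IsTracialState τ) {u : P} (hu : IsUnit u) : X.TraceBounded τ u :=
  ⟨1, fun a ha => by
    rw [← one_mul u, hinv 1 u hu a ha, X.tr_one hτ ha, ENNReal.coe_one, one_mul]⟩

theorem TraceUnitInvariant.tr_congr [IsLeftCancelMul P] (hinv : X.TraceUnitInvariant τ) {p q : P}
    (hpq : p ∣ q) (hqp : q ∣ p) {a : A} (ha : 0 ≤ a) : X.tr τ p a = X.tr τ q a := by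
  obtain ⟨u, hu, rfl⟩ := exists_isUnit_of_dvd_dvd hpq hqp
  exact (hinv p u hu a ha).symm

theorem traceBounded_of_irreducible (hτ : IsTracialState τ) (hinv : X.TraceUnitInvariant τ)
    (hP : IsFactorNoetherian P) (h : ∀ p, Irreducible p → X.TraceBounded τ p) (p : P) :
    X.TraceBounded τ p := by
  induction p using hP.induction with
  | _ p ih =>
    by_cases hu : IsUnit p
    · exact hinv.traceBounded_of_isUnit hτ hu
    by_cases hirr : Irreducible p
    · exact h p hirr
    obtain ⟨x, y, hx, hy, rfl⟩ : ∃ x y, ¬ IsUnit x ∧ ¬ IsUnit y ∧ p = x * y := by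
      by_contra! hc
      exact hirr ⟨hu, fun {b c} h => by by_contra! h'; exact hc b c h'.1 h'.2 h⟩
    exact (ih x (.mul_right x hy)).mul hτ (fun h => hx (h ▸ isUnit_one)) (ih y (.mul_left y hx))

end Bounded

section Positivity

variable {X} {τ : A →L[ℂ] ℂ} {N : P →* ℝ} {β : ℝ}

/-- The value `N(p)^{-β} Tr_τ^p(a)`, which is `0` if the trace is infinite. -/
noncomputable def weightedTrace (X : ProductSystem P A) (N : P →* ℝ) (β : ℝ) (τ : A →L[ℂ] ℂ)
    (a : {a : A // 0 ≤ a}) (p : P) : ℝ :=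
  N p ^ (-β) * (X.tr τ p a).toReal

theorem map_eq_of_dvd_dvd [IsLeftCancelMul P] (hN₁ : ∀ u, IsUnit u → N u = 1) {p q : P}
    (hpq : p ∣ q) (hqp : q ∣ p) : N p = N q := by
  obtain ⟨u, hu, rfl⟩ := exists_isUnit_of_dvd_dvd hpq hqp
  rw [map_mul, hN₁ u hu, mul_one]

theorem dependsOnRightIdeal_weightedTrace [IsLeftCancelMul P] (hN₁ : ∀ u, IsUnit u → N u = 1)
    (hinv : X.TraceUnitInvariant τ) (a : {a : A // 0 ≤ a}) :
    DependsOnRightIdeal (X.weightedTrace N β τ a) := fun p q hpq hqp => by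
  rw [weightedTrace, weightedTrace, hinv.tr_congr hpq hqp a.2, map_eq_of_dvd_dvd hN₁ hpq hqp]

theorem summand_eq [IsLeftCancelMul P] (hN₁ : ∀ u, IsUnit u → N u = 1)
    (hinv : X.TraceUnitInvariant τ) {K : Finset P} {r : P} (hr : IsRightLCM (K : Set P) r) {a : A}
    (ha : 0 ≤ a) :
    X.summand N β τ K a = (((-1) ^ K.card * N r ^ (-β) : ℝ) : EReal) * (X.tr τ r a : EReal) := by
  have hex : ∃ r, IsRightLCM (K : Set P) r := ⟨r, hr⟩
  have hle : hex.choose ∣ r := hex.choose_spec.2 r hr.1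
  have hge : r ∣ hex.choose := hr.2 _ hex.choose_spec.1
  rw [summand, dif_pos hex, map_eq_of_dvd_dvd hN₁ hle hge, hinv.tr_congr hle hge ha]

theorem PositivityOn.traceBounded [IsLeftCancelMul P] (hN : ∀ p, 0 < N p)
    (hN₁ : ∀ u, IsUnit u → N u = 1) (hinv : X.TraceUnitInvariant τ) {R : Set P}
    (hR : X.PositivityOn N β τ R) {p : P} (hp : p ∈ R) : X.TraceBounded τ p := by
  have hw : 0 < N p ^ (-β) := Real.rpow_pos_of_pos (hN p) _
  refine ⟨(N p ^ (-β))⁻¹.toNNReal, fun a ha => ?_⟩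
  have h_pos := hR {p} (by simpa using hp) a ha
  have h_filter : (({p} : Finset P).powerset.filter fun K => K.Nonempty) = {{p}} := by
    classical
    ext K
    simp only [Finset.mem_filter, Finset.mem_powerset, Finset.subset_singleton_iff,
      Finset.mem_singleton]
    exact ⟨fun h => h.1.resolve_left h.2.ne_empty,
      fun h => ⟨.inr h, h ▸ Finset.singleton_nonempty p⟩⟩
  have h_lcm : IsRightLCM (({p} : Finset P) : Set P) p := by simp [IsRightLCM]
  rw [h_filter, Finset.sum_singleton, summand_eq hN₁ hinv h_lcm ha, Finset.card_singleton, pow_one,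
    neg_one_mul] at h_pos
  have h_fin : X.tr τ p a ≠ ⊤ := by
    intro htop
    rw [htop, EReal.coe_ennreal_top, EReal.coe_mul_top_of_neg (neg_neg_of_pos hw)] at h_pos
    simp at h_pos
  have h_real : 0 ≤ (τ a).re + -(N p ^ (-β)) * (X.tr τ p a).toReal := by
    rw [← EReal.coe_ennreal_toReal h_fin] at h_pos
    exact_mod_cast h_pos
  rw [← ENNReal.ofReal_toReal h_fin]
  change _ ≤ ENNReal.ofReal _ * _
  rw [← ENNReal.ofReal_mul (by positivity)]
  refine ENNReal.ofReal_le_ofReal ?_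
  rw [le_inv_mul_iff₀ hw]
  linarith

theorem coe_altSum_weightedTrace [IsLeftCancelMul P] (hP : HasFiniteRightLCMs P)
    (hN₁ : ∀ u, IsUnit u → N u = 1) (hτ : IsTracialState τ) (hinv : X.TraceUnitInvariant τ)
    (hb : ∀ p, X.TraceBounded τ p) (J : Finset P) (a : {a : A // 0 ≤ a}) :
    ((altSum (X.weightedTrace N β τ a) id J 1 : ℝ) : EReal) =
      ((τ a).re : EReal) + ∑ K ∈ J.powerset with K.Nonempty, X.summand N β τ K a := by
  classical
  have h_lcm : ∀ K : Finset P, IsRightLCM (K : Set P) (rightLCM (insert 1 (id '' (K : Set P)))) :=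
    fun K => by
      have h := hP.isRightLCM (Set.toFinite (insert 1 (id '' (K : Set P))))
      refine ⟨fun p hp => h.1 p (by simp [hp]), fun z hz => h.2 z ?_⟩
      simpa using hz
  have h_term : ∀ K : Finset P, X.summand N β τ K a =
      (((-1) ^ K.card * X.weightedTrace N β τ a (rightLCM (insert 1 (id '' (K : Set P)))) : ℝ) :
        EReal) := fun K => by
    rw [summand_eq hN₁ hinv (h_lcm K) a.2, weightedTrace, ← mul_assoc,
      ← EReal.coe_ennreal_toReal ((hb _).ne_top a.2), ← EReal.coe_mul]
  have h_empty : X.summand N β τ ∅ a = ((τ a).re : EReal) := by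
    rw [summand_eq hN₁ hinv (r := 1) (by simp [IsRightLCM]) a.2, X.tr_one hτ a.2,
      EReal.coe_ennreal_ofReal, max_eq_left (hτ.nonneg _ a.2).1]
    simp
  have h_filter : (J.powerset.filter fun K => ¬ K.Nonempty) = {∅} := by
    ext K
    simp only [Finset.mem_filter, Finset.mem_powerset, Finset.not_nonempty_iff_eq_empty,
      Finset.mem_singleton]
    exact ⟨fun h => h.2, fun h => ⟨by simp [h], h⟩⟩
  rw [altSum, ereal_coe_sum]
  simp only [← h_term]
  rw [← Finset.sum_filter_not_add_sum_filter _ fun K : Finset P => K.Nonempty, h_filter,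
    Finset.sum_singleton, h_empty]

open CStarCorrespondence in
theorem tendsto_weightedTrace (hN : ∀ p, 0 < N p) (hτ : IsTracialState τ)
    (hb : ∀ p, X.TraceBounded τ p) {p : P} (hp : p ≠ 1) (a : {a : A // 0 ≤ a}) (q : P) :
    Tendsto (fun ξ : (X.corr p).ContractiveFamily => N p ^ (-β) * ∑ i, X.weightedTrace N β τ
        ⟨_, (X.corr p).ip_lsmul_self_nonneg a.2 (ξ.vec i)⟩ q)
      (ContractiveFamily.approxId (X.corr p)) (𝓝 (X.weightedTrace N β τ a (p * q))) := by
  have h_tr := (ENNReal.tendsto_toReal ((hb _).ne_top a.2)).comp (X.tendsto_sum_tr_ip hp hτ a.2 q)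
  refine (h_tr.const_mul (N (p * q) ^ (-β))).congr fun ξ => ?_
  rw [Function.comp_apply, ENNReal.toReal_sum fun i _ =>
    (hb q).ne_top ((X.corr p).ip_lsmul_self_nonneg a.2 (ξ.vec i)), map_mul,
    Real.mul_rpow (hN p).le (hN q).le, mul_assoc]
  simp only [weightedTrace, Finset.mul_sum]

theorem altSum_weightedTrace_mul_left_nonneg (hN : ∀ p, 0 < N p) (hτ : IsTracialState τ)
    (hb : ∀ p, X.TraceBounded τ p) {p : P} (hp : p ≠ 1) {ι : Type*} {y : ι → P} {s : Finset ι}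
    (h : ∀ a, 0 ≤ altSum (X.weightedTrace N β τ a) y s 1) (a : {a : A // 0 ≤ a}) :
    0 ≤ altSum (fun r => X.weightedTrace N β τ a (p * r)) y s 1 := by
  refine ge_of_tendsto' (tendsto_finsetSum _ fun K _ =>
    (tendsto_weightedTrace hN hτ hb hp a _).const_mul ((-1) ^ K.card)) fun ξ => ?_
  have h_sum := mul_nonneg (Real.rpow_nonneg (hN p).le (-β))
    (Finset.sum_nonneg fun i (_ : i ∈ Finset.univ) =>
      h ⟨_, (X.corr p).ip_lsmul_self_nonneg a.2 (ξ.vec i)⟩)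
  refine h_sum.trans_eq ?_
  simp only [altSum, Finset.mul_sum]
  rw [Finset.sum_comm]
  exact Finset.sum_congr rfl fun K _ => Finset.sum_congr rfl fun i _ => mul_left_comm _ _ _

theorem positivityOn_ne_one_iff [IsLeftCancelMul P] (hP : IsFactorNoetherian P)
    (hL : HasConditionalRightLCMs P) (hD : IsRightDirected P) (X : ProductSystem P A) {N : P →* ℝ}
    (hN : ∀ p, 0 < N p) (hN₁ : ∀ u, IsUnit u → N u = 1) (β : ℝ) (hτ : IsTracialState τ)
    (hinv : X.TraceUnitInvariant τ) :
    X.PositivityOn N β τ {p | p ≠ 1} ↔ X.PositivityOn N β τ {p | Irreducible p} := by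
  refine ⟨fun h J hJ => h J fun p hp => (hJ hp).ne_one, fun h J _ a ha => ?_⟩
  have hF := hL.hasFiniteRightLCMs hD
  have hb := traceBounded_of_irreducible hτ hinv hP fun p hp => h.traceBounded hN hN₁ hinv hp
  have h_iff := fun J a => coe_altSum_weightedTrace (β := β) hF hN₁ hτ hinv hb J a
  rw [← h_iff J ⟨a, ha⟩, EReal.coe_nonneg]
  refine altSum_nonneg_of_irreducible hP hD hF (dependsOnRightIdeal_weightedTrace hN₁ hinv)
    (fun p hp n y hy => ?_) (fun J hJ a => ?_) J ⟨a, ha⟩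
  · exact altSum_weightedTrace_mul_left_nonneg hN hτ hb (by rintro rfl; exact hp isUnit_one) hy
  · rw [← EReal.coe_nonneg, h_iff]
    exact h J hJ a a.2

end Positivity

end ProductSystem

/-! ### Orders of products of two simple reflections -/

section GeometricRepresentation

open Polynomial.Chebyshev Module CoxeterSystem

theorem chebyshevS_eval_sub_one_eq_zero {θ : ℝ} (hθ : Real.sin θ ≠ 0) {n : ℤ}
    (h : n * θ = Real.pi) :
    (S ℝ (n - 1)).eval (2 * Real.cos θ) = 0 := by
  refine (mul_eq_zero_iff_right hθ).mp ?_
  rw [S_two_mul_real_cos, Int.cast_sub, Int.cast_one, sub_add_cancel, h, Real.sin_pi]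

theorem chebyshevS_eval_add_eval_sub_one_eq_zero {θ : ℝ} (hθ : Real.sin θ ≠ 0) {n : ℤ}
    (h : (2 * n + 1) * θ = 2 * Real.pi) :
    (S ℝ n).eval (2 * Real.cos θ) + (S ℝ (n - 1)).eval (2 * Real.cos θ) = 0 := by
  refine (mul_eq_zero_iff_right hθ).mp ?_
  have h_sub : (n + 1) * θ = 2 * Real.pi - n * θ := by linear_combination h
  rw [add_mul, S_two_mul_real_cos, S_two_mul_real_cos, Int.cast_sub, Int.cast_one, sub_add_cancel,
    h_sub, Real.sin_two_pi_sub, neg_add_cancel]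

theorem sin_two_pi_div_ne_zero {m : ℕ} (hm : 3 ≤ m) : Real.sin (2 * Real.pi / m) ≠ 0 := by
  have hm' : (3 : ℝ) ≤ m := by exact_mod_cast hm
  refine (Real.sin_pos_of_pos_of_lt_pi (by positivity) ?_).ne'
  rw [div_lt_iff₀ (by positivity)]
  nlinarith [Real.pi_pos]

theorem cos_pi_div_ne_zero {m : ℕ} (hm : 3 ≤ m) : Real.cos (Real.pi / m) ≠ 0 := fun h =>
  sin_two_pi_div_ne_zero hm (by rw [mul_div_assoc, Real.sin_two_mul, h, mul_zero])

variable {B : Type*} (M : CoxeterMatrix B)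

/-- The coroots `α_j ↦ -2 cos(π / m_{ij})` of the geometric representation. The junk value
`π / 0 = 0` gives the right constant `-2` for `m_{ij} = ∞`, which is encoded as `0`. -/
noncomputable def geomCoroot (i : B) : Dual ℝ (B →₀ ℝ) :=
  Finsupp.linearCombination ℝ fun j => -2 * Real.cos (Real.pi / M i j)

theorem geomCoroot_single (i j : B) :
    geomCoroot M i (Finsupp.single j 1) = -2 * Real.cos (Real.pi / M i j) := by
  simp [geomCoroot]

theorem geomCoroot_self (i : B) : geomCoroot M i (Finsupp.single i 1) = 2 := by
  simp [geomCoroot_single]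

theorem geomCoroot_mul (i j : B) :
    2 * Real.cos (2 * Real.pi / M i j) =
      geomCoroot M i (Finsupp.single j 1) * geomCoroot M j (Finsupp.single i 1) - 2 := by
  rw [geomCoroot_single, geomCoroot_single, M.symmetric j i, mul_div_assoc, Real.cos_two_mul]
  ring

/-- The simple reflections in the geometric representation of a Coxeter group. -/
noncomputable def geomReflection (i : B) : (B →₀ ℝ) ≃ₗ[ℝ] (B →₀ ℝ) :=
  reflection (geomCoroot_self M i)

variable {M}

theorem geomReflection_mul_pow_of_eq_two {i j : B} (h : M i j = 2) :
    (geomReflection M i * geomReflection M j) ^ 2 = 1 := by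
  have hij : geomCoroot M i (Finsupp.single j 1) = 0 := by simp [geomCoroot_single, h]
  have hji : geomCoroot M j (Finsupp.single i 1) = 0 := by
    simp [geomCoroot_single, M.symmetric j i, h]
  ext1 z
  simp only [pow_two, LinearEquiv.mul_apply, geomReflection, reflection_apply, map_sub,
    map_smul, hij, hji, geomCoroot_self, LinearEquiv.coe_one, id]
  module

theorem geomReflection_mul_pow_of_three_le {i j : B} (h : 3 ≤ M i j) :
    (geomReflection M i * geomReflection M j) ^ M i j = 1 := by
  have h_sin := sin_two_pi_div_ne_zero h
  have hm : (M i j : ℝ) ≠ 0 := by exact_mod_cast (by lia : M i j ≠ 0)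
  have h_angle : (M i j : ℝ) * (2 * Real.pi / M i j) = 2 * Real.pi := mul_div_cancel₀ _ hm
  ext1 z
  rw [geomReflection, geomReflection, reflection_mul_reflection_pow_apply
    (geomCoroot_self M i) (geomCoroot_self M j) (M i j) z _ (geomCoroot_mul M i j)]
  obtain ⟨n, hn | hn⟩ := Nat.even_or_odd' (M i j)
  · have h_eval := chebyshevS_eval_sub_one_eq_zero h_sin (n := n) (by
      rw [hn] at h_angle ⊢
      push_cast at h_angle ⊢
      linear_combination h_angle / 2)
    rw [show ((M i j : ℤ) - 2) / 2 = n - 1 by lia, show ((M i j : ℤ) - 1) / 2 = n - 1 by lia,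
      h_eval]
    simp
  · have h_eval := chebyshevS_eval_add_eval_sub_one_eq_zero h_sin (n := n) (by
      rw [hn] at h_angle ⊢
      exact_mod_cast h_angle)
    rw [show ((M i j : ℤ) - 1) / 2 = n by lia, show ((M i j : ℤ) - 3) / 2 = n - 1 by lia,
      show (M i j : ℤ) / 2 = n by lia, show ((M i j : ℤ) - 2) / 2 = n - 1 by lia, h_eval]
    simp

variable (M) in
theorem isLiftable_geomReflection : M.IsLiftable (geomReflection M) := by
  intro i j
  obtain h | h | h | h : M i j = 0 ∨ M i j = 1 ∨ M i j = 2 ∨ 3 ≤ M i j := by lia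
  · rw [h, pow_zero]
  · obtain rfl : i = j := by_contra fun hij => M.off_diagonal i j hij h
    rw [h, pow_one]
    ext1 z
    exact involutive_reflection (geomCoroot_self M i) z
  · rw [h, geomReflection_mul_pow_of_eq_two h]
  · exact geomReflection_mul_pow_of_three_le h

theorem chebyshevS_eval_of_geomReflection_mul_pow_eq_one {i j : B} (hij : i ≠ j) {k : ℕ}
    (h : (geomReflection M i * geomReflection M j) ^ k = 1) :
    (S ℝ k).eval (2 * Real.cos (2 * Real.pi / M i j)) +
        (S ℝ (k - 1)).eval (2 * Real.cos (2 * Real.pi / M i j)) = 1 ∧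
      (S ℝ (k - 1)).eval (2 * Real.cos (2 * Real.pi / M i j)) *
        Real.cos (Real.pi / M i j) = 0 := by
  have h_coroot : geomCoroot M j (Finsupp.single i 1) = -2 * Real.cos (Real.pi / M i j) := by
    rw [geomCoroot_single, M.symmetric j i]
  have h_apply := LinearEquiv.congr_fun h (Finsupp.single i 1)
  rw [geomReflection, geomReflection, reflection_mul_reflection_pow_apply_self
    (geomCoroot_self M i) (geomCoroot_self M j) k _ (geomCoroot_mul M i j), h_coroot] at h_apply
  have hi := DFunLike.congr_fun h_apply i
  have hj := DFunLike.congr_fun h_apply j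
  simp only [Finsupp.add_apply, Finsupp.smul_apply, Finsupp.single_eq_same, ne_eq, hij, hij.symm,
    not_false_eq_true, Finsupp.single_eq_of_ne, smul_eq_mul, mul_one, mul_zero, add_zero, zero_add,
    LinearEquiv.coe_one, id] at hi hj
  exact ⟨hi, by linarith⟩

theorem dvd_of_geomReflection_mul_pow_eq_one {i j : B} (hij : i ≠ j) {k : ℕ}
    (h : (geomReflection M i * geomReflection M j) ^ k = 1) : M i j ∣ k := by
  obtain ⟨h_one, h_zero⟩ := chebyshevS_eval_of_geomReflection_mul_pow_eq_one hij h
  obtain hm | hm | hm | hm : M i j = 0 ∨ M i j = 1 ∨ M i j = 2 ∨ 3 ≤ M i j := by lia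
  · simp only [hm, CharP.cast_eq_zero, div_zero, Real.cos_zero, mul_one, S_eval_two] at h_one
    push_cast at h_one
    rw [hm, zero_dvd_iff, ← Nat.cast_eq_zero (R := ℝ)]
    linarith
  · exact hm ▸ one_dvd k
  · rw [hm, ← even_iff_two_dvd]
    by_contra h_odd
    have h_even : Even ((k : ℤ) - 1) := by
      simpa [Int.even_sub_one] using h_odd
    simp only [hm, Nat.cast_ofNat, mul_div_cancel_left₀ Real.pi two_ne_zero, Real.cos_pi, mul_neg,
      mul_one, S_eval_neg_two, Int.negOnePow_even _ h_even,
      Int.negOnePow_odd (k : ℤ) (by simpa using h_odd)] at h_one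
    push_cast at h_one
    linarith
  · have h_sin := sin_two_pi_div_ne_zero hm
    set θ := 2 * Real.pi / M i j with hθ
    rw [mul_eq_zero_iff_right (cos_pi_div_ne_zero hm)] at h_zero
    have h_sin_k := S_two_mul_real_cos θ ((k : ℤ) - 1)
    have h_sin_succ := S_two_mul_real_cos θ (k : ℤ)
    rw [h_zero, zero_mul, Int.cast_sub, Int.cast_one, sub_add_cancel, Int.cast_natCast] at h_sin_k
    rw [h_zero, add_zero] at h_one
    rw [h_one, one_mul, Int.cast_natCast, add_one_mul, Real.sin_add, ← h_sin_k, zero_mul, zero_add,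
      right_eq_mul₀ h_sin, Real.cos_eq_one_iff] at h_sin_succ
    obtain ⟨n, hn⟩ := h_sin_succ
    have hm' : (M i j : ℝ) ≠ 0 := by exact_mod_cast (by lia : M i j ≠ 0)
    rw [hθ, mul_div_left_comm, mul_comm, mul_right_inj' (by positivity), eq_div_iff hm'] at hn
    exact Int.natCast_dvd_natCast.mp ⟨n, by rw [mul_comm]; exact_mod_cast hn.symm⟩

theorem orderOf_simple_mul_simple {W : Type*} [Group W] (cs : CoxeterSystem M W) (i j : B) :
    orderOf (cs.simple i * cs.simple j) = M i j := by
  refine Nat.dvd_antisymm (orderOf_dvd_of_pow_eq_one (cs.simple_mul_simple_pow i j)) ?_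
  by_cases hij : i = j
  · simp [hij]
  have h := congrArg (cs.lift ⟨_, isLiftable_geomReflection M⟩)
    (pow_orderOf_eq_one (cs.simple i * cs.simple j))
  rw [map_pow, map_mul, lift_apply_simple, lift_apply_simple, map_one] at h
  exact dvd_of_geomReflection_mul_pow_eq_one hij h

end GeometricRepresentation

/-! ### The strong exchange property -/

section StrongExchange

open CoxeterSystem

variable {B : Type*} {M : CoxeterMatrix B} {W : Type*} [Group W] (cs : CoxeterSystem M W)

theorem leftInvSeq_append (ω ω' : List B) :
    cs.leftInvSeq (ω ++ ω') =
      cs.leftInvSeq ω ++ (cs.leftInvSeq ω').map (MulAut.conj (cs.wordProd ω)) := by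
  induction ω with
  | nil => simp
  | cons i ω ih =>
    simp only [List.cons_append, leftInvSeq, ih, List.map_append, List.map_map, wordProd_cons,
      map_mul, MulAut.coe_mul]

theorem leftInvSeq_alternatingFrom (i j : B) (k : ℕ) :
    cs.leftInvSeq (alternatingFrom i j k) =
      (List.range k).map fun l => (cs.simple i * cs.simple j) ^ l * cs.simple i := by
  induction k generalizing i j with
  | zero => rfl
  | succ k ih =>
    rw [alternatingFrom, leftInvSeq, ih, List.range_succ_eq_map, List.map_cons, List.map_map,
      List.map_map, pow_zero, one_mul]
    refine congrArg _ (List.map_congr_left fun l _ => ?_)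
    rw [Function.comp_apply, Function.comp_apply, MulAut.conj_apply, inv_simple,
      Nat.succ_eq_add_one, pow_succ', mul_assoc (cs.simple i) (cs.simple j), ← mul_pow_mul,
      ← mul_assoc]

theorem wordProd_alternatingFrom_two_mul (i j : B) (k : ℕ) :
    cs.wordProd (alternatingFrom i j (2 * k)) = (cs.simple i * cs.simple j) ^ k := by
  induction k with
  | zero => simp [alternatingFrom]
  | succ k ih =>
    rw [mul_add, mul_one, alternatingFrom, alternatingFrom, wordProd_cons, wordProd_cons, ih,
      pow_succ', mul_assoc]

open Classical in
/-- The action of a simple reflection on pairs of a reflection and a sign: it conjugates the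
reflection and flips the sign of itself. For convenience it is extended to all of `W × ZMod 2`. -/
noncomputable def signedConj (i : B) : Function.End (W × ZMod 2) := fun x =>
  (cs.simple i * x.1 * cs.simple i, x.2 + if x.1 = cs.simple i then 1 else 0)

open Classical in
theorem prod_signedConj_reverse (ω : List B) (r : W) (ε : ZMod 2) :
    (ω.reverse.map (signedConj cs)).prod (r, ε) =
      ((cs.wordProd ω)⁻¹ * r * cs.wordProd ω, ε + (cs.leftInvSeq ω).count r) := by
  induction ω generalizing r ε with
  | nil => simp [Function.End.one_def]
  | cons i ω ih =>
    have h_count : ((cs.leftInvSeq ω).map (MulAut.conj (cs.simple i))).count r =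
        (cs.leftInvSeq ω).count (cs.simple i * r * cs.simple i) := by
      conv_lhs => rw [show r = MulAut.conj (cs.simple i) (cs.simple i * r * cs.simple i) by
        simp [mul_assoc]]
      exact List.count_map_of_injective _ _ (MulAut.conj _).injective _
    rw [List.reverse_cons, List.map_append, List.prod_append, List.map_singleton,
      List.prod_singleton]
    change (ω.reverse.map (signedConj cs)).prod (signedConj cs i (r, ε)) = _
    rw [signedConj, ih, leftInvSeq, List.count_cons, h_count, wordProd_cons]
    refine Prod.ext (by simp [mul_assoc]) ?_
    simp only [beq_iff_eq, eq_comm (a := cs.simple i), Nat.cast_add, Nat.cast_ite, Nat.cast_one,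
      Nat.cast_zero]
    ring

theorem signedConj_mul_pow (i j : B) (k : ℕ) :
    (signedConj cs i * signedConj cs j) ^ k =
      ((alternatingFrom j i (2 * k)).reverse.map (signedConj cs)).prod := by
  induction k with
  | zero => rfl
  | succ k ih =>
    rw [pow_succ, ih, mul_add, mul_one, alternatingFrom, alternatingFrom]
    simp

theorem isLiftable_signedConj : M.IsLiftable (signedConj cs) := by
  classical
  intro i j
  have h_pow : (cs.simple j * cs.simple i) ^ M i j = 1 := cs.simple_mul_simple_pow' i j
  have h_shift : (fun l => (cs.simple j * cs.simple i) ^ l * cs.simple j) ∘ (M i j + ·) =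
      fun l => (cs.simple j * cs.simple i) ^ l * cs.simple j := by
    funext l
    simp [pow_add, h_pow]
  rw [signedConj_mul_pow]
  funext ⟨r, ε⟩
  rw [prod_signedConj_reverse, wordProd_alternatingFrom_two_mul, h_pow, leftInvSeq_alternatingFrom,
    two_mul, List.range_add, List.map_append, List.count_append, List.map_map, h_shift,
    Nat.cast_add, CharTwo.add_self_eq_zero, inv_one, one_mul, mul_one, add_zero,
    Function.End.one_def, id]

/-- The action of the Coxeter group on `W × ZMod 2` that extends `signedConj`. The sign by which
`w⁻¹` acts on a reflection is the parity of its multiplicity in the inversion sequence of any word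
for `w`; that this parity depends only on `w` is the source of the strong exchange property. -/
noncomputable def signedConjHom : W →* Function.End (W × ZMod 2) :=
  cs.lift ⟨signedConj cs, isLiftable_signedConj cs⟩

theorem signedConjHom_simple (i : B) : signedConjHom cs (cs.simple i) = signedConj cs i :=
  cs.lift_apply_simple _ i

open Classical in
theorem signedConjHom_inv_wordProd (ω : List B) (r : W) (ε : ZMod 2) :
    signedConjHom cs (cs.wordProd ω)⁻¹ (r, ε) =
      ((cs.wordProd ω)⁻¹ * r * cs.wordProd ω, ε + (cs.leftInvSeq ω).count r) := by
  rw [← prod_signedConj_reverse, ← wordProd_reverse, wordProd, map_list_prod, List.map_map,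
    show signedConjHom cs ∘ cs.simple = signedConj cs from funext (signedConjHom_simple cs)]

theorem signedConjHom_add (w r : W) (ε δ : ZMod 2) :
    signedConjHom cs w (r, ε + δ) =
      ((signedConjHom cs w (r, ε)).1, (signedConjHom cs w (r, ε)).2 + δ) := by
  classical
  obtain ⟨ω, hω⟩ := cs.wordProd_surjective w⁻¹
  obtain rfl : w = (cs.wordProd ω)⁻¹ := by rw [hω, inv_inv]
  rw [signedConjHom_inv_wordProd, signedConjHom_inv_wordProd, add_right_comm]

theorem signedConjHom_mul_apply (v w : W) (x : W × ZMod 2) :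
    signedConjHom cs (v * w) x = signedConjHom cs v (signedConjHom cs w x) := by
  rw [map_mul]
  rfl

variable {cs}

theorem signedConjHom_self {t : W} (ht : cs.IsReflection t) :
    signedConjHom cs t (t, 0) = (t, 1) := by
  classical
  obtain ⟨v, i, rfl⟩ := ht
  obtain ⟨ω, rfl⟩ := cs.wordProd_surjective v
  set v := cs.wordProd ω with hv
  obtain ⟨ε, hε⟩ : ∃ ε, signedConjHom cs v⁻¹ (v * cs.simple i * v⁻¹, 0) = (cs.simple i, ε) :=
    ⟨_, by rw [signedConjHom_inv_wordProd]; exact Prod.ext (by simp [hv, mul_assoc]) rfl⟩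
  have h_back : signedConjHom cs v (cs.simple i, ε) = (v * cs.simple i * v⁻¹, 0) := by
    rw [← hε, ← signedConjHom_mul_apply, mul_inv_cancel, map_one, Function.End.one_def, id]
  have h_flip : signedConjHom cs (cs.simple i) (cs.simple i, ε) = (cs.simple i, ε + 1) := by
    rw [signedConjHom_simple, signedConj]
    simp
  rw [signedConjHom_mul_apply, hε, signedConjHom_mul_apply, h_flip, signedConjHom_add, h_back,
    zero_add]

theorem mem_leftInvSeq_of_isLeftInversion {ω : List B} {t : W}
    (h : cs.IsLeftInversion (cs.wordProd ω) t) : t ∈ cs.leftInvSeq ω := by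
  classical
  by_contra h_notMem
  obtain ⟨ht, h_lt⟩ := h
  obtain ⟨ω', hω', h_eq⟩ := cs.exists_isReduced (t * cs.wordProd ω)
  have h_sign : ((cs.leftInvSeq ω').count t : ZMod 2) = 1 := by
    have h_act := signedConjHom_inv_wordProd cs ω' t 0
    rw [← h_eq, mul_inv_rev, ht.inv, signedConjHom_mul_apply, signedConjHom_self ht,
      signedConjHom_inv_wordProd, List.count_eq_zero_of_not_mem h_notMem] at h_act
    simpa using (congrArg Prod.snd h_act).symm
  have h_mem : t ∈ cs.leftInvSeq ω' := by
    by_contra hn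
    simp [List.count_eq_zero_of_not_mem hn] at h_sign
  have h_gt := (cs.isLeftInversion_of_mem_leftInvSeq hω' h_mem).2
  rw [← h_eq, ← mul_assoc, ht.mul_self, one_mul] at h_gt
  exact h_gt.asymm h_lt

theorem isReduced_of_nodup_leftInvSeq {ω : List B} (h : (cs.leftInvSeq ω).Nodup) :
    cs.IsReduced ω := by
  classical
  obtain ⟨ω', hω', h_eq⟩ := cs.exists_isReduced (cs.wordProd ω)
  have h_sub : cs.leftInvSeq ω ⊆ cs.leftInvSeq ω' := by
    intro t ht
    by_contra hn
    have h_act := signedConjHom_inv_wordProd cs ω t 0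
    rw [h_eq, signedConjHom_inv_wordProd, List.count_eq_zero_of_not_mem hn,
      List.count_eq_one_of_mem h ht] at h_act
    simpa using congrArg Prod.snd h_act
  have h_le := (h.subperm h_sub).length_le
  rw [length_leftInvSeq, length_leftInvSeq, ← hω'.eq, ← h_eq] at h_le
  exact (cs.length_wordProd_le ω).antisymm h_le

theorem length_alternatingFrom (i j : B) (k : ℕ) : (alternatingFrom i j k).length = k := by
  induction k generalizing i j with
  | zero => rfl
  | succ k ih => rw [alternatingFrom, List.length_cons, ih]

variable (cs) in
theorem isReduced_alternatingFrom {i j : B} {k : ℕ} (hk : M i j ≠ 0 → k ≤ M i j) :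
    cs.IsReduced (alternatingFrom i j k) := by
  refine isReduced_of_nodup_leftInvSeq ?_
  rw [leftInvSeq_alternatingFrom]
  refine List.Nodup.map_on (fun a ha b hb h => ?_) List.nodup_range
  rw [List.mem_range] at ha hb
  rw [mul_left_inj, pow_eq_pow_iff_modEq, orderOf_simple_mul_simple] at h
  rcases eq_or_ne (M i j) 0 with hM | hM
  · rwa [hM, Nat.modEq_zero_iff] at h
  · exact h.eq_of_lt_of_lt (ha.trans_le (hk hM)) (hb.trans_le (hk hM))

theorem length_mul_lt_or_length_conj_mul_lt {t : W} (ht : cs.IsReflection t) {u x : W}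
    (h : cs.length (t * (u * x)) < cs.length (u * x)) :
    cs.length (t * u) < cs.length u ∨ cs.length (u⁻¹ * t * u * x) < cs.length x := by
  obtain ⟨ω, hω, rfl⟩ := cs.exists_isReduced u
  obtain ⟨ω', hω', rfl⟩ := cs.exists_isReduced x
  rw [← wordProd_append] at h
  have h_mem := mem_leftInvSeq_of_isLeftInversion ⟨ht, h⟩
  rw [leftInvSeq_append, List.mem_append, List.mem_map] at h_mem
  rcases h_mem with h_mem | ⟨r, hr, rfl⟩
  · exact .inl (cs.isLeftInversion_of_mem_leftInvSeq hω h_mem).2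
  · refine .inr ?_
    simpa [MulAut.conj_apply, mul_assoc] using (cs.isLeftInversion_of_mem_leftInvSeq hω' hr).2

end StrongExchange

/-! ### The weak order of a Coxeter group -/

theorem exists_lub_of_covers {α : Type*} {r cover : α → α → Prop} (h_refl : ∀ a, r a a)
    (h_trans : ∀ {a b c}, r a b → r b c → r a c) (rank : α → ℕ)
    (h_rank : ∀ {a b}, r a b → rank a ≤ rank b)
    (h_cover : ∀ {x y}, cover x y → r x y ∧ rank x < rank y)
    (h_exists_cover : ∀ {x a}, r x a → r a x ∨ ∃ y, cover x y ∧ r y a)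
    (h_lub_covers : ∀ {x y y' w}, cover x y → cover x y' → r y w → r y' w →
      ∃ d, r y d ∧ r y' d ∧ ∀ z, r y z → r y' z → r d z)
    {x a b w : α} (ha : r x a) (hb : r x b) (haw : r a w) (hbw : r b w) :
    ∃ d, r a d ∧ r b d ∧ ∀ z, r a z → r b z → r d z := by
  induction hn : rank w - rank x using Nat.strong_induction_on generalizing x a b with
  | _ n ih =>
    rcases h_exists_cover ha with hax | ⟨y, hxy, hya⟩
    · exact ⟨b, h_trans hax hb, h_refl b, fun z _ h => h⟩
    rcases h_exists_cover hb with hbx | ⟨y', hxy', hyb⟩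
    · exact ⟨a, h_refl a, h_trans hbx ha, fun z h _ => h⟩
    have hyw := h_trans hya haw
    have hyw' := h_trans hyb hbw
    obtain ⟨d, hyd, hyd', hd⟩ := h_lub_covers hxy hxy' hyw hyw'
    have hdw := hd w hyw hyw'
    have := (h_cover hxy).2
    have := (h_cover hxy').2
    have := h_rank hyd
    have := h_rank hyd'
    have := h_rank hdw
    obtain ⟨e, hae, hde, he⟩ := ih _ (by omega) hya hyd haw hdw rfl
    obtain ⟨f, hbf, hdf, hf⟩ := ih _ (by omega) hyb hyd' hbw hdw rfl
    obtain ⟨g, heg, hfg, hg⟩ := ih _ (by omega) hde hdf (he w haw hdw) (hf w hbw hdw) rfl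
    refine ⟨g, h_trans hae heg, h_trans hbf hfg, fun z haz hbz => ?_⟩
    have hdz := hd z (h_trans hya haz) (h_trans hyb hbz)
    exact hg z (he z haz hdz) (hf z hbz hdz)

section WeakOrder

open CoxeterSystem

variable {B : Type*} {M : CoxeterMatrix B} {W : Type*} [Group W] (cs : CoxeterSystem M W)

/-- The right weak order: `u` is a left factor of `w` with complementary length. -/
def WeakLE (u w : W) : Prop := cs.length u + cs.length (u⁻¹ * w) = cs.length w

variable {cs}

theorem weakLE_mul_iff {u v : W} :
    WeakLE cs u (u * v) ↔ cs.length (u * v) = cs.length u + cs.length v := by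
  rw [WeakLE, inv_mul_cancel_left, eq_comm]

theorem weakLE_simple_iff {w : W} {i : B} : WeakLE cs (cs.simple i) w ↔ cs.IsLeftDescent w i := by
  rw [isLeftDescent_iff, WeakLE, inv_simple, length_simple, add_comm]

namespace WeakLE

theorem refl (u : W) : WeakLE cs u u := by simp [WeakLE]

theorem one_le (u : W) : WeakLE cs 1 u := by simp [WeakLE]

theorem trans {u v w : W} (h : WeakLE cs u v) (h' : WeakLE cs v w) : WeakLE cs u w := by
  have h_le := cs.length_mul_le u (u⁻¹ * w)
  have h_le' := cs.length_mul_le (u⁻¹ * v) (v⁻¹ * w)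
  rw [mul_inv_cancel_left] at h_le
  rw [mul_assoc, mul_inv_cancel_left] at h_le'
  unfold WeakLE at *
  omega

theorem length_le {u w : W} (h : WeakLE cs u w) : cs.length u ≤ cs.length w :=
  h ▸ Nat.le_add_right _ _

theorem antisymm {u w : W} (h : WeakLE cs u w) (h' : WeakLE cs w u) : u = w := by
  have h_le := h'.length_le
  unfold WeakLE at h
  rw [← inv_mul_eq_one, ← cs.length_eq_zero_iff]
  omega

theorem inv_mul {u v w : W} (h : WeakLE cs u v) (h' : WeakLE cs v w) :
    WeakLE cs (u⁻¹ * v) (u⁻¹ * w) := by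
  have huw := h.trans h'
  unfold WeakLE at *
  rw [mul_inv_rev, inv_inv, mul_assoc, mul_inv_cancel_left]
  omega

theorem length_mul {u v w : W} (h : WeakLE cs u w) (h' : WeakLE cs v (u⁻¹ * w)) :
    cs.length (u * v) = cs.length u + cs.length v ∧
      cs.length (u * v) + cs.length ((u * v)⁻¹ * w) = cs.length w := by
  have h_le := cs.length_mul_le u v
  have h_le' := cs.length_mul_le (u * v) ((u * v)⁻¹ * w)
  rw [mul_inv_cancel_left] at h_le'
  unfold WeakLE at *
  rw [mul_inv_rev, mul_assoc] at *
  omega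

theorem le_mul {u v w : W} (h : WeakLE cs u w) (h' : WeakLE cs v (u⁻¹ * w)) :
    WeakLE cs u (u * v) :=
  weakLE_mul_iff.mpr (h.length_mul h').1

theorem mul_le {u v w : W} (h : WeakLE cs u w) (h' : WeakLE cs v (u⁻¹ * w)) :
    WeakLE cs (u * v) w :=
  (h.length_mul h').2

theorem mul_le_mul_left {u v w : W} (h : WeakLE cs u (u * w)) (h' : WeakLE cs v w) :
    WeakLE cs (u * v) (u * w) :=
  h.mul_le (by rwa [inv_mul_cancel_left])

end WeakLE

theorem isReduced_append_iff {ω ω' : List B} :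
    cs.IsReduced (ω ++ ω') ↔ cs.IsReduced ω ∧ cs.IsReduced ω' ∧
      WeakLE cs (cs.wordProd ω) (cs.wordProd (ω ++ ω')) := by
  have h := cs.length_wordProd_le ω
  have h' := cs.length_wordProd_le ω'
  have h_mul := cs.length_mul_le (cs.wordProd ω) (cs.wordProd ω')
  rw [wordProd_append, weakLE_mul_iff]
  unfold CoxeterSystem.IsReduced
  rw [wordProd_append, List.length_append]
  omega

theorem isReduced_nil : cs.IsReduced [] := by
  simp [CoxeterSystem.IsReduced]

theorem isReduced_singleton (i : B) : cs.IsReduced [i] := by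
  simp [CoxeterSystem.IsReduced]

theorem isReduced_cons_iff {i : B} {ω : List B} :
    cs.IsReduced (i :: ω) ↔ cs.IsReduced ω ∧ cs.IsLeftDescent (cs.wordProd (i :: ω)) i := by
  rw [← List.singleton_append, isReduced_append_iff, wordProd_singleton, weakLE_simple_iff,
    and_iff_right (isReduced_singleton i)]

/-! ### Dihedral subgroups -/

theorem alternatingFrom_eq_reverse (i j : B) (k : ℕ) :
    alternatingFrom i j k = (alternatingWord j i k).reverse := by
  induction k generalizing i j with
  | zero => rfl
  | succ k ih => rw [alternatingFrom, alternatingWord_succ, ih, List.concat_eq_append,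
      List.reverse_append, List.reverse_singleton, List.singleton_append]

variable (cs)

theorem wordProd_alternatingFrom_braid (i j : B) :
    cs.wordProd (alternatingFrom i j (M i j)) = cs.wordProd (alternatingFrom j i (M j i)) := by
  rw [alternatingFrom_eq_reverse, alternatingFrom_eq_reverse, wordProd_reverse, wordProd_reverse,
    M.symmetric i j, ← braidWord, M.symmetric j i, ← braidWord, wordProd_braidWord_eq]

theorem wordProd_alternatingFrom_mem {H : Subgroup W} {i j : B} (hi : cs.simple i ∈ H)
    (hj : cs.simple j ∈ H) (k : ℕ) : cs.wordProd (alternatingFrom i j k) ∈ H := by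
  induction k generalizing i j with
  | zero => exact H.one_mem
  | succ k ih =>
    rw [alternatingFrom, wordProd_cons]
    exact H.mul_mem hi (ih hj hi)

/-- The products `i * j * i * ⋯` of at most `M i j` alternating factors (of any number of factors
when `M i j = 0`, which encodes an infinite order). -/
def alternatingProducts (i j : B) : Set W :=
  {q | ∃ k, (M i j ≠ 0 → k ≤ M i j) ∧ cs.wordProd (alternatingFrom i j k) = q}

theorem simple_mul_mem_alternatingProducts {i j : B} {q : W}
    (hq : q ∈ alternatingProducts cs i j ∪ alternatingProducts cs j i) :
    cs.simple i * q ∈ alternatingProducts cs i j ∪ alternatingProducts cs j i := by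
  have h_self : ∀ q ∈ alternatingProducts cs i j,
      cs.simple i * q ∈ alternatingProducts cs i j ∪ alternatingProducts cs j i := by
    rintro _ ⟨_ | k, hk, rfl⟩
    · exact .inl ⟨1, fun h => Nat.one_le_iff_ne_zero.mpr h, rfl⟩
    · refine .inr ⟨k, fun h => ?_, ?_⟩
      · rw [M.symmetric j i] at h ⊢
        exact (Nat.le_succ k).trans (hk h)
      · rw [alternatingFrom, wordProd_cons, simple_mul_simple_cancel_left]
  obtain hq | ⟨k, hk, rfl⟩ := hq
  · exact h_self q hq
  by_cases hkM : M i j ≠ 0 ∧ k = M i j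
  · refine h_self _ ⟨M i j, fun _ => le_rfl, ?_⟩
    rw [wordProd_alternatingFrom_braid, hkM.2, M.symmetric j i]
  · refine .inl ⟨k + 1, fun h => ?_, wordProd_cons ..⟩
    rw [M.symmetric j i] at hk
    have := hk h
    omega

theorem closure_pair_subset_alternatingProducts (i j : B) :
    (Subgroup.closure {cs.simple i, cs.simple j} : Set W) ⊆
      alternatingProducts cs i j ∪ alternatingProducts cs j i := by
  have h_mul : ∀ x ∈ ({cs.simple i, cs.simple j} : Set W),
      ∀ q ∈ alternatingProducts cs i j ∪ alternatingProducts cs j i,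
      x * q ∈ alternatingProducts cs i j ∪ alternatingProducts cs j i := by
    rintro _ (rfl | rfl) q hq
    · exact simple_mul_mem_alternatingProducts cs hq
    · rw [Set.union_comm] at hq ⊢
      exact simple_mul_mem_alternatingProducts cs hq
  intro q hq
  induction hq using Subgroup.closure_induction_left with
  | one => exact .inl ⟨0, fun _ => Nat.zero_le _, rfl⟩
  | mul_left x hx y _ ih => exact h_mul x hx y ih
  | inv_mul_cancel x hx y _ ih =>
    have hx_inv : x⁻¹ = x := by rcases hx with rfl | rfl <;> exact inv_simple ..
    rw [hx_inv]
    exact h_mul x hx y ih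

theorem exists_eq_mul_forall_length_le (H : Subgroup W) (w : W) :
    ∃ q ∈ H, ∃ x, w = q * x ∧ ∀ q' ∈ H, cs.length x ≤ cs.length (q' * x) := by
  obtain ⟨h, hh⟩ : ∃ h : H, ∀ h' : H, cs.length (h * w) ≤ cs.length (h' * w) :=
    ⟨_, fun h' => Function.argmin_le (fun h : H => cs.length (h * w)) h'⟩
  refine ⟨_, H.inv_mem h.2, h * w, (inv_mul_cancel_left _ _).symm, fun q' hq' => ?_⟩
  simpa [mul_assoc] using hh (⟨q', hq'⟩ * h)

variable {cs}

theorem length_alternatingFrom_mul {i j : B} {x : W}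
    (hx : ∀ q ∈ Subgroup.closure {cs.simple i, cs.simple j}, cs.length x ≤ cs.length (q * x))
    {k : ℕ} (hk : M i j ≠ 0 → k ≤ M i j) :
    cs.length (cs.wordProd (alternatingFrom i j k) * x) = k + cs.length x := by
  induction k generalizing i j with
  | zero => simp [alternatingFrom]
  | succ k ih =>
    have hk' : M j i ≠ 0 → k ≤ M j i := by
      rw [M.symmetric j i]
      exact fun h => (Nat.le_succ k).trans (hk h)
    have h_tail := ih (by rwa [Set.pair_comm]) hk'
    have hi : cs.simple i ∈ Subgroup.closure {cs.simple i, cs.simple j} :=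
      Subgroup.subset_closure (.inl rfl)
    have hq := wordProd_alternatingFrom_mem cs (Subgroup.subset_closure (.inr rfl)) hi k
    have h_red := (isReduced_cons_iff.mp (isReduced_alternatingFrom cs hk)).2
    rw [wordProd_cons, IsLeftDescent, simple_mul_simple_cancel_left] at h_red
    rw [alternatingFrom, wordProd_cons, mul_assoc]
    rcases cs.length_simple_mul (cs.wordProd (alternatingFrom j i k) * x) i with h | h
    · omega
    rcases length_mul_lt_or_length_conj_mul_lt (cs.isReflection_simple i)
      (u := cs.wordProd (alternatingFrom j i k)) (x := x) (by omega) with h | h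
    · omega
    · exact absurd (hx _ (mul_mem (mul_mem (inv_mem hq) hi) hq)) h.not_ge

theorem eq_of_isLeftDescent_alternatingFrom_mul {i j : B} {x : W}
    (hx : ∀ q ∈ Subgroup.closure {cs.simple i, cs.simple j}, cs.length x ≤ cs.length (q * x))
    {k : ℕ} (hk : M i j ≠ 0 → k ≤ M i j)
    (hj : cs.IsLeftDescent (cs.wordProd (alternatingFrom i j k) * x) j) :
    M i j ≠ 0 ∧ k = M i j := by
  by_contra h_ne
  have h_long := length_alternatingFrom_mul (i := j) (j := i) (k := k + 1)
    (by rwa [Set.pair_comm]) fun h => by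
      rw [M.symmetric j i] at h ⊢
      have := hk h
      omega
  rw [alternatingFrom, wordProd_cons, mul_assoc] at h_long
  rw [IsLeftDescent, h_long, length_alternatingFrom_mul hx hk] at hj
  omega

theorem weakLE_alternatingFrom_of_isLeftDescent {i j : B} {w : W} (hi : cs.IsLeftDescent w i)
    (hj : cs.IsLeftDescent w j) :
    M i j ≠ 0 ∧ WeakLE cs (cs.wordProd (alternatingFrom i j (M i j))) w := by
  obtain ⟨q, hq, x, rfl, hx⟩ :=
    exists_eq_mul_forall_length_le cs (Subgroup.closure {cs.simple i, cs.simple j}) w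
  obtain ⟨hM, rfl⟩ : M i j ≠ 0 ∧ cs.wordProd (alternatingFrom i j (M i j)) = q := by
    obtain ⟨k, hk, rfl⟩ | ⟨k, hk, rfl⟩ := closure_pair_subset_alternatingProducts cs i j hq
    · obtain ⟨hM, rfl⟩ := eq_of_isLeftDescent_alternatingFrom_mul hx hk hj
      exact ⟨hM, rfl⟩
    · rw [Set.pair_comm] at hx
      obtain ⟨hM, rfl⟩ := eq_of_isLeftDescent_alternatingFrom_mul hx hk hi
      exact ⟨M.symmetric j i ▸ hM, wordProd_alternatingFrom_braid cs i j⟩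
  refine ⟨hM, weakLE_mul_iff.mpr ?_⟩
  rw [length_alternatingFrom_mul hx fun _ => le_rfl,
    (isReduced_alternatingFrom cs fun _ => le_rfl).eq, length_alternatingFrom]

theorem simple_weakLE_alternatingFrom {i j : B} (hM : M i j ≠ 0) :
    WeakLE cs (cs.simple i) (cs.wordProd (alternatingFrom i j (M i j))) := by
  have h_red := isReduced_alternatingFrom cs (i := i) (j := j) fun _ => le_rfl
  obtain ⟨m, hm⟩ := Nat.exists_eq_succ_of_ne_zero hM
  rw [hm, alternatingFrom] at h_red ⊢
  exact weakLE_simple_iff.mpr (isReduced_cons_iff.mp h_red).2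

/-! ### Joins in the weak order -/

theorem exists_weakLE_lub_mul_simple {x w : W} {i j : B} (hi : WeakLE cs x (x * cs.simple i))
    (hj : WeakLE cs x (x * cs.simple j)) (hiw : WeakLE cs (x * cs.simple i) w)
    (hjw : WeakLE cs (x * cs.simple j) w) :
    ∃ d, WeakLE cs (x * cs.simple i) d ∧ WeakLE cs (x * cs.simple j) d ∧
      ∀ z, WeakLE cs (x * cs.simple i) z → WeakLE cs (x * cs.simple j) z → WeakLE cs d z := by
  have h_dihedral : ∀ z, WeakLE cs (x * cs.simple i) z → WeakLE cs (x * cs.simple j) z →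
      M i j ≠ 0 ∧ WeakLE cs (cs.wordProd (alternatingFrom i j (M i j))) (x⁻¹ * z) := by
    intro z hiz hjz
    have hi_desc := hi.inv_mul hiz
    have hj_desc := hj.inv_mul hjz
    rw [inv_mul_cancel_left, weakLE_simple_iff] at hi_desc hj_desc
    exact weakLE_alternatingFrom_of_isLeftDescent hi_desc hj_desc
  obtain ⟨hM, hw⟩ := h_dihedral w hiw hjw
  have hx := (hi.trans hiw).le_mul hw
  refine ⟨x * cs.wordProd (alternatingFrom i j (M i j)),
    hx.mul_le_mul_left (simple_weakLE_alternatingFrom hM), hx.mul_le_mul_left ?_,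
    fun z hiz hjz => (hi.trans hiz).mul_le (h_dihedral z hiz hjz).2⟩
  rw [wordProd_alternatingFrom_braid]
  exact simple_weakLE_alternatingFrom (by rwa [M.symmetric j i])

variable (cs)

theorem exists_forall_weakLE [Finite W] : ∃ w₀, ∀ u, WeakLE cs u w₀ := by
  obtain ⟨w₀, h_max⟩ := Finite.exists_max cs.length
  refine ⟨w₀, fun u => ?_⟩
  induction hn : cs.length u generalizing u with
  | zero => exact cs.length_eq_zero_iff.mp hn ▸ WeakLE.one_le _
  | succ n ih =>
    obtain ⟨i, hi⟩ := cs.exists_rightDescent_of_ne_one fun h : u = 1 => by simp [h] at hn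
    obtain ⟨v, rfl⟩ : ∃ v, u = v * cs.simple i := ⟨u * cs.simple i, by simp⟩
    rw [isRightDescent_iff, simple_mul_simple_cancel_right] at hi
    have h_refl : cs.IsReflection (v * cs.simple i * v⁻¹) := ⟨v, i, rfl⟩
    have h_lt := lt_of_le_of_ne (h_max _) (h_refl.length_mul_right_ne w₀)
    rw [← mul_inv_cancel_left v w₀] at h_lt
    have h_desc : cs.IsLeftDescent (v⁻¹ * w₀) i := by
      rcases length_mul_lt_or_length_conj_mul_lt h_refl h_lt with h | h
      · rw [inv_mul_cancel_right] at h
        omega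
      · rwa [mul_assoc v, inv_mul_cancel_left, inv_mul_cancel_right] at h
    exact (ih v (by omega)).mul_le (weakLE_simple_iff.mpr h_desc)

theorem exists_weakLE_lub [Finite W] (u v : W) :
    ∃ d, WeakLE cs u d ∧ WeakLE cs v d ∧
      ∀ z, WeakLE cs u z → WeakLE cs v z → WeakLE cs d z := by
  obtain ⟨w₀, h_top⟩ := exists_forall_weakLE cs
  refine exists_lub_of_covers (r := WeakLE cs)
    (cover := fun x y => ∃ i, y = x * cs.simple i ∧ WeakLE cs x y) WeakLE.refl
    WeakLE.trans cs.length WeakLE.length_le ?_ ?_ ?_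
    (WeakLE.one_le u) (WeakLE.one_le v) (h_top u) (h_top v)
  · rintro x y ⟨i, rfl, h⟩
    refine ⟨h, ?_⟩
    rw [weakLE_mul_iff, length_simple] at h
    omega
  · intro x a h
    rcases eq_or_ne x a with rfl | hxa
    · exact .inl (WeakLE.refl x)
    · obtain ⟨i, hi⟩ := cs.exists_leftDescent_of_ne_one (mt inv_mul_eq_one.mp hxa)
      rw [← weakLE_simple_iff] at hi
      exact .inr ⟨_, ⟨i, rfl, h.le_mul hi⟩, h.mul_le hi⟩
  · rintro x y y' w ⟨i, rfl, hi⟩ ⟨j, rfl, hj⟩ hyw hyw'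
    exact exists_weakLE_lub_mul_simple hi hj hyw hyw'

variable [Finite W]

/-- The least upper bound of two elements of a finite Coxeter group in the weak order. -/
noncomputable def weakJoin (u v : W) : W := (exists_weakLE_lub cs u v).choose

theorem weakLE_weakJoin_left (u v : W) : WeakLE cs u (weakJoin cs u v) :=
  (exists_weakLE_lub cs u v).choose_spec.1

theorem weakLE_weakJoin_right (u v : W) : WeakLE cs v (weakJoin cs u v) :=
  (exists_weakLE_lub cs u v).choose_spec.2.1

variable {cs}

theorem WeakLE.weakJoin_le {u v z : W} (hu : WeakLE cs u z) (hv : WeakLE cs v z) :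
    WeakLE cs (weakJoin cs u v) z :=
  (exists_weakLE_lub cs u v).choose_spec.2.2 z hu hv

theorem weakJoin_eq_right {u v : W} (h : WeakLE cs u v) : weakJoin cs u v = v :=
  (h.weakJoin_le (WeakLE.refl v)).antisymm (weakLE_weakJoin_right cs u v)

variable (cs)

theorem weakJoin_comm (u v : W) : weakJoin cs u v = weakJoin cs v u :=
  ((weakLE_weakJoin_right cs v u).weakJoin_le (weakLE_weakJoin_left cs v u)).antisymm
    ((weakLE_weakJoin_right cs u v).weakJoin_le (weakLE_weakJoin_left cs u v))

/-- The right complement `u⁻¹ (u ∨ v)`: what must be appended to `u` to reach its weak order join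
with `v`. -/
noncomputable def weakComplement (u v : W) : W := u⁻¹ * weakJoin cs u v

theorem mul_weakComplement (u v : W) : u * weakComplement cs u v = weakJoin cs u v :=
  mul_inv_cancel_left u _

theorem weakComplement_self (u : W) : weakComplement cs u u = 1 := by
  rw [weakComplement, weakJoin_eq_right (WeakLE.refl u), inv_mul_cancel]

theorem weakComplement_one_left (u : W) : weakComplement cs 1 u = u := by
  rw [weakComplement, weakJoin_eq_right (WeakLE.one_le u), inv_one, one_mul]

theorem weakComplement_one_right (u : W) : weakComplement cs u 1 = 1 := by
  rw [weakComplement, weakJoin_comm, weakJoin_eq_right (WeakLE.one_le u), inv_mul_cancel]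

variable {cs}

namespace WeakLE

theorem weakJoin_mul {v v' : W} (h : WeakLE cs v (v * v')) (u : W) :
    weakJoin cs (v * v') u = v * weakJoin cs v' (weakComplement cs v u) := by
  have hvv' := weakLE_weakJoin_left cs (v * v') u
  have hu := weakLE_weakJoin_right cs (v * v') u
  have hv := h.trans hvv'
  have h_le : WeakLE cs (weakJoin cs v' (weakComplement cs v u))
      (v⁻¹ * weakJoin cs (v * v') u) := by
    refine weakJoin_le ?_ ((weakLE_weakJoin_left cs v u).inv_mul (hv.weakJoin_le hu))
    simpa only [inv_mul_cancel_left] using h.inv_mul hvv'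
  have hv_le := hv.le_mul h_le
  refine antisymm (weakJoin_le ?_ ?_) (hv.mul_le h_le)
  · exact hv_le.mul_le_mul_left (weakLE_weakJoin_left cs _ _)
  · refine (weakLE_weakJoin_right cs v u).trans ?_
    rw [← mul_weakComplement]
    exact hv_le.mul_le_mul_left (weakLE_weakJoin_right cs _ _)

theorem weakComplement_mul_left {v v' : W} (h : WeakLE cs v (v * v')) (u : W) :
    weakComplement cs (v * v') u = weakComplement cs v' (weakComplement cs v u) := by
  rw [weakComplement, h.weakJoin_mul, mul_inv_rev, mul_assoc, inv_mul_cancel_left]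
  rfl

theorem weakComplement_mul_right {v v' : W} (h : WeakLE cs v (v * v')) (u : W) :
    weakComplement cs u (v * v') =
      weakComplement cs u v * weakComplement cs (weakComplement cs v u) v' := by
  rw [weakComplement, weakJoin_comm, h.weakJoin_mul, weakJoin_comm cs v',
    ← mul_weakComplement cs _ v', ← mul_assoc v, mul_weakComplement, ← mul_assoc,
    weakJoin_comm cs v u]
  rfl

theorem weakComplement_right {v v' : W} (h : WeakLE cs v v') (u : W) :
    WeakLE cs (weakComplement cs u v) (weakComplement cs u v') :=
  (weakLE_weakJoin_left cs u v).inv_mul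
    ((weakLE_weakJoin_left cs u v').weakJoin_le (h.trans (weakLE_weakJoin_right cs u v')))

end WeakLE

end WeakOrder

/-! ### The lift of a Coxeter group to its Artin monoid -/

section ArtinWord

variable {B : Type*} (M : CoxeterMatrix B)

/-- The element of the Artin monoid represented by a word. -/
def artinWord (ω : List B) : M.ArtinMonoid :=
  PresentedMonoid.mk M.artinRel (FreeMonoid.ofList ω)

theorem artinWord_nil : artinWord M [] = 1 := rfl

theorem artinWord_cons (i : B) (ω : List B) :
    artinWord M (i :: ω) = PresentedMonoid.of M.artinRel i * artinWord M ω := rfl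

theorem artinWord_append (ω ω' : List B) :
    artinWord M (ω ++ ω') = artinWord M ω * artinWord M ω' := rfl

theorem artinWord_surjective : Function.Surjective (artinWord M) :=
  PresentedMonoid.surjective_mk

variable {M} in
theorem artinWord_braid {i j : B} (h : M i j ≠ 0) :
    artinWord M (alternatingFrom i j (M i j)) = artinWord M (alternatingFrom j i (M j i)) :=
  Quotient.sound (ConGen.Rel.of _ _ ⟨i, j, h, rfl, rfl⟩)

end ArtinWord

section ArtinLift

open CoxeterSystem

variable {B : Type*} {M : CoxeterMatrix B} {W : Type*} [Group W] {cs : CoxeterSystem M W}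

theorem exists_cons_artinWord_eq {i j : B} {w : W} (hi : cs.IsLeftDescent w i)
    (hj : cs.IsLeftDescent w j) :
    ∃ ω ω', cs.IsReduced (i :: ω) ∧ cs.IsReduced (j :: ω') ∧ cs.wordProd (i :: ω) = w ∧
      cs.wordProd (j :: ω') = w ∧ artinWord M (i :: ω) = artinWord M (j :: ω') := by
  obtain ⟨hM, h_le⟩ := weakLE_alternatingFrom_of_isLeftDescent hi hj
  obtain ⟨ω, hω, h_eq⟩ :=
    cs.exists_isReduced ((cs.wordProd (alternatingFrom i j (M i j)))⁻¹ * w)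
  have h_prod : cs.wordProd (alternatingFrom i j (M i j) ++ ω) = w := by
    rw [wordProd_append, ← h_eq, mul_inv_cancel_left]
  have h_prod' : cs.wordProd (alternatingFrom j i (M j i) ++ ω) = w := by
    rw [wordProd_append, ← wordProd_alternatingFrom_braid, ← wordProd_append, h_prod]
  have h_red : cs.IsReduced (alternatingFrom i j (M i j) ++ ω) := by
    rw [isReduced_append_iff, h_prod]
    exact ⟨isReduced_alternatingFrom cs fun _ => le_rfl, hω, h_le⟩
  have h_red' : cs.IsReduced (alternatingFrom j i (M j i) ++ ω) := by
    rw [isReduced_append_iff, h_prod', ← wordProd_alternatingFrom_braid]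
    exact ⟨isReduced_alternatingFrom cs fun _ => le_rfl, hω, h_le⟩
  have h_braid : artinWord M (alternatingFrom i j (M i j) ++ ω) =
      artinWord M (alternatingFrom j i (M j i) ++ ω) := by
    rw [artinWord_append, artinWord_append, artinWord_braid hM]
  obtain ⟨m, hm⟩ := Nat.exists_eq_succ_of_ne_zero hM
  rw [M.symmetric j i] at h_prod' h_red' h_braid
  rw [hm] at h_prod h_red h_prod' h_red' h_braid
  exact ⟨_, _, h_red, h_red', h_prod, h_prod', h_braid⟩

/-- **Matsumoto's theorem**. -/
theorem artinWord_eq_of_isReduced {ω ω' : List B} (hω : cs.IsReduced ω) (hω' : cs.IsReduced ω')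
    (h : cs.wordProd ω = cs.wordProd ω') : artinWord M ω = artinWord M ω' := by
  have h_length : ω.length = ω'.length := by rw [← hω.eq, h, hω'.eq]
  induction hn : ω.length generalizing ω ω' with
  | zero =>
    rw [List.length_eq_zero_iff.mp hn, List.length_eq_zero_iff.mp (h_length.symm.trans hn)]
  | succ n ih =>
    have h_same_head : ∀ {i : B} {ω ω' : List B}, cs.IsReduced (i :: ω) →
        cs.IsReduced (i :: ω') → cs.wordProd (i :: ω) = cs.wordProd (i :: ω') →
        (i :: ω).length = n + 1 → artinWord M (i :: ω) = artinWord M (i :: ω') := by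
      intro i ω ω' hω hω' h hn
      have h_length : (i :: ω).length = (i :: ω').length := by rw [← hω.eq, h, hω'.eq]
      rw [wordProd_cons, wordProd_cons, mul_right_inj] at h
      rw [artinWord_cons, artinWord_cons, ih (isReduced_cons_iff.mp hω).1
        (isReduced_cons_iff.mp hω').1 h (Nat.succ_injective h_length) (Nat.succ_injective hn)]
    obtain ⟨i, ω, rfl⟩ := List.exists_cons_of_length_eq_add_one hn
    obtain ⟨j, ω', rfl⟩ := List.exists_cons_of_length_eq_add_one (h_length ▸ hn)
    obtain ⟨ω₁, ω₁', h_red, h_red', h_prod, h_prod', h_braid⟩ := exists_cons_artinWord_eq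
      (isReduced_cons_iff.mp hω).2 (h ▸ (isReduced_cons_iff.mp hω').2)
    rw [h_same_head hω h_red h_prod.symm hn, h_braid,
      h_same_head hω' h_red' (h_prod'.trans h).symm (h_length ▸ hn)]

variable (cs)

/-- The section of the projection from the Artin monoid to the Coxeter group given by reduced
words. -/
noncomputable def artinLift (w : W) : M.ArtinMonoid :=
  artinWord M (cs.exists_isReduced w).choose

variable {cs} in
theorem artinLift_wordProd {ω : List B} (hω : cs.IsReduced ω) :
    artinLift cs (cs.wordProd ω) = artinWord M ω :=
  artinWord_eq_of_isReduced (cs.exists_isReduced _).choose_spec.1 hω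
    (cs.exists_isReduced _).choose_spec.2.symm

theorem artinLift_one : artinLift cs 1 = 1 :=
  artinLift_wordProd (cs := cs) isReduced_nil

theorem artinLift_simple (i : B) :
    artinLift cs (cs.simple i) = PresentedMonoid.of M.artinRel i := by
  rw [← wordProd_singleton, artinLift_wordProd (isReduced_singleton i), artinWord_cons,
    artinWord_nil, mul_one]

variable {cs} in
theorem WeakLE.artinLift_mul {u v : W} (h : WeakLE cs u (u * v)) :
    artinLift cs (u * v) = artinLift cs u * artinLift cs v := by
  obtain ⟨ω, hω, rfl⟩ := cs.exists_isReduced u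
  obtain ⟨ω', hω', rfl⟩ := cs.exists_isReduced v
  rw [← wordProd_append] at h ⊢
  rw [artinLift_wordProd hω, artinLift_wordProd hω',
    artinLift_wordProd (isReduced_append_iff.mpr ⟨hω, hω', h⟩), artinWord_append]

variable [Finite W]

theorem artinLift_weakJoin (u v : W) :
    artinLift cs (weakJoin cs u v) = artinLift cs u * artinLift cs (weakComplement cs u v) := by
  have h := weakLE_weakJoin_left cs u v
  rw [← mul_weakComplement] at h ⊢
  exact h.artinLift_mul

variable {cs} in
theorem WeakLE.artinLift_weakComplement_mul {v v' : W} (h : WeakLE cs v (v * v')) (u : W) :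
    artinLift cs (weakComplement cs u (v * v')) = artinLift cs (weakComplement cs u v) *
      artinLift cs (weakComplement cs (weakComplement cs v u) v') := by
  have h_le := h.weakComplement_right u
  rw [h.weakComplement_mul_right] at h_le ⊢
  exact h_le.artinLift_mul

end ArtinLift

/-! ### Right complements in Artin monoids of finite type -/

section ArtinComplement

open CoxeterSystem

variable {B : Type*} {M : CoxeterMatrix B} {W : Type*} [Group W] [Finite W]
  (cs : CoxeterSystem M W)

/-- One step of a transducer that computes right complements in the Artin monoid: in state `u`, it
reads `v`, appends the lift of `u⁻¹ (u ∨ v)` to the output and moves to the state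
`v⁻¹ (u ∨ v)`. -/
noncomputable def complementStep (v : W) : Function.End (W × M.ArtinMonoid) := fun x =>
  (weakComplement cs v x.1, x.2 * artinLift cs (weakComplement cs x.1 v))

theorem complementStep_one : complementStep cs 1 = 1 := by
  funext x
  rw [complementStep, weakComplement_one_left, weakComplement_one_right, artinLift_one, mul_one]
  rfl

variable {cs} in
theorem WeakLE.complementStep_mul {v v' : W} (h : WeakLE cs v (v * v')) :
    complementStep cs (v * v') = complementStep cs v' * complementStep cs v := by
  funext x
  change _ = complementStep cs v' (complementStep cs v x)
  simp only [complementStep, h.weakComplement_mul_left, h.artinLift_weakComplement_mul, mul_assoc]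

variable {cs} in
theorem prod_complementStep {ω : List B} (hω : cs.IsReduced ω) :
    (ω.map fun i => MulOpposite.op (complementStep cs (cs.simple i))).prod =
      MulOpposite.op (complementStep cs (cs.wordProd ω)) := by
  induction ω with
  | nil => rw [wordProd_nil, complementStep_one, List.map_nil, List.prod_nil, MulOpposite.op_one]
  | cons i ω ih =>
    obtain ⟨h_red, h_desc⟩ := isReduced_cons_iff.mp hω
    rw [← weakLE_simple_iff, wordProd_cons] at h_desc
    rw [List.map_cons, List.prod_cons, ih h_red, wordProd_cons, h_desc.complementStep_mul,
      MulOpposite.op_mul]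

/-- The right action of the Artin monoid on the states and outputs of the transducer. -/
noncomputable def complementHom : M.ArtinMonoid →* (Function.End (W × M.ArtinMonoid))ᵐᵒᵖ :=
  PresentedMonoid.lift (fun i => MulOpposite.op (complementStep cs (cs.simple i))) <| by
    rintro _ _ ⟨i, j, -, rfl, rfl⟩
    rw [FreeMonoid.lift_ofList, FreeMonoid.lift_ofList,
      prod_complementStep (isReduced_alternatingFrom cs fun _ => le_rfl),
      prod_complementStep (isReduced_alternatingFrom cs fun _ => le_rfl),
      wordProd_alternatingFrom_braid]

/-- The state reached and output produced by the transducer on reading `b` in the state `x.1` with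
previous output `x.2`. -/
noncomputable def complementAct (b : M.ArtinMonoid) (x : W × M.ArtinMonoid) : W × M.ArtinMonoid :=
  (complementHom cs b).unop x

theorem complementAct_one (x : W × M.ArtinMonoid) : complementAct cs 1 x = x := by
  rw [complementAct, map_one]
  rfl

theorem complementAct_mul (a b : M.ArtinMonoid) (x : W × M.ArtinMonoid) :
    complementAct cs (a * b) x = complementAct cs b (complementAct cs a x) := by
  rw [complementAct, map_mul]
  rfl

theorem complementAct_of (i : B) (u : W) (c : M.ArtinMonoid) :
    complementAct cs (PresentedMonoid.of M.artinRel i) (u, c) =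
      (weakComplement cs (cs.simple i) u,
        c * artinLift cs (weakComplement cs u (cs.simple i))) := rfl

theorem exists_complementAct_eq (b : M.ArtinMonoid) (u : W) :
    ∃ (v : W) (d : M.ArtinMonoid), (∀ c, complementAct cs b (u, c) = (v, c * d)) ∧
      artinLift cs u * d = b * artinLift cs v := by
  obtain ⟨ω, rfl⟩ := artinWord_surjective M b
  induction ω generalizing u with
  | nil => exact ⟨u, 1, fun c => by rw [artinWord_nil, complementAct_one, mul_one],
      by rw [artinWord_nil, one_mul, mul_one]⟩
  | cons i ω ih =>
    obtain ⟨v, d, h_act, h_mul⟩ := ih (weakComplement cs (cs.simple i) u)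
    refine ⟨v, artinLift cs (weakComplement cs u (cs.simple i)) * d, fun c => ?_, ?_⟩
    · rw [artinWord_cons, complementAct_mul, complementAct_of, h_act, mul_assoc]
    · rw [← mul_assoc, ← artinLift_weakJoin, weakJoin_comm, artinLift_weakJoin, mul_assoc, h_mul,
        artinWord_cons, mul_assoc, artinLift_simple]

theorem complementAct_one_state (b c : M.ArtinMonoid) :
    complementAct cs b (1, c) = (1, c * b) := by
  obtain ⟨ω, rfl⟩ := artinWord_surjective M b
  induction ω generalizing c with
  | nil => rw [artinWord_nil, complementAct_one, mul_one]
  | cons i ω ih =>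
    rw [artinWord_cons, complementAct_mul, complementAct_of, weakComplement_one_right,
      weakComplement_one_left, ih, artinLift_simple, mul_assoc]

theorem complementAct_of_mul (i : B) (b : M.ArtinMonoid) :
    complementAct cs (PresentedMonoid.of M.artinRel i * b) (cs.simple i, 1) = (1, b) := by
  rw [complementAct_mul, complementAct_of, weakComplement_self, artinLift_one,
    complementAct_one_state, mul_one, one_mul]

end ArtinComplement

/-! ### Artin monoids of finite type -/

section FiniteType

open CoxeterSystem

variable {B : Type*} {M : CoxeterMatrix B} {W : Type*} [Group W] [Finite W]

theorem isLeftCancelMul_artinMonoid (cs : CoxeterSystem M W) : IsLeftCancelMul M.ArtinMonoid where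
  mul_left_cancel a b c h := by
    obtain ⟨ω, rfl⟩ := artinWord_surjective M a
    induction ω with
    | nil => simpa only [artinWord_nil, one_mul] using h
    | cons i ω ih =>
      refine ih ?_
      have h_act := congrArg (fun x => complementAct cs x (cs.simple i, 1)) h
      simp only [artinWord_cons, mul_assoc, complementAct_of_mul] at h_act
      exact congrArg Prod.snd h_act

theorem isRightDirected_artinMonoid (cs : CoxeterSystem M W) : IsRightDirected M.ArtinMonoid := by
  intro a b
  obtain ⟨ω, rfl⟩ := artinWord_surjective M a
  induction ω generalizing b with
  | nil => exact ⟨b, artinWord_nil M ▸ one_dvd b, dvd_rfl⟩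
  | cons i ω ih =>
    obtain ⟨v, d, -, h_mul⟩ := exists_complementAct_eq cs b (cs.simple i)
    obtain ⟨z, hωz, y, rfl⟩ := ih d
    refine ⟨PresentedMonoid.of M.artinRel i * (d * y), mul_dvd_mul_left _ hωz, ?_⟩
    rw [← artinLift_simple cs i, ← mul_assoc, h_mul, mul_assoc]
    exact dvd_mul_right _ _

theorem isRightLCM_artinLift_weakJoin (cs : CoxeterSystem M W) (i j : B) :
    IsRightLCM {PresentedMonoid.of M.artinRel i, PresentedMonoid.of M.artinRel j}
      (artinLift cs (weakJoin cs (cs.simple i) (cs.simple j))) := by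
  refine isRightLCM_pair_iff.mpr ⟨?_, ?_, ?_⟩
  · rw [artinLift_weakJoin, artinLift_simple]
    exact dvd_mul_right _ _
  · rw [weakJoin_comm, artinLift_weakJoin, artinLift_simple]
    exact dvd_mul_right _ _
  · rintro _ ⟨x, rfl⟩ ⟨y, hy⟩
    obtain ⟨v, d, h_act, -⟩ :=
      exists_complementAct_eq cs y (weakComplement cs (cs.simple j) (cs.simple i))
    have h_read := complementAct_of_mul cs i x
    rw [hy, complementAct_mul, complementAct_of, h_act, one_mul] at h_read
    obtain rfl : artinLift cs (weakComplement cs (cs.simple i) (cs.simple j)) * d = x :=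
      congrArg Prod.snd h_read
    rw [← artinLift_simple cs i, ← mul_assoc, ← artinLift_weakJoin]
    exact dvd_mul_right _ _

end FiniteType

section ArtinLength

variable {B : Type*} (M : CoxeterMatrix B)

/-- The common length of all words that represent an element of the Artin monoid. -/
def artinLength (a : M.ArtinMonoid) : ℕ :=
  Multiplicative.toAdd <| PresentedMonoid.lift (rels := M.artinRel)
    (fun _ => Multiplicative.ofAdd 1) (by
      rintro _ _ ⟨i, j, -, rfl, rfl⟩
      simp only [FreeMonoid.lift_ofList, List.map_const', List.prod_replicate,
        length_alternatingFrom, M.symmetric j i]) a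

theorem artinLength_one : artinLength M 1 = 0 := by rw [artinLength, map_one, toAdd_one]

theorem artinLength_of (i : B) : artinLength M (PresentedMonoid.of M.artinRel i) = 1 := rfl

variable {M}

theorem artinLength_mul (a b : M.ArtinMonoid) :
    artinLength M (a * b) = artinLength M a + artinLength M b := by
  rw [artinLength, map_mul, toAdd_mul]
  rfl

theorem artinLength_eq_zero_iff {a : M.ArtinMonoid} : artinLength M a = 0 ↔ a = 1 := by
  refine ⟨fun h => ?_, fun h => h ▸ artinLength_one M⟩
  obtain ⟨_ | ⟨i, ω⟩, rfl⟩ := artinWord_surjective M a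
  · exact artinWord_nil M
  · rw [artinWord_cons, artinLength_mul, artinLength_of] at h
    omega

theorem isUnit_artinMonoid_iff {a : M.ArtinMonoid} : IsUnit a ↔ a = 1 := by
  refine ⟨fun h => ?_, fun h => h ▸ isUnit_one⟩
  obtain ⟨b, hb⟩ := h.exists_right_inv
  have h_add := artinLength_mul a b
  rw [hb, artinLength_one] at h_add
  exact artinLength_eq_zero_iff.mp (by omega)

variable (M)

theorem isFactorNoetherian_artinMonoid : IsFactorNoetherian M.ArtinMonoid := by
  refine Subrelation.wf ?_ (measure (artinLength M)).wf
  rintro f _ ⟨x, y, rfl, h⟩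
  change artinLength M f < artinLength M (x * f * y)
  rw [isUnit_artinMonoid_iff, isUnit_artinMonoid_iff, ← artinLength_eq_zero_iff,
    ← artinLength_eq_zero_iff] at h
  rw [artinLength_mul, artinLength_mul]
  omega

theorem irreducible_artinMonoid_eq : {p : M.ArtinMonoid | Irreducible p} = M.artinGenerators := by
  ext p
  constructor
  · intro (hp : Irreducible p)
    obtain ⟨_ | ⟨i, ω⟩, rfl⟩ := artinWord_surjective M p
    · exact absurd isUnit_one hp.not_isUnit
    · obtain h | h := (hp.isUnit_or_isUnit (artinWord_cons M i ω)).imp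
        isUnit_artinMonoid_iff.mp isUnit_artinMonoid_iff.mp
      · exact absurd (artinLength_of M i) (by simp [h, artinLength_one])
      · exact ⟨i, by rw [artinWord_cons, h, mul_one]⟩
  · rintro ⟨i, rfl⟩
    have h_length := artinLength_of M i
    refine ⟨fun h => ?_, fun x y h => ?_⟩
    · rw [isUnit_artinMonoid_iff, ← artinLength_eq_zero_iff] at h
      omega
    · rw [isUnit_artinMonoid_iff, isUnit_artinMonoid_iff, ← artinLength_eq_zero_iff,
        ← artinLength_eq_zero_iff]
      rw [h, artinLength_mul] at h_length
      omega

variable {M}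

theorem hasConditionalRightLCMs_artinMonoid {W : Type*} [Group W] [Finite W]
    (cs : CoxeterSystem M W) : HasConditionalRightLCMs M.ArtinMonoid := by
  have := isLeftCancelMul_artinMonoid cs
  rintro a b ⟨w, haw, hbw⟩
  simp only [isRightLCM_pair_iff]
  refine exists_lub_of_covers (α := M.ArtinMonoid) (r := (· ∣ ·))
    (cover := fun x y => ∃ i, y = x * PresentedMonoid.of M.artinRel i) dvd_refl dvd_trans
    (artinLength M) ?_ ?_ ?_ ?_ (one_dvd a) (one_dvd b) haw hbw
  · rintro a _ ⟨c, rfl⟩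
    exact artinLength_mul a c ▸ Nat.le_add_right _ _
  · rintro x _ ⟨i, rfl⟩
    refine ⟨dvd_mul_right _ _, ?_⟩
    rw [artinLength_mul, artinLength_of]
    exact Nat.lt_succ_self _
  · rintro x _ ⟨c, rfl⟩
    obtain ⟨_ | ⟨i, ω⟩, rfl⟩ := artinWord_surjective M c
    · exact .inl (by rw [artinWord_nil, mul_one])
    · exact .inr ⟨_, ⟨i, rfl⟩, mul_dvd_mul_left x (Dvd.intro _ (artinWord_cons M i ω).symm)⟩
  · rintro x _ _ w ⟨i, rfl⟩ ⟨j, rfl⟩ - -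
    exact ⟨_, isRightLCM_pair_iff.mp ((isRightLCM_artinLift_weakJoin cs i j).mul_left x)⟩

end ArtinLength

theorem mainTheorem4 :
    -- Noetherian directed right LCM monoids: trees are finite, and positivity reduces to atoms
    (∀ (P : Type*) [Monoid P] [IsLeftCancelMul P],
      IsFactorNoetherian P → HasConditionalRightLCMs P → IsRightDirected P →
      (∀ (n : ℕ) (l : ExtList P n),
        (∃ Λ, IsListTree l Λ) ∧ ∀ Λ, IsListTree l Λ → (treeNodes Λ).Finite) ∧
      (∀ (A : Type*) [NonUnitalCStarAlgebra A] [PartialOrder A] [StarOrderedRing A]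
        (X : ProductSystem P A) (N : P →* ℝ), (∀ p, 0 < N p) → (∀ u, IsUnit u → N u = 1) →
        ∀ (β : ℝ) (τ : A →L[ℂ] ℂ), IsTracialState τ → X.TraceUnitInvariant τ →
        (X.PositivityOn N β τ {p | p ≠ 1} ↔ X.PositivityOn N β τ {p | Irreducible p}))) ∧
    -- Artin monoids of finite type: positivity reduces to the canonical generators
    (∀ (B : Type*) (M : CoxeterMatrix B), Finite M.Group →
      ∀ (A : Type*) [NonUnitalCStarAlgebra A] [PartialOrder A] [StarOrderedRing A]
        (X : ProductSystem M.ArtinMonoid A) (N : M.ArtinMonoid →* ℝ), (∀ p, 0 < N p) →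
        ∀ (β : ℝ) (τ : A →L[ℂ] ℂ), IsTracialState τ →
        (X.PositivityOn N β τ {p | p ≠ 1} ↔ X.PositivityOn N β τ M.artinGenerators)) := by
  refine ⟨fun P _ _ hN hL hD => ⟨fun n l => ⟨exists_isListTree l, fun Λ hΛ =>
    treeNodes_finite hN hD hΛ⟩, fun A _ _ _ X N hN₀ hN₁ β τ hτ hinv =>
    X.positivityOn_ne_one_iff hN hL hD hN₀ hN₁ β hτ hinv⟩, ?_⟩
  intro B M _ A _ _ _ X N hN β τ hτ
  have := isLeftCancelMul_artinMonoid M.toCoxeterSystem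
  rw [← irreducible_artinMonoid_eq M]
  refine X.positivityOn_ne_one_iff (isFactorNoetherian_artinMonoid M)
    (hasConditionalRightLCMs_artinMonoid M.toCoxeterSystem)
    (isRightDirected_artinMonoid M.toCoxeterSystem) hN (fun u hu => ?_) β hτ
    (fun p u hu a _ => ?_)
  · rw [isUnit_artinMonoid_iff.mp hu, map_one]
  · rw [isUnit_artinMonoid_iff.mp hu, mul_one]
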